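/- **Conventions.** Let $\mathcal L$ be a single-sorted continuous signature: function symbols and $[0,1]$-valued predicate symbols $s$ with moduli $\delta_{s,i}\colon(0,1]\to(0,1]$ for each argument, and a distance symbol $d$ (with the identity as modulus). An $\mathcal L$-structure is a non-empty complete metric space of diameter at most $1$ in which $d(x_i,y)<\delta_{s,i}(\varepsilon)$ implies that replacing $x_i$ by $y$ changes $s(\bar x)$ by at most $\varepsilon$. Formulae are built with the connectives $\neg x=1-x$, $\frac12 x$, $x\dot- y=\max(x-y,0)$ and with $\inf$, $\sup$. We write $x\wedge y=x\dot-(x\dot- y)$ and $x\vee y=\neg(\neg x\wedge\neg y)$. A theory $T$ is a set of sentences, and $M\models T$ means $\varphi^M=0$ for all $\varphi\in T$. The signature $\mathcal L^R$ has a main sort with the function symbols of $\mathcal L$, an auxiliary sort with $0,\neg,\frac12,\dot-$, a distance on each sort, and for each predicate symbol $P$ of $\mathcal L$ (including $d$) a function symbol $[\![P]\!]$ from the main sort to the auxiliary sort. If $s\neq d$ is a symbol of $\mathcal L$ with modulus $\delta$, then $s$ (respectively $[\![s]\!]$) has in $\mathcal L^R$ the modulus $\varepsilon\mapsto\frac\varepsilon2\delta(\frac\varepsilon2)$;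 $[\![d]\!]$ and the operations of the auxiliary sort have the identity. Put $1=\neg 0$ and $E(X)=d(X,0)$ in the auxiliary sort. The theory $T_0^R$ consists of the following axioms (free variables are universally quantified). * $E(X)=E(X\dot-Y)+E(Y\wedge X)$; $E(1)=1$; $d(X,Y)=E(X\dot-Y)+E(Y\dot-X)$; $\tau=0$ for every $\{\neg,\frac12,\dot-\}$-term $\tau$ that is identically $0$ on $[0,1]$; and $\inf_Y\bigl(E(Y\wedge\neg Y)\vee|E(Y\wedge X)-\frac12E(X)|\bigr)=0$ (theory $ARV$ of atomless spaces of $[0,1]$-valued random variables). * (R1) For all $\varepsilon$: $(\delta_{f,i}(\varepsilon)\dot-[\![d(x,y)]\!])\wedge([\![d(f(\bar x',x,\bar y'),f(\bar x',y,\bar y'))]\!]\dot-\varepsilon)=0$ and $(\delta_{P,i}(\varepsilon)\dot-[\![d(x,y)]\!])\wedge([\![P(\bar x',x,\bar y')]\!]\dot-[\![P(\bar x',y,\bar y')]\!]\dot-\varepsilon)=0$, for all $f$, all $P$ (including $d$) and all argument places $i$; here dyadic constants approximate $\delta(\varepsilon)$ from below and $\varepsilon$ from above. * (R2) $d(x,y)=E[\![d(x,y)]\!]$.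 * (R3) $\inf_z E\bigl[([\![d(x,z)]\!]\wedge U)\vee([\![d(y,z)]\!]\wedge\neg U)\bigr]=0$ for all $x,y$ of the main sort and all $U$ of the auxiliary sort with $E(U\wedge\neg U)=0$. In a model of $T_0^R$ the auxiliary sort, ordered by $X\le Y\iff X\dot-Y=0$, is a complete lattice. For an $\mathcal L$-formula $\varphi(\bar x)$ and a tuple $\bar a$ of the main sort, define $[\![\varphi(\bar a)]\!]$ in the auxiliary sort by induction: atomic formulae through the symbols $[\![P]\!]$, connectives through the operations, and $[\![\inf_y\varphi]\!]$, $[\![\sup_y\varphi]\!]$ as the greatest lower bound and the least upper bound over the main sort. Finally $T^R=T_0^R\cup\{[\![\varphi]\!]=0:\varphi\in T\}$. For a set $I$ of variables, $S_I(T)$ is the space of complete types of $T$ in the variables $I$, and $S_I(T^R)$ the space of complete $\mathcal L^R$-types of $T^R$ in the main sort variables $I$, with the logic topology (the coarsest for which formulae are continuous). $\mathfrak R(X)$ is the space of regular Borel probability measures on $X$, with the weak topology, and $\langle\varphi,\mu\rangle=\int\varphi\,d\mu$. **Theorem.** Let $T$ be a (not necessarily complete) $\mathcal L$-theory. 1.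 $T^R$ eliminates quantifiers in the main sort down to formulae $E[\![\varphi(\bar x)]\!]$: for every $\mathcal L^R$-formula $\Phi$ whose free variables lie in $I$ (all of the main sort) and every $\varepsilon>0$ there is a combination $\tau$, by the connectives $\neg,\frac12,\dot-$, of finitely many $E[\![\varphi]\!]$, with $\varphi$ an $\mathcal L$-formula in the variables $I$, such that $|\Phi-\tau|\le\varepsilon$ at all tuples in all models of $T^R$. 2. For every $I$ and every $p\in S_I(T^R)$ there is a unique $\nu_p\in\mathfrak R(S_I(T))$ such that $\langle\varphi,\nu_p\rangle=E[\![\varphi]\!]^p$ for every $\mathcal L$-formula $\varphi$ in the variables $I$, where $E[\![\varphi]\!]^p$ is the value of $E[\![\varphi]\!]$ at any realisation of $p$. The map $p\mapsto\nu_p$ is a homeomorphism $S_I(T^R)\simeq\mathfrak R(S_I(T))$. 3. For every map $g\colon I\to J$, let $g^*\colon S_J(T)\to S_I(T)$ and $g^{*,R}\colon S_J(T^R)\to S_I(T^R)$ be the maps $\mathrm{tp}\bigl((a_j)_{j\in J}\bigr)\mapsto\mathrm{tp}\bigl((a_{g(i)})_{i\in I}\bigr)$. Then $\nu_{g^{*,R}(p)}$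 is the image measure of $\nu_p$ under $g^*$, for all $p\in S_J(T^R)$. 4. There is a bijection $\beta$ from the set of completions of $T^R$ onto the set of regular Borel probability measures on the space of completions of $T$ (with the logic topology), such that for every $N\models T^R$ and every $\mathcal L$-sentence $\varphi$, $E[\![\varphi]\!]^N=\int\varphi^C\,d\beta(\mathrm{Th}(N))(C)$, where $\varphi^C$ is the value of $\varphi$ in the models of the completion $C$. If $T$ is complete (it has a model, and all its models give the same values to sentences), then so is $T^R$. -/

import Mathlib

open MeasureTheory

universe u v w

namespace ContLogic

noncomputable section

/-! ### Continuous propositional logics -/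

/-- A continuous propositional logic: a set with operations `¬`, `½` and `∸`. -/
class CPL (S : Type*) where
  neg : S → S
  half : S → S
  tsub : S → S → S

/-- The standard connectives on truth values (only used on `[0,1]`). -/
instance : CPL ℝ where
  neg x := 1 - x
  half x := x / 2
  tsub x y := max (x - y) 0

namespace CPL

variable {S : Type*} [CPL S]

/-- `x ∧ y = x ∸ (x ∸ y)`. -/
def inf (x y : S) : S := tsub x (tsub x y)

/-- `x ∨ y = ¬(¬x ∧ ¬y)`. -/
def sup (x y : S) : S := neg (inf (neg x) (neg y))

/-- The dyadic constant `min (k / 2 ^ n) 1`, built from a given element `zero`, with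
`1 = ¬0`, `2 ^ (-n) = ½ ⋯ ½ 1` and `x ∔ y = ¬(¬x ∸ y)`. -/
def dyadic (zero : S) (k n : ℕ) : S :=
  (fun x => neg (tsub (neg x) (half^[n] (neg zero))))^[k] zero

end CPL

/-- The continuous propositional logic freely generated by `α`. -/
inductive FreeCPL (α : Type v) : Type v
  | var : α → FreeCPL α
  | neg : FreeCPL α → FreeCPL α
  | half : FreeCPL α → FreeCPL α
  | tsub : FreeCPL α → FreeCPL α → FreeCPL α

/-- The homomorphism from the free logic that extends a map defined on the generators. -/
def FreeCPL.eval {α : Type v} {S : Type w} [CPL S] (v : α → S) : FreeCPL α → S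
  | var x => v x
  | neg τ => CPL.neg (τ.eval v)
  | half τ => CPL.half (τ.eval v)
  | tsub τ σ => CPL.tsub (τ.eval v) (σ.eval v)

/-- `τ` is valid: its truth value is `0` (that is, "true") under all truth assignments. -/
def FreeCPL.Valid {α : Type v} (τ : FreeCPL α) : Prop :=
  ∀ v : α → ℝ, (∀ x, v x ∈ Set.Icc (0 : ℝ) 1) → τ.eval v = 0

/-! ### Continuous signatures, terms and formulae -/

/-- Uniform continuity moduli `(0,1] → (0,1]`. -/
abbrev Modulus := Set.Ioc (0 : ℝ) 1 → Set.Ioc (0 : ℝ) 1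

/-- The modulus `ε ↦ (ε/2) · δ(ε/2)`. -/
def Modulus.rand (δ : Modulus) : Modulus := fun ε =>
  let ε' : Set.Ioc (0 : ℝ) 1 := ⟨ε / 2, half_pos ε.2.1, (half_le_self ε.2.1.le).trans ε.2.2⟩
  ⟨ε' * δ ε', mul_pos ε'.2.1 (δ ε').2.1, mul_le_one₀ ε'.2.2 (δ ε').2.1.le (δ ε').2.2⟩

/-- A (single-sorted) continuous signature. The distance symbol is not listed: it is always
present, with the identity as its modulus in both arguments. -/
structure Signature where
  Func : ℕ → Type u
  Pred : ℕ → Type u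
  funMod : ∀ {n : ℕ}, Func n → Fin n → Modulus
  predMod : ∀ {n : ℕ}, Pred n → Fin n → Modulus

/-- Terms with variables in `α`. -/
inductive Term (L : Signature.{u}) (α : Type v) : Type (max u v)
  | var : α → Term L α
  | func : ∀ {n : ℕ}, L.Func n → (Fin n → Term L α) → Term L α

namespace Term

variable {L : Signature.{u}} {α : Type v} {β : Type w}

def eval {M : Type*} (F : ∀ {n : ℕ}, L.Func n → (Fin n → M) → M) (v : α → M) : Term L α → M
  | var x => v x
  | func f ts => F f fun i => (ts i).eval F v

def relabel (g : α → β) : Term L α → Term L β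
  | var x => var (g x)
  | func f ts => func f fun i => (ts i).relabel g

theorem eval_relabel {M : Type*} (F : ∀ {n : ℕ}, L.Func n → (Fin n → M) → M) (g : α → β)
    (v : β → M) (t : Term L α) : (t.relabel g).eval F v = t.eval F (v ∘ g) := by
  induction t with
  | var x => rfl
  | func f ts ih => simp only [relabel, eval, ih]

end Term

/-- Formulae of continuous logic with free variables in `I` and `n` further variables
`0, …, n - 1` (to be bound by quantifiers; a quantifier binds the last of them). -/
inductive BFormula (L : Signature.{u}) (I : Type v) : ℕ → Type (max u v)
  | dist {n : ℕ} : Term L (I ⊕ Fin n) → Term L (I ⊕ Fin n) → BFormula L I n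
  | pred {n k : ℕ} : L.Pred k → (Fin k → Term L (I ⊕ Fin n)) → BFormula L I n
  | neg {n : ℕ} : BFormula L I n → BFormula L I n
  | half {n : ℕ} : BFormula L I n → BFormula L I n
  | tsub {n : ℕ} : BFormula L I n → BFormula L I n → BFormula L I n
  | inf {n : ℕ} : BFormula L I (n + 1) → BFormula L I n
  | sup {n : ℕ} : BFormula L I (n + 1) → BFormula L I n

/-- Formulae whose free variables are in `I`. -/
abbrev Formula (L : Signature.{u}) (I : Type v) := BFormula L I 0

/-- Sentences. -/
abbrev Sentence (L : Signature.{u}) := Formula L PEmpty.{u + 1}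

/-- Renaming the free variables. -/
def BFormula.relabel {L : Signature.{u}} {I : Type v} {J : Type w} (g : I → J) :
    ∀ {n : ℕ}, BFormula L I n → BFormula L J n
  | _, dist s t => dist (s.relabel (Sum.map g id)) (t.relabel (Sum.map g id))
  | _, pred P ts => pred P fun i => (ts i).relabel (Sum.map g id)
  | _, neg φ => neg (φ.relabel g)
  | _, half φ => half (φ.relabel g)
  | _, tsub φ ψ => tsub (φ.relabel g) (ψ.relabel g)
  | _, inf φ => inf (φ.relabel g)
  | _, sup φ => sup (φ.relabel g)

/-! ### Structures, theories, types -/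

/-- An `L`-structure: a non-empty complete metric space of diameter at most `1`, with
interpretations of the symbols that respect the moduli. -/
structure Str (L : Signature.{u}) where
  Carrier : Type u
  [metric : MetricSpace Carrier]
  [complete : CompleteSpace Carrier]
  [nonempty : Nonempty Carrier]
  dist_le_one : ∀ x y : Carrier, dist x y ≤ 1
  func : ∀ {n : ℕ}, L.Func n → (Fin n → Carrier) → Carrier
  pred : ∀ {n : ℕ}, L.Pred n → (Fin n → Carrier) → ℝ
  pred_mem : ∀ {n : ℕ} (P : L.Pred n) (x : Fin n → Carrier), pred P x ∈ Set.Icc (0 : ℝ) 1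
  func_unif : ∀ {n : ℕ} (f : L.Func n) (i : Fin n) (ε : Set.Ioc (0 : ℝ) 1)
    (x : Fin n → Carrier) (y : Carrier), dist (x i) y < L.funMod f i ε →
      dist (func f x) (func f (Function.update x i y)) ≤ ε
  pred_unif : ∀ {n : ℕ} (P : L.Pred n) (i : Fin n) (ε : Set.Ioc (0 : ℝ) 1)
    (x : Fin n → Carrier) (y : Carrier), dist (x i) y < L.predMod P i ε →
      |pred P x - pred P (Function.update x i y)| ≤ ε

attribute [instance] Str.metric Str.complete Str.nonempty

/-- The value of a formula in a structure, at `a` for the free variables and `b` for the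
further ones. -/
def BFormula.value {L : Signature.{u}} {I : Type v} (M : Str L) (a : I → M.Carrier) :
    ∀ {n : ℕ}, BFormula L I n → (Fin n → M.Carrier) → ℝ
  | _, dist s t, b => Dist.dist (s.eval M.func (Sum.elim a b)) (t.eval M.func (Sum.elim a b))
  | _, pred P ts, b => M.pred P fun i => (ts i).eval M.func (Sum.elim a b)
  | _, neg φ, b => CPL.neg (φ.value M a b)
  | _, half φ, b => CPL.half (φ.value M a b)
  | _, tsub φ ψ, b => CPL.tsub (φ.value M a b) (ψ.value M a b)
  | _, inf φ, b => ⨅ c : M.Carrier, φ.value M a (Fin.snoc b c)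
  | _, sup φ, b => ⨆ c : M.Carrier, φ.value M a (Fin.snoc b c)

theorem BFormula.value_relabel {L : Signature.{u}} {I : Type v} {J : Type w} (M : Str L)
    (g : I → J) (a : J → M.Carrier) {n : ℕ} (φ : BFormula L I n) (b : Fin n → M.Carrier) :
    (φ.relabel g).value M a b = φ.value M (a ∘ g) b := by
  have key : ∀ (n : ℕ) (b : Fin n → M.Carrier),
      Sum.elim a b ∘ Sum.map g id = Sum.elim (a ∘ g) b := by
    intro n b
    funext x
    cases x <;> rfl
  induction φ <;> simp_all [BFormula.relabel, BFormula.value, Term.eval_relabel]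

namespace Str

variable {L : Signature.{u}} (M : Str L)

/-- The complete type of a tuple: the values of all formulae at this tuple. -/
def tp {I : Type v} (a : I → M.Carrier) : Formula L I → ℝ := fun φ => φ.value M a Fin.elim0

/-- The value of a sentence. -/
def sval (φ : Sentence L) : ℝ := M.tp PEmpty.elim φ

/-- `M ⊨ T`. -/
def Models (T : Set (Sentence L)) : Prop := ∀ φ ∈ T, M.sval φ = 0

/-- The complete theory of `M`. -/
def theory : Set (Sentence L) := {φ | M.sval φ = 0}

end Str

/-- The space of complete types of `T` in the variables `I`: those realised in models
of `T`. -/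
def TypeSpace {L : Signature.{u}} (T : Set (Sentence L)) (I : Type v) :=
  {p : Formula L I → ℝ // ∃ M : Str L, M.Models T ∧ ∃ a : I → M.Carrier, p = M.tp a}

/-- The coarsest topology for which the values of formulae are continuous. -/
instance {L : Signature.{u}} (T : Set (Sentence L)) (I : Type v) :
    TopologicalSpace (TypeSpace T I) :=
  TopologicalSpace.induced Subtype.val inferInstance

instance {L : Signature.{u}} (T : Set (Sentence L)) (I : Type v) :
    MeasurableSpace (TypeSpace T I) := borel _

instance {L : Signature.{u}} (T : Set (Sentence L)) (I : Type v) :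
    BorelSpace (TypeSpace T I) := ⟨rfl⟩

/-- For `g : I → J`, the map `tp (a_j)_{j ∈ J} ↦ tp (a_{g i})_{i ∈ I}`. -/
def TypeSpace.map {L : Signature.{u}} (T : Set (Sentence L)) {I : Type v} {J : Type w}
    (g : I → J) (p : TypeSpace T J) : TypeSpace T I :=
  ⟨fun φ => p.1 (φ.relabel g), by
    obtain ⟨M, hM, a, ha⟩ := p.2
    refine ⟨M, hM, a ∘ g, ?_⟩
    funext φ
    rw [ha]
    exact φ.value_relabel M g a _⟩

/-- The completions of `T`: the complete theories (of `L`-structures) that contain `T`. -/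
def Completion {L : Signature.{u}} (T : Set (Sentence L)) :=
  {C : Set (Sentence L) // ∃ M : Str L, M.Models T ∧ C = M.theory}

/-- The value of a sentence according to a completion (all models of a completion agree). -/
def Completion.sval {L : Signature.{u}} {T : Set (Sentence L)} (C : Completion T)
    (φ : Sentence L) : ℝ := C.2.choose.sval φ

/-- The logic topology: the sets `{C | φ ∈ C}` are a sub-basis of closed sets. -/
instance {L : Signature.{u}} (T : Set (Sentence L)) : TopologicalSpace (Completion T) :=
  TopologicalSpace.generateFrom {U | ∃ φ : Sentence L, U = {C | φ ∉ C.1}}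

instance {L : Signature.{u}} (T : Set (Sentence L)) : MeasurableSpace (Completion T) := borel _

instance {L : Signature.{u}} (T : Set (Sentence L)) : BorelSpace (Completion T) := ⟨rfl⟩

/-- `T` is complete: it has a model, and all models give the same values to sentences. -/
def IsCompleteTheory {L : Signature.{u}} (T : Set (Sentence L)) : Prop :=
  (∃ M : Str L, M.Models T) ∧
    ∀ M M' : Str L, M.Models T → M'.Models T → ∀ φ : Sentence L, M.sval φ = M'.sval φ

/-- Regular Borel probability measures, with the weak topology. -/
def RegProb (X : Type*) [TopologicalSpace X] [MeasurableSpace X] [BorelSpace X] :=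
  {μ : ProbabilityMeasure X // (μ : Measure X).Regular}

instance (X : Type*) [TopologicalSpace X] [MeasurableSpace X] [BorelSpace X] :
    TopologicalSpace (RegProb X) :=
  TopologicalSpace.induced Subtype.val inferInstance

/-- The underlying measure. -/
def RegProb.meas {X : Type*} [TopologicalSpace X] [MeasurableSpace X] [BorelSpace X]
    (μ : RegProb X) : Measure X := (μ.1 : Measure X)

/-! ### The randomisation signature

The signature `L^R` has a main sort with the function symbols of `L`, an auxiliary sort with
`0, ¬, ½, ∸`, and a function symbol `⟦P⟧` from the main to the auxiliary sort for every
predicate symbol `P` of `L` (the distance included). Its only predicates are the two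
distances. The terms of the main sort are the `L`-terms. -/

/-- `L^R`-terms of the auxiliary sort, with main variables in `α` and auxiliary ones in `β`. -/
inductive AuxTerm (L : Signature.{u}) (α : Type v) (β : Type w) : Type (max u v w)
  | var : β → AuxTerm L α β
  | zero : AuxTerm L α β
  | neg : AuxTerm L α β → AuxTerm L α β
  | half : AuxTerm L α β → AuxTerm L α β
  | tsub : AuxTerm L α β → AuxTerm L α β → AuxTerm L α β
  | brDist : Term L α → Term L α → AuxTerm L α β
  | brPred {k : ℕ} : L.Pred k → (Fin k → Term L α) → AuxTerm L α β

/-- `L^R`-formulae with free variables in `I`, all of the main sort, and with `m` further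
variables of the main sort and `k` of the auxiliary sort, to be bound by quantifiers. -/
inductive RBFormula (L : Signature.{u}) (I : Type v) : ℕ → ℕ → Type (max u v)
  | distMain {m k : ℕ} : Term L (I ⊕ Fin m) → Term L (I ⊕ Fin m) → RBFormula L I m k
  | distAux {m k : ℕ} : AuxTerm L (I ⊕ Fin m) (Fin k) → AuxTerm L (I ⊕ Fin m) (Fin k) →
      RBFormula L I m k
  | neg {m k : ℕ} : RBFormula L I m k → RBFormula L I m k
  | half {m k : ℕ} : RBFormula L I m k → RBFormula L I m k
  | tsub {m k : ℕ} : RBFormula L I m k → RBFormula L I m k → RBFormula L I m k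
  | infMain {m k : ℕ} : RBFormula L I (m + 1) k → RBFormula L I m k
  | supMain {m k : ℕ} : RBFormula L I (m + 1) k → RBFormula L I m k
  | infAux {m k : ℕ} : RBFormula L I m (k + 1) → RBFormula L I m k
  | supAux {m k : ℕ} : RBFormula L I m (k + 1) → RBFormula L I m k

/-- `L^R`-formulae whose free variables are in `I`, all of the main sort. -/
abbrev RFormula (L : Signature.{u}) (I : Type v) := RBFormula L I 0 0

/-- `L^R`-sentences. -/
abbrev RSentence (L : Signature.{u}) := RFormula L PEmpty.{u + 1}

def AuxTerm.relabel {L : Signature.{u}} {α α' : Type*} {β : Type w} (g : α → α') :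
    AuxTerm L α β → AuxTerm L α' β
  | var x => var x
  | zero => zero
  | neg τ => neg (τ.relabel g)
  | half τ => half (τ.relabel g)
  | tsub τ σ => tsub (τ.relabel g) (σ.relabel g)
  | brDist s t => brDist (s.relabel g) (t.relabel g)
  | brPred P ts => brPred P fun i => (ts i).relabel g

/-- Renaming the free variables. -/
def RBFormula.relabel {L : Signature.{u}} {I : Type v} {J : Type w} (g : I → J) :
    ∀ {m k : ℕ}, RBFormula L I m k → RBFormula L J m k
  | _, _, distMain s t => distMain (s.relabel (Sum.map g id)) (t.relabel (Sum.map g id))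
  | _, _, distAux s t => distAux (s.relabel (Sum.map g id)) (t.relabel (Sum.map g id))
  | _, _, neg φ => neg (φ.relabel g)
  | _, _, half φ => half (φ.relabel g)
  | _, _, tsub φ ψ => tsub (φ.relabel g) (ψ.relabel g)
  | _, _, infMain φ => infMain (φ.relabel g)
  | _, _, supMain φ => supMain (φ.relabel g)
  | _, _, infAux φ => infAux (φ.relabel g)
  | _, _, supAux φ => supAux (φ.relabel g)

/-- An `L^R`-structure. The symbols that come from `L` have the moduli
`ε ↦ (ε/2) · δ(ε/2)`, where `δ` is the modulus in `L`; the distance symbol `⟦d⟧` and the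
operations of the auxiliary sort have the identity as modulus. -/
structure RStr (L : Signature.{u}) where
  Main : Type u
  Aux : Type u
  [metricMain : MetricSpace Main]
  [completeMain : CompleteSpace Main]
  [nonemptyMain : Nonempty Main]
  [metricAux : MetricSpace Aux]
  [completeAux : CompleteSpace Aux]
  [cpl : CPL Aux]
  zero : Aux
  distMain_le_one : ∀ x y : Main, dist x y ≤ 1
  distAux_le_one : ∀ X Y : Aux, dist X Y ≤ 1
  func : ∀ {n : ℕ}, L.Func n → (Fin n → Main) → Main
  brDist : Main → Main → Aux
  brPred : ∀ {n : ℕ}, L.Pred n → (Fin n → Main) → Aux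
  func_unif : ∀ {n : ℕ} (f : L.Func n) (i : Fin n) (ε : Set.Ioc (0 : ℝ) 1)
    (x : Fin n → Main) (y : Main), dist (x i) y < (L.funMod f i).rand ε →
      dist (func f x) (func f (Function.update x i y)) ≤ ε
  brPred_unif : ∀ {n : ℕ} (P : L.Pred n) (i : Fin n) (ε : Set.Ioc (0 : ℝ) 1)
    (x : Fin n → Main) (y : Main), dist (x i) y < (L.predMod P i).rand ε →
      dist (brPred P x) (brPred P (Function.update x i y)) ≤ ε
  brDist_unif_left : ∀ x y z : Main, dist (brDist x z) (brDist y z) ≤ dist x y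
  brDist_unif_right : ∀ x y z : Main, dist (brDist z x) (brDist z y) ≤ dist x y
  neg_unif : ∀ X Y : Aux, dist (CPL.neg X) (CPL.neg Y) ≤ dist X Y
  half_unif : ∀ X Y : Aux, dist (CPL.half X) (CPL.half Y) ≤ dist X Y
  tsub_unif_left : ∀ X Y Z : Aux, dist (CPL.tsub X Z) (CPL.tsub Y Z) ≤ dist X Y
  tsub_unif_right : ∀ X Y Z : Aux, dist (CPL.tsub Z X) (CPL.tsub Z Y) ≤ dist X Y

attribute [instance] RStr.metricMain RStr.completeMain RStr.nonemptyMain RStr.metricAux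
  RStr.completeAux RStr.cpl

def AuxTerm.eval {L : Signature.{u}} (N : RStr L) {α : Type v} {β : Type w}
    (a : α → N.Main) (X : β → N.Aux) : AuxTerm L α β → N.Aux
  | var x => X x
  | zero => N.zero
  | neg τ => CPL.neg (τ.eval N a X)
  | half τ => CPL.half (τ.eval N a X)
  | tsub τ σ => CPL.tsub (τ.eval N a X) (σ.eval N a X)
  | brDist s t => N.brDist (s.eval N.func a) (t.eval N.func a)
  | brPred P ts => N.brPred P fun i => (ts i).eval N.func a

theorem AuxTerm.eval_relabel {L : Signature.{u}} (N : RStr L) {α α' : Type*} {β : Type w}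
    (g : α → α') (a : α' → N.Main) (X : β → N.Aux) (τ : AuxTerm L α β) :
    (τ.relabel g).eval N a X = τ.eval N (a ∘ g) X := by
  induction τ <;> simp_all [AuxTerm.relabel, AuxTerm.eval, Term.eval_relabel]

/-- The value of an `L^R`-formula at `a` (free variables), `b` and `X` (further variables of
the main and of the auxiliary sort). -/
def RBFormula.value {L : Signature.{u}} {I : Type v} (N : RStr L) (a : I → N.Main) :
    ∀ {m k : ℕ}, RBFormula L I m k → (Fin m → N.Main) → (Fin k → N.Aux) → ℝ
  | _, _, distMain s t, b, _ => dist (s.eval N.func (Sum.elim a b)) (t.eval N.func (Sum.elim a b))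
  | _, _, distAux s t, b, X => dist (s.eval N (Sum.elim a b) X) (t.eval N (Sum.elim a b) X)
  | _, _, neg φ, b, X => CPL.neg (φ.value N a b X)
  | _, _, half φ, b, X => CPL.half (φ.value N a b X)
  | _, _, tsub φ ψ, b, X => CPL.tsub (φ.value N a b X) (ψ.value N a b X)
  | _, _, infMain φ, b, X => ⨅ c : N.Main, φ.value N a (Fin.snoc b c) X
  | _, _, supMain φ, b, X => ⨆ c : N.Main, φ.value N a (Fin.snoc b c) X
  | _, _, infAux φ, b, X => ⨅ Y : N.Aux, φ.value N a b (Fin.snoc X Y)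
  | _, _, supAux φ, b, X => ⨆ Y : N.Aux, φ.value N a b (Fin.snoc X Y)

theorem RBFormula.value_relabel {L : Signature.{u}} {I : Type v} {J : Type w} (N : RStr L)
    (g : I → J) (a : J → N.Main) {m k : ℕ} (φ : RBFormula L I m k) (b : Fin m → N.Main)
    (X : Fin k → N.Aux) : (φ.relabel g).value N a b X = φ.value N (a ∘ g) b X := by
  have key : ∀ (n : ℕ) (b : Fin n → N.Main),
      Sum.elim a b ∘ Sum.map g id = Sum.elim (a ∘ g) b := by
    intro n b
    funext x
    cases x <;> rfl
  induction φ <;>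
    simp_all [RBFormula.relabel, RBFormula.value, Term.eval_relabel, AuxTerm.eval_relabel]

/-! ### The randomised theory -/

namespace RStr

variable {L : Signature.{u}} (N : RStr L)

/-- The expectation `E(X) = d(X, 0)`. -/
def E (X : N.Aux) : ℝ := dist X N.zero

/-- The order of the auxiliary sort: `X ≤ Y` if and only if `X ∸ Y = 0`. -/
def AuxLE (X Y : N.Aux) : Prop := CPL.tsub X Y = N.zero

open Classical in
/-- The greatest lower bound of a set in the auxiliary sort. In models of `RV` it exists and
is unique, so that the second case does not occur. -/
def auxInf (S : Set N.Aux) : N.Aux :=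
  if h : ∃ X, (∀ Y ∈ S, N.AuxLE X Y) ∧ ∀ Z, (∀ Y ∈ S, N.AuxLE Z Y) → N.AuxLE Z X
  then h.choose else N.zero

open Classical in
/-- The least upper bound of a set in the auxiliary sort. In models of `RV` it exists and
is unique, so that the second case does not occur. -/
def auxSup (S : Set N.Aux) : N.Aux :=
  if h : ∃ X, (∀ Y ∈ S, N.AuxLE Y X) ∧ ∀ Z, (∀ Y ∈ S, N.AuxLE Y Z) → N.AuxLE X Z
  then h.choose else N.zero

/-- The condition `(δ(ε) ∸ D) ∧ (X ∸ ε) = 0` for all `ε`. As the auxiliary sort has terms for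
dyadic constants only, `δ(ε)` is approximated from below and `ε` from above. -/
def Controls (δ : Modulus) (D X : N.Aux) : Prop :=
  ∀ (ε : Set.Ioc (0 : ℝ) 1) (k n j m : ℕ), (k : ℝ) / 2 ^ n ≤ δ ε → (ε : ℝ) ≤ (j : ℝ) / 2 ^ m →
    CPL.inf (CPL.tsub (CPL.dyadic N.zero k n) D) (CPL.tsub X (CPL.dyadic N.zero j m)) = N.zero

/-- The theory `RV` of spaces of `[0,1]`-valued random variables, in the auxiliary sort. -/
structure IsRV : Prop where
  rv1 : ∀ X Y : N.Aux, N.E X = N.E (CPL.tsub X Y) + N.E (CPL.inf Y X)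
  rv2 : N.E (CPL.neg N.zero) = 1
  rv3 : ∀ X Y : N.Aux, dist X Y = N.E (CPL.tsub X Y) + N.E (CPL.tsub Y X)
  rv4 : ∀ τ : FreeCPL ℕ, τ.Valid → ∀ X : ℕ → N.Aux, τ.eval X = N.zero

/-- The theory `ARV`: in addition, the underlying probability space is atomless. -/
structure IsARV : Prop extends N.IsRV where
  arv : ∀ X : N.Aux,
    ⨅ Y : N.Aux, max (N.E (CPL.inf Y (CPL.neg Y))) |N.E (CPL.inf Y X) - N.E X / 2| = 0

/-- The theory `T₀^R`: `ARV` together with the axioms R1, R2 and R3. In R3, `U` ranges over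
the probability algebra of the auxiliary sort. -/
structure IsT0R : Prop extends N.IsARV where
  r1_func : ∀ {n : ℕ} (f : L.Func n) (i : Fin n) (x : Fin n → N.Main) (y : N.Main),
    N.Controls (L.funMod f i) (N.brDist (x i) y)
      (N.brDist (N.func f x) (N.func f (Function.update x i y)))
  r1_pred : ∀ {n : ℕ} (P : L.Pred n) (i : Fin n) (x : Fin n → N.Main) (y : N.Main),
    N.Controls (L.predMod P i) (N.brDist (x i) y)
      (CPL.tsub (N.brPred P x) (N.brPred P (Function.update x i y)))
  r1_dist_left : ∀ x y z : N.Main,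
    N.Controls id (N.brDist x y) (CPL.tsub (N.brDist x z) (N.brDist y z))
  r1_dist_right : ∀ x y z : N.Main,
    N.Controls id (N.brDist x y) (CPL.tsub (N.brDist z x) (N.brDist z y))
  r2 : ∀ x y : N.Main, dist x y = N.E (N.brDist x y)
  r3 : ∀ (x y : N.Main) (U : N.Aux), N.E (CPL.inf U (CPL.neg U)) = 0 →
    ⨅ z : N.Main, N.E (CPL.sup (CPL.inf (N.brDist x z) U)
      (CPL.inf (N.brDist y z) (CPL.neg U))) = 0

end RStr

/-- The random variable `⟦φ⟧`, for an `L`-formula `φ`. -/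
def BFormula.bracket {L : Signature.{u}} {I : Type v} (N : RStr L) (a : I → N.Main) :
    ∀ {n : ℕ}, BFormula L I n → (Fin n → N.Main) → N.Aux
  | _, dist s t, b => N.brDist (s.eval N.func (Sum.elim a b)) (t.eval N.func (Sum.elim a b))
  | _, pred P ts, b => N.brPred P fun i => (ts i).eval N.func (Sum.elim a b)
  | _, neg φ, b => CPL.neg (φ.bracket N a b)
  | _, half φ, b => CPL.half (φ.bracket N a b)
  | _, tsub φ ψ, b => CPL.tsub (φ.bracket N a b) (ψ.bracket N a b)
  | _, inf φ, b => N.auxInf (Set.range fun c : N.Main => φ.bracket N a (Fin.snoc b c))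
  | _, sup φ, b => N.auxSup (Set.range fun c : N.Main => φ.bracket N a (Fin.snoc b c))

namespace RStr

variable {L : Signature.{u}} (N : RStr L)

/-- `⟦φ(a)⟧`. -/
def br {I : Type v} (a : I → N.Main) (φ : Formula L I) : N.Aux := φ.bracket N a Fin.elim0

/-- The complete `L^R`-type of a tuple of the main sort. -/
def tp {I : Type v} (a : I → N.Main) : RFormula L I → ℝ :=
  fun φ => φ.value N a Fin.elim0 Fin.elim0

/-- The value of an `L^R`-sentence. -/
def sval (φ : RSentence L) : ℝ := N.tp PEmpty.elim φ

/-- The complete `L^R`-theory of `N`. -/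
def theory : Set (RSentence L) := {φ | N.sval φ = 0}

/-- `N ⊨ T^R`, where `T^R` consists of `T₀^R` and of `⟦φ⟧ = 0` for all `φ ∈ T`. -/
def ModelsR (T : Set (Sentence L)) : Prop :=
  N.IsT0R ∧ ∀ φ ∈ T, N.br PEmpty.elim φ = N.zero

end RStr

/-- The space of complete types of `T^R` in the main sort variables `I`. -/
def RTypeSpace {L : Signature.{u}} (T : Set (Sentence L)) (I : Type v) :=
  {p : RFormula L I → ℝ // ∃ N : RStr L, N.ModelsR T ∧ ∃ a : I → N.Main, p = N.tp a}

/-- The coarsest topology for which the values of `L^R`-formulae are continuous. -/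
instance {L : Signature.{u}} (T : Set (Sentence L)) (I : Type v) :
    TopologicalSpace (RTypeSpace T I) :=
  TopologicalSpace.induced Subtype.val inferInstance

/-- For `g : I → J`, the map `tp (a_j)_{j ∈ J} ↦ tp (a_{g i})_{i ∈ I}`. -/
def RTypeSpace.map {L : Signature.{u}} (T : Set (Sentence L)) {I : Type v} {J : Type w}
    (g : I → J) (p : RTypeSpace T J) : RTypeSpace T I :=
  ⟨fun φ => p.1 (φ.relabel g), by
    obtain ⟨N, hN, a, ha⟩ := p.2
    refine ⟨N, hN, a ∘ g, ?_⟩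
    funext φ
    rw [ha]
    exact φ.value_relabel N g a _ _⟩

/-- `E⟦φ⟧^p = ⟨φ, μ⟩` for all `L`-formulae `φ`, where `E⟦φ⟧^p` is the value of `E⟦φ⟧` at any
realisation of `p`. -/
def Represents {L : Signature.{u}} {T : Set (Sentence L)} {I : Type v}
    (μ : RegProb (TypeSpace T I)) (p : RTypeSpace T I) : Prop :=
  ∀ (N : RStr L), N.ModelsR T → ∀ a : I → N.Main, p.1 = N.tp a →
    ∀ φ : Formula L I, N.E (N.br a φ) = ∫ q, q.1 φ ∂μ.meas

/-- The completions of `T^R`. -/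
def RCompletion {L : Signature.{u}} (T : Set (Sentence L)) :=
  {C : Set (RSentence L) // ∃ N : RStr L, N.ModelsR T ∧ C = N.theory}

/-- `T^R` is complete. -/
def IsCompleteTheoryR {L : Signature.{u}} (T : Set (Sentence L)) : Prop :=
  (∃ N : RStr L, N.ModelsR T) ∧
    ∀ N N' : RStr L, N.ModelsR T → N'.ModelsR T → ∀ φ : RSentence L, N.sval φ = N'.sval φ

end

end ContLogic

open ContLogic

/-! A model of `T₀^R` is a measurable field of `L`-structures seen through its random elements. The
axioms of `RV` make the expectation a positive functional on the terms over the auxiliary sort,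
hence integration against a regular probability measure on a cube. This measure lives on the closed
set of homomorphisms into `[0,1]`, which represents the auxiliary sort by random variables with
pointwise operations (`RStr.IsRV.nonempty_rep`). At each point `ω`, R1 yields an `L`-structure in
which the image of the main sort is dense. R3 and completeness give exact gluing of two random
elements along an event, almost everywhere (`Rep.exists_glue`). Gluing makes infima over the main
sort attained up to `ε`, uniformly in `ω` (`Rep.exists_inf`), so the value of `⟦φ(a)⟧` at `ω` is the
value of `φ` at `a(ω)` in the fibre (`Rep.r_bracket`). Thus a tuple is a random type of `T`, and
`ν_p` is its law.

Quantifier elimination says that this law determines the whole type. The inductive claim is that the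
value of a formula is uniformly determined by finitely many expectations of combinations of the
given random variables (`Determined`). For a quantifier, a near-optimal new element in one model is
rounded to a random choice among finitely many grid vectors. Whether a grid vector is attainable at
`ω` is measured by an old random variable, essentially an infimum formula. As the old variables have
nearly the same law in the second model, and as its probability space is atomless, the random choice
can be imitated there with nearly the same frequencies (`exists_similar_choice`), and gluing
realises it by a new element (`Determined.iInf`). A Lipschitz extension and density of the
connectives turn `Determined` into a term.

Conversely, every regular measure on the types of `T` comes from a model: choose a model realising
each type and take all families of points. The choice is not measurable, so integration is first
extended to a finitely additive mean on all bounded functions. An ultraproduct of averages then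
makes the mean atomless and saturated enough for spaces of random elements to be complete
(`Mean.exists_rich`). The resulting structure satisfies `T^R`, with brackets computed pointwise.

Finally, each `E⟦φ⟧` is itself the value of an `L^R`-formula (`BFormula.value_expectation`), which
makes `p ↦ ν_p` continuous; quantifier elimination makes its inverse continuous. Naturality compares
integrals of formulae, and completions are types in no variables. -/

namespace ContLogic

open Filter Topology CompactlySupported

noncomputable section

/-! ### Continuous propositional logics: homomorphisms and real truth values -/

namespace CPL

/-- Homomorphisms of continuous propositional logics. -/
structure IsHom {S S' : Type*} [CPL S] [CPL S'] (h : S → S') : Prop where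
  neg : ∀ x, h (CPL.neg x) = CPL.neg (h x)
  half : ∀ x, h (CPL.half x) = CPL.half (h x)
  tsub : ∀ x y, h (CPL.tsub x y) = CPL.tsub (h x) (h y)

namespace IsHom

variable {S S' : Type*} [CPL S] [CPL S'] {h : S → S'}

theorem inf (hh : IsHom h) (x y : S) : h (CPL.inf x y) = CPL.inf (h x) (h y) := by
  simp only [CPL.inf, hh.tsub]

theorem sup (hh : IsHom h) (x y : S) : h (CPL.sup x y) = CPL.sup (h x) (h y) := by
  simp only [CPL.sup, hh.inf, hh.neg]

theorem half_iterate (hh : IsHom h) (n : ℕ) (x : S) :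
    h (CPL.half^[n] x) = CPL.half^[n] (h x) := by
  induction n generalizing x with
  | zero => rfl
  | succ n ih => simp only [Function.iterate_succ, Function.comp, ih, hh.half]

theorem dyadic (hh : IsHom h) (z : S) (k n : ℕ) :
    h (CPL.dyadic z k n) = CPL.dyadic (h z) k n := by
  unfold CPL.dyadic
  induction k with
  | zero => rfl
  | succ k ih =>
    simp only [Function.iterate_succ_apply', hh.neg, hh.tsub, hh.half_iterate, ih]

end IsHom

theorem neg_real (x : ℝ) : CPL.neg x = 1 - x := rfl

theorem half_real (x : ℝ) : CPL.half x = x / 2 := rfl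

theorem tsub_real (x y : ℝ) : CPL.tsub x y = max (x - y) 0 := rfl

theorem inf_real {x y : ℝ} (hx : 0 ≤ x) (hy : 0 ≤ y) : CPL.inf x y = min x y := by
  simp only [CPL.inf, tsub_real]
  grind

theorem sup_real {x y : ℝ} (hx : x ≤ 1) (hy : y ≤ 1) : CPL.sup x y = max x y := by
  simp only [CPL.sup]
  rw [inf_real (by rw [neg_real]; linarith) (by rw [neg_real]; linarith)]
  simp only [neg_real]
  grind

theorem half_iterate_real (n : ℕ) (x : ℝ) : CPL.half^[n] x = x / 2 ^ n := by
  induction n generalizing x with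
  | zero => simp
  | succ n ih =>
    rw [Function.iterate_succ_apply, ih, half_real, pow_succ]
    field_simp

theorem dyadic_real (k n : ℕ) : CPL.dyadic (0 : ℝ) k n = min ((k : ℝ) / 2 ^ n) 1 := by
  unfold CPL.dyadic
  induction k with
  | zero => simp
  | succ k ih =>
    have h2 : (0 : ℝ) ≤ 1 / 2 ^ n := by positivity
    rw [Function.iterate_succ_apply', ih, half_iterate_real]
    simp only [neg_real, tsub_real]
    have : ((k + 1 : ℕ) : ℝ) / 2 ^ n = (k : ℝ) / 2 ^ n + 1 / 2 ^ n := by push_cast; ring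
    rw [this, sub_zero]
    grind

/-- Truncated addition. -/
def tadd {S : Type*} [CPL S] (x y : S) : S := neg (tsub (neg x) y)

theorem tadd_real (x y : ℝ) : tadd x y = min (x + y) 1 := by
  simp only [tadd, neg_real, tsub_real]
  grind

theorem IsHom.tadd {S S' : Type*} [CPL S] [CPL S'] {h : S → S'} (hh : IsHom h) (x y : S) :
    h (CPL.tadd x y) = CPL.tadd (h x) (h y) := by
  simp only [CPL.tadd, hh.neg, hh.tsub]

theorem neg_mem {x : ℝ} (hx : x ∈ Set.Icc (0 : ℝ) 1) : CPL.neg x ∈ Set.Icc (0 : ℝ) 1 := by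
  rw [neg_real]; constructor <;> linarith [hx.1, hx.2]

theorem half_mem {x : ℝ} (hx : x ∈ Set.Icc (0 : ℝ) 1) : CPL.half x ∈ Set.Icc (0 : ℝ) 1 := by
  rw [half_real]; constructor <;> linarith [hx.1, hx.2]

theorem tsub_mem {x y : ℝ} (hx : x ∈ Set.Icc (0 : ℝ) 1) (hy : y ∈ Set.Icc (0 : ℝ) 1) :
    CPL.tsub x y ∈ Set.Icc (0 : ℝ) 1 := by
  rw [tsub_real]; exact ⟨le_max_right _ _, max_le (by linarith [hx.2, hy.1]) zero_le_one⟩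

end CPL

namespace FreeCPL

instance instCPL {α : Type v} : CPL (FreeCPL α) := ⟨neg, half, tsub⟩

variable {α : Type v}

theorem isHom_eval {S : Type w} [CPL S] (v : α → S) : CPL.IsHom (FreeCPL.eval v) :=
  ⟨fun _ => rfl, fun _ => rfl, fun _ _ => rfl⟩

/-- Used both semantically, with `h` the evaluation of random variables at a point, and
syntactically, with `h` an evaluation of terms, where it is the substitution lemma. -/
theorem map_eval {S S' : Type*} [CPL S] [CPL S'] {h : S → S'} (hh : CPL.IsHom h)
    (v : α → S) (τ : FreeCPL α) : h (τ.eval v) = τ.eval (fun x => h (v x)) := by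
  induction τ with
  | var x => rfl
  | neg τ ih => simp only [eval, hh.neg, ih]
  | half τ ih => simp only [eval, hh.half, ih]
  | tsub τ σ ih ih' => simp only [eval, hh.tsub, ih, ih']

open Classical in
/-- The variables of a term. -/
def vars : FreeCPL α → Finset α
  | var x => {x}
  | neg τ => τ.vars
  | half τ => τ.vars
  | tsub τ σ => τ.vars ∪ σ.vars

/-- A Lipschitz constant of a term for the supremum distance. -/
def lip : FreeCPL α → ℝ
  | var _ => 1
  | neg τ => τ.lip
  | half τ => τ.lip
  | tsub τ σ => τ.lip + σ.lip

theorem lip_nonneg (τ : FreeCPL α) : 0 ≤ τ.lip := by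
  induction τ with
  | var x => exact zero_le_one
  | neg τ ih => exact ih
  | half τ ih => exact ih
  | tsub τ σ ih ih' => exact add_nonneg ih ih'

theorem eval_congr {S : Type w} [CPL S] {v v' : α → S} (τ : FreeCPL α)
    (h : ∀ x ∈ τ.vars, v x = v' x) : τ.eval v = τ.eval v' := by
  induction τ with
  | var x => exact h x (by simp [vars])
  | neg τ ih => simp only [eval, ih h]
  | half τ ih => simp only [eval, ih h]
  | tsub τ σ ih ih' =>
    simp only [vars, Finset.mem_union] at h
    simp only [eval, ih fun x hx => h x (Or.inl hx), ih' fun x hx => h x (Or.inr hx)]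

theorem abs_eval_sub_le {v v' : α → ℝ} {e : ℝ} (τ : FreeCPL α)
    (h : ∀ x ∈ τ.vars, |v x - v' x| ≤ e) : |τ.eval v - τ.eval v'| ≤ τ.lip * e := by
  induction τ with
  | var x => simpa [lip, eval] using h x (by simp [vars])
  | neg τ ih =>
    have := ih h
    simp only [eval, lip, CPL.neg_real]
    rwa [sub_sub_sub_cancel_left, abs_sub_comm]
  | half τ ih =>
    have := ih h
    simp only [eval, lip, CPL.half_real]
    rw [← sub_div, abs_div, abs_two]
    linarith [abs_nonneg (τ.eval v - τ.eval v')]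
  | tsub τ σ ih ih' =>
    simp only [vars, Finset.mem_union] at h
    have h1 := ih fun x hx => h x (Or.inl hx)
    have h2 := ih' fun x hx => h x (Or.inr hx)
    simp only [eval, lip, CPL.tsub_real, add_mul]
    refine (abs_max_sub_max_le_abs _ _ _).trans ?_
    calc |τ.eval v - σ.eval v - (τ.eval v' - σ.eval v')|
        = |(τ.eval v - τ.eval v') - (σ.eval v - σ.eval v')| := by ring_nf
      _ ≤ _ := (abs_sub _ _).trans (add_le_add h1 h2)

theorem eval_mem {v : α → ℝ} (hv : ∀ x, v x ∈ Set.Icc (0 : ℝ) 1) (τ : FreeCPL α) :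
    τ.eval v ∈ Set.Icc (0 : ℝ) 1 := by
  induction τ with
  | var x => exact hv x
  | neg τ ih => exact CPL.neg_mem ih
  | half τ ih => exact CPL.half_mem ih
  | tsub τ σ ih ih' => exact CPL.tsub_mem ih ih'

theorem continuous_eval {X : Type*} [TopologicalSpace X] {f : α → X → ℝ}
    (hf : ∀ a, Continuous (f a)) (τ : FreeCPL α) :
    Continuous fun x => τ.eval fun a => f a x := by
  induction τ with
  | var x => exact hf x
  | neg τ ih => exact continuous_const.sub ih
  | half τ ih => exact ih.div_const 2
  | tsub τ σ ih ih' => exact (ih.sub ih').max continuous_const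

end FreeCPL

/-! ### Density of sets of continuous functions closed under the connectives -/

/-- A non-empty set of continuous `[0,1]`-valued functions that is closed under the connectives. -/
structure ConnClosed {X : Type*} [TopologicalSpace X] (A : Set C(X, ℝ)) : Prop where
  nonempty : A.Nonempty
  mem : ∀ f ∈ A, ∀ x, f x ∈ Set.Icc (0 : ℝ) 1
  neg : ∀ f ∈ A, ∃ g ∈ A, ∀ x, g x = 1 - f x
  half : ∀ f ∈ A, ∃ g ∈ A, ∀ x, g x = f x / 2
  tsub : ∀ f ∈ A, ∀ f' ∈ A, ∃ g ∈ A, ∀ x, g x = max (f x - f' x) 0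

namespace ConnClosed

variable {X : Type*} [TopologicalSpace X] {A : Set C(X, ℝ)}

theorem zero (hA : ConnClosed A) : ∃ g ∈ A, ∀ x, g x = 0 := by
  obtain ⟨f, hf⟩ := hA.nonempty
  obtain ⟨g, hg, h⟩ := hA.tsub f hf f hf
  exact ⟨g, hg, fun x => by simp [h x]⟩

theorem one (hA : ConnClosed A) : ∃ g ∈ A, ∀ x, g x = 1 := by
  obtain ⟨f, hf, h0⟩ := hA.zero
  obtain ⟨g, hg, h⟩ := hA.neg f hf
  exact ⟨g, hg, fun x => by simp [h x, h0 x]⟩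

theorem min (hA : ConnClosed A) {f f' : C(X, ℝ)} (hf : f ∈ A) (hf' : f' ∈ A) :
    ∃ g ∈ A, ∀ x, g x = min (f x) (f' x) := by
  obtain ⟨g, hg, h⟩ := hA.tsub f hf f' hf'
  obtain ⟨k, hk, h'⟩ := hA.tsub f hf g hg
  refine ⟨k, hk, fun x => ?_⟩
  have h1 := (hA.mem f hf x).1
  have h2 := (hA.mem f' hf' x).1
  rw [h' x, h x]
  grind

theorem tadd (hA : ConnClosed A) {f f' : C(X, ℝ)} (hf : f ∈ A) (hf' : f' ∈ A) :
    ∃ g ∈ A, ∀ x, g x = Min.min (f x + f' x) 1 := by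
  obtain ⟨g, hg, h⟩ := hA.neg f hf
  obtain ⟨k, hk, h'⟩ := hA.tsub g hg f' hf'
  obtain ⟨l, hl, h''⟩ := hA.neg k hk
  refine ⟨l, hl, fun x => ?_⟩
  rw [h'' x, h' x, h x]
  grind

theorem average (hA : ConnClosed A) {f f' : C(X, ℝ)} (hf : f ∈ A) (hf' : f' ∈ A) :
    ∃ g ∈ A, ∀ x, g x = (f x + f' x) / 2 := by
  obtain ⟨g, hg, h⟩ := hA.half f hf
  obtain ⟨k, hk, h'⟩ := hA.half f' hf'
  obtain ⟨l, hl, h''⟩ := hA.tadd hg hk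
  refine ⟨l, hl, fun x => ?_⟩
  have h1 := (hA.mem f hf x).2
  have h2 := (hA.mem f' hf' x).2
  rw [h'' x, h' x, h x]
  grind

theorem two_pow_mul (hA : ConnClosed A) {f : C(X, ℝ)} (hf : f ∈ A) (n : ℕ) :
    ∃ g ∈ A, ∀ x, g x = Min.min (2 ^ n * f x) 1 := by
  induction n with
  | zero =>
    refine ⟨f, hf, fun x => ?_⟩
    have := (hA.mem f hf x).2
    simp [this]
  | succ n ih =>
    obtain ⟨g, hg, h⟩ := ih
    obtain ⟨k, hk, h'⟩ := hA.tadd hg hg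
    refine ⟨k, hk, fun x => ?_⟩
    have : 0 ≤ 2 ^ n * f x := mul_nonneg (by positivity) (hA.mem f hf x).1
    rw [h' x, h x, pow_succ, show (2 : ℝ) ^ n * 2 * f x = 2 ^ n * f x + 2 ^ n * f x by ring]
    grind

/-- The dyadic vector space generated by `A`. -/
def span (hA : ConnClosed A) : AddSubgroup C(X, ℝ) where
  -- A representation is asked for at every large scale `2 ^ n`, so that two elements always have a
  -- common scale, with room for the averages that replace sums.
  carrier := {F | ∃ N : ℕ, ∀ n ≥ N, ∃ g ∈ A, ∃ h ∈ A, ∀ x, F x = 2 ^ n * (g x - h x)}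
  zero_mem' := by
    obtain ⟨g, hg, h⟩ := hA.zero
    exact ⟨0, fun n _ => ⟨g, hg, g, hg, fun x => by simp⟩⟩
  neg_mem' := by
    rintro F ⟨N, hN⟩
    refine ⟨N, fun n hn => ?_⟩
    obtain ⟨g, hg, h, hh, e⟩ := hN n hn
    refine ⟨h, hh, g, hg, fun x => ?_⟩
    rw [ContinuousMap.neg_apply, e x]
    ring
  add_mem' := by
    rintro F F' ⟨N, hN⟩ ⟨N', hN'⟩
    refine ⟨N + N' + 1, fun n hn => ?_⟩
    obtain ⟨m, rfl⟩ : ∃ m, n = m + 1 := ⟨n - 1, by omega⟩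
    obtain ⟨g, hg, h, hh, e⟩ := hN m (by omega)
    obtain ⟨g', hg', h', hh', e'⟩ := hN' m (by omega)
    obtain ⟨k, hk, ek⟩ := hA.average hg hg'
    obtain ⟨l, hl, el⟩ := hA.average hh hh'
    refine ⟨k, hk, l, hl, fun x => ?_⟩
    rw [ContinuousMap.add_apply, e x, e' x, ek x, el x]
    ring

/-- At a common scale, `min (g - h) (g' - h') = min (g + h') (g' + h) - (h + h')`; averages replace
the sums and cost one power of two. -/
theorem inf_mem_span (hA : ConnClosed A) {F F' : C(X, ℝ)} (hF : F ∈ hA.span)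
    (hF' : F' ∈ hA.span) : F ⊓ F' ∈ hA.span := by
  obtain ⟨N, hN⟩ := hF
  obtain ⟨N', hN'⟩ := hF'
  refine ⟨N + N' + 1, fun n hn => ?_⟩
  obtain ⟨m, rfl⟩ : ∃ m, n = m + 1 := ⟨n - 1, by omega⟩
  obtain ⟨g, hg, h, hh, e⟩ := hN m (by omega)
  obtain ⟨g', hg', h', hh', e'⟩ := hN' m (by omega)
  obtain ⟨k, hk, ek⟩ := hA.average hg hh'
  obtain ⟨k', hk', ek'⟩ := hA.average hg' hh
  obtain ⟨l, hl, el⟩ := hA.average hh hh'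
  obtain ⟨p, hp, ep⟩ := hA.min hk hk'
  refine ⟨p, hp, l, hl, fun x => ?_⟩
  have h2 : (0 : ℝ) ≤ 2 ^ (m + 1) := by positivity
  rw [ContinuousMap.inf_apply, e x, e' x, ep x, el x, ek x, ek' x, ← min_sub_sub_right,
    mul_min_of_nonneg _ _ h2]
  congr 1 <;> ring

/-- The positive part of `2 ^ N * (g - h)` is `2 ^ N` times a truncated difference, and repeated
truncated doubling computes this multiple cut off at `1`. -/
theorem clip_mem (hA : ConnClosed A) {F : C(X, ℝ)} (hF : F ∈ hA.span) :
    ∃ g ∈ A, ∀ x, g x = Min.min (max (F x) 0) 1 := by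
  obtain ⟨N, hN⟩ := hF
  obtain ⟨g, hg, h, hh, e⟩ := hN N le_rfl
  obtain ⟨k, hk, ek⟩ := hA.tsub g hg h hh
  obtain ⟨l, hl, el⟩ := hA.two_pow_mul hk N
  refine ⟨l, hl, fun x => ?_⟩
  have h2 : (0 : ℝ) ≤ 2 ^ N := by positivity
  rw [el x, ek x, e x, mul_max_of_nonneg _ _ h2, mul_zero]

theorem mem_span (hA : ConnClosed A) {f : C(X, ℝ)} (hf : f ∈ A) (m : ℕ) :
    (1 / 2 ^ m : ℝ) • f ∈ hA.span := by
  have key : ∀ n : ℕ, ∃ g ∈ A, ∀ x, g x = f x / 2 ^ n := by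
    intro n
    induction n with
    | zero => exact ⟨f, hf, fun x => by simp⟩
    | succ n ih =>
      obtain ⟨g, hg, h⟩ := ih
      obtain ⟨k, hk, h'⟩ := hA.half g hg
      exact ⟨k, hk, fun x => by rw [h' x, h x, pow_succ]; field_simp⟩
  refine ⟨0, fun n _ => ?_⟩
  obtain ⟨g, hg, h⟩ := key (n + m)
  obtain ⟨z, hz, hz0⟩ := hA.zero
  refine ⟨g, hg, z, hz, fun x => ?_⟩
  rw [h x, hz0 x, ContinuousMap.smul_apply, pow_add, smul_eq_mul]
  field_simp
  ring

/-- The scalars `p` for which `p • f` is in the closure form a closed subgroup of `ℝ` that contains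
all `1 / 2 ^ n`, hence arbitrarily small positive numbers; such a subgroup is everything. -/
theorem smul_mem_closure (hA : ConnClosed A) [CompactSpace X] {f : C(X, ℝ)} (hf : f ∈ A)
    (p : ℝ) : p • f ∈ hA.span.topologicalClosure := by
  let φ : ℝ →+ C(X, ℝ) := ((LinearMap.id : ℝ →ₗ[ℝ] ℝ).smulRight f).toAddMonoidHom
  have hφ : ∀ p, φ p = p • f := fun p => rfl
  have hc : Continuous φ := by
    have : Continuous fun p : ℝ => p • f := by fun_prop
    exact this
  have hd : Dense ((hA.span.topologicalClosure.comap φ : AddSubgroup ℝ) : Set ℝ) := by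
    refine AddSubgroup.dense_of_not_isolated_zero _ fun ε hε => ?_
    obtain ⟨n, hn⟩ := exists_pow_lt_of_lt_one hε (show (1 / 2 : ℝ) < 1 by norm_num)
    refine ⟨1 / 2 ^ n, ?_, by positivity, by simpa [div_pow] using hn⟩
    exact AddSubgroup.le_topologicalClosure _ (hA.mem_span hf n)
  have hcl : IsClosed ((hA.span.topologicalClosure.comap φ : AddSubgroup ℝ) : Set ℝ) :=
    hA.span.isClosed_topologicalClosure.preimage hc
  have := hcl.closure_eq ▸ hd.closure_eq
  have hp : p ∈ ((hA.span.topologicalClosure.comap φ : AddSubgroup ℝ) : Set ℝ) := by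
    rw [this]; trivial
  exact hp

/-- The lattice form of the Stone–Weierstrass theorem: the closure is a lattice, and it interpolates
any two values at any two points. -/
theorem span_dense (hA : ConnClosed A) [CompactSpace X]
    (sep : ∀ x y, x ≠ y → ∃ f ∈ A, f x ≠ f y) (F : C(X, ℝ)) :
    F ∈ hA.span.topologicalClosure := by
  have inf_mem : ∀ᵉ (f ∈ (hA.span.topologicalClosure : Set C(X, ℝ)))
      (g ∈ (hA.span.topologicalClosure : Set C(X, ℝ))),
      f ⊓ g ∈ (hA.span.topologicalClosure : Set C(X, ℝ)) := by
    intro f hf g hg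
    refine Metric.mem_closure_iff.mpr fun ε hε => ?_
    obtain ⟨f', hf', hd⟩ := Metric.mem_closure_iff.mp hf ε hε
    obtain ⟨g', hg', hd'⟩ := Metric.mem_closure_iff.mp hg ε hε
    refine ⟨f' ⊓ g', hA.inf_mem_span hf' hg', (ContinuousMap.dist_lt_iff hε).mpr fun x => ?_⟩
    have h1 := (ContinuousMap.dist_apply_le_dist (f := f) (g := f') x).trans_lt hd
    have h2 := (ContinuousMap.dist_apply_le_dist (f := g) (g := g') x).trans_lt hd'
    rw [Real.dist_eq] at h1 h2 ⊢
    exact (abs_min_sub_min_le_max _ _ _ _).trans_lt (max_lt h1 h2)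
  obtain ⟨o, ho, ho1⟩ := hA.one
  have h := ContinuousMap.sublattice_closure_eq_top
    (hA.span.topologicalClosure : Set C(X, ℝ)) ⟨0, zero_mem _⟩ inf_mem
    (fun f hf g hg => by
      have := neg_mem (inf_mem _ (neg_mem hf) _ (neg_mem hg))
      have e : f ⊔ g = -(-f ⊓ -g) := by
        ext x
        simp only [ContinuousMap.sup_apply, ContinuousMap.neg_apply, ContinuousMap.inf_apply]
        grind
      rw [e]
      exact this)
    (fun v x y => by
      by_cases hxy : x = y
      · refine ⟨v x • o, hA.smul_mem_closure ho _, ?_, ?_⟩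
        · simp [ho1]
        · simp [ho1, hxy]
      · obtain ⟨g, hg, hgxy⟩ := sep x y hxy
        have hne : g x - g y ≠ 0 := sub_ne_zero.mpr hgxy
        -- The affine function of `g` that takes the values `v x` at `x` and `v y` at `y`; `o` is
        -- the constant `1`.
        refine ⟨((v x - v y) / (g x - g y)) • g + (v x - (v x - v y) / (g x - g y) * g x) • o,
          add_mem (hA.smul_mem_closure hg _) (hA.smul_mem_closure ho _), ?_, ?_⟩
        · simp [ho1]
        · simp [ho1]
          field_simp
          ring)
  rw [hA.span.isClosed_topologicalClosure.closure_eq] at h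
  have : F ∈ (hA.span.topologicalClosure : Set C(X, ℝ)) := by rw [h]; trivial
  exact this

/-- Density in the `[0,1]`-valued continuous functions. -/
theorem exists_abs_sub_le (hA : ConnClosed A) [CompactSpace X]
    (sep : ∀ x y, x ≠ y → ∃ f ∈ A, f x ≠ f y) (F : C(X, ℝ))
    (hF : ∀ x, F x ∈ Set.Icc (0 : ℝ) 1) {ε : ℝ} (hε : 0 < ε) :
    ∃ g ∈ A, ∀ x, |F x - g x| ≤ ε := by
  obtain ⟨G, hG, hd⟩ := Metric.mem_closure_iff.mp (hA.span_dense sep F) ε hε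
  -- Clipping to `[0,1]` returns to `A` and does not increase the distance to `F`, whose values are
  -- already in `[0,1]`.
  obtain ⟨g, hg, e⟩ := hA.clip_mem hG
  refine ⟨g, hg, fun x => ?_⟩
  have h1 : |F x - G x| ≤ ε := by
    have := (ContinuousMap.dist_apply_le_dist (f := F) (g := G) x).trans hd.le
    rwa [Real.dist_eq] at this
  have h2 := hF x
  rw [e x]
  rw [abs_le] at h1 ⊢
  simp only [Set.mem_Icc] at h2
  constructor <;> grind

end ConnClosed

/-- The terms are dense in the continuous functions on a cube. -/
theorem exists_term_abs_sub_le {J : Type*} (F : (J → Set.Icc (0 : ℝ) 1) → ℝ)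
    (hc : Continuous F) (hF : ∀ z, F z ∈ Set.Icc (0 : ℝ) 1) [Nonempty J] {ε : ℝ} (hε : 0 < ε) :
    ∃ τ : FreeCPL J, ∀ z : J → Set.Icc (0 : ℝ) 1, |F z - τ.eval fun j => (z j : ℝ)| ≤ ε := by
  let ev : FreeCPL J → C(J → Set.Icc (0 : ℝ) 1, ℝ) := fun τ =>
    ⟨fun z => τ.eval fun j => (z j : ℝ), τ.continuous_eval fun j => by fun_prop⟩
  have hA : ConnClosed (Set.range ev) := by
    refine ⟨⟨_, .var (Classical.arbitrary J), rfl⟩, ?_, ?_, ?_, ?_⟩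
    · rintro _ ⟨τ, rfl⟩ z
      exact τ.eval_mem fun j => (z j).2
    · rintro _ ⟨τ, rfl⟩
      exact ⟨_, ⟨τ.neg, rfl⟩, fun z => rfl⟩
    · rintro _ ⟨τ, rfl⟩
      exact ⟨_, ⟨τ.half, rfl⟩, fun z => rfl⟩
    · rintro _ ⟨τ, rfl⟩ _ ⟨σ, rfl⟩
      exact ⟨_, ⟨τ.tsub σ, rfl⟩, fun z => rfl⟩
  obtain ⟨_, ⟨τ, rfl⟩, h⟩ := hA.exists_abs_sub_le (fun x y hxy => by
    obtain ⟨j, hj⟩ := Function.ne_iff.mp hxy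
    exact ⟨_, ⟨.var j, rfl⟩, fun h => hj (Subtype.ext h)⟩) ⟨F, hc⟩ hF hε
  exact ⟨τ, h⟩

/-! ### Measures from positive functionals on sets of continuous functions -/

/-- A functional on a family of continuous functions that is positive on linear combinations is
represented by a regular probability measure. -/
theorem exists_regular_probability {K : Type*} [TopologicalSpace K] [CompactSpace K] [T2Space K]
    [MeasurableSpace K] [BorelSpace K] {ι : Type*} (ev : ι → C(K, ℝ)) (E : ι → ℝ)
    (pos : ∀ c : ι →₀ ℝ, (∀ k, 0 ≤ c.sum fun i a => a * ev i k) → 0 ≤ c.sum fun i a => a * E i)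
    (i₁ : ι) (h1 : ∀ k, ev i₁ k = 1) (hE : E i₁ = 1) :
    ∃ μ : ProbabilityMeasure K, (μ : Measure K).Regular ∧
      ∀ i, ∫ k, ev i k ∂(μ : Measure K) = E i := by
  let A : (ι →₀ ℝ) →ₗ[ℝ] C(K, ℝ) := Finsupp.linearCombination ℝ ev
  let B : (ι →₀ ℝ) →ₗ[ℝ] ℝ := Finsupp.linearCombination ℝ E
  have hA : ∀ c k, A c k = c.sum fun i a => a * ev i k := by
    intro c k
    simp [A, Finsupp.linearCombination_apply, Finsupp.sum, ContinuousMap.sum_apply]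
  have hB : ∀ c, B c = c.sum fun i a => a * E i := by
    intro c
    simp [B, Finsupp.linearCombination_apply, Finsupp.sum]
  have pos' : ∀ c, (∀ k, 0 ≤ A c k) → 0 ≤ B c := by
    intro c hc
    rw [hB]
    exact pos c fun k => hA c k ▸ hc k
  -- Positivity applied to `c` and to `-c`: a combination that vanishes as a function has
  -- expectation `0`, so the functional is well defined on the range of `A`.
  have hker : LinearMap.ker A ≤ LinearMap.ker B := by
    intro c hc
    rw [LinearMap.mem_ker] at hc ⊢
    have h1 := pos' c fun k => by simp [hc]
    have h2 := pos' (-c) fun k => by simp [hc]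
    rw [map_neg] at h2
    linarith
  let f : C(K, ℝ) →ₗ.[ℝ] ℝ :=
    ⟨LinearMap.range A, (LinearMap.ker A).liftQ B hker ∘ₗ A.quotKerEquivRange.symm.toLinearMap⟩
  have hf : ∀ c, f ⟨A c, LinearMap.mem_range_self A c⟩ = B c := by
    intro c
    change (LinearMap.ker A).liftQ B hker (A.quotKerEquivRange.symm _) = _
    rw [LinearMap.quotKerEquivRange_symm_apply_image A c (LinearMap.mem_range_self A c)]
    simp
  let s : PointedCone ℝ C(K, ℝ) :=
    { carrier := {g | ∀ k, 0 ≤ g k}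
      add_mem' := fun {a b} ha hb k => add_nonneg (ha k) (hb k)
      zero_mem' := fun k => le_rfl
      smul_mem' := fun c g hg k => mul_nonneg c.2 (hg k) }
  have hone : ∀ c : ℝ, A (Finsupp.single i₁ c) = ContinuousMap.const K c := by
    intro c
    ext k
    rw [hA]
    simp [h1]
  -- Extension of a positive functional; the constants, multiples of `ev i₁`, dominate all
  -- continuous functions because the space is compact.
  obtain ⟨g, hgf, hgs⟩ := riesz_extension s f
    (by
      rintro ⟨_, ⟨c, rfl⟩⟩ hx
      rw [hf]
      exact pos' c hx)
    (fun y => by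
      refine ⟨⟨A (Finsupp.single i₁ ‖y‖), LinearMap.mem_range_self A _⟩, fun k => ?_⟩
      have e : ((⟨A (Finsupp.single i₁ ‖y‖), LinearMap.mem_range_self A _⟩ : f.domain) :
          C(K, ℝ)) = ContinuousMap.const K ‖y‖ := hone _
      rw [ContinuousMap.add_apply, e]
      have := (abs_le.mp ((Real.norm_eq_abs _).symm.le.trans (y.norm_coe_le_norm k))).1
      simp only [ContinuousMap.const_apply]
      linarith)
  let Λ : C_c(K, ℝ) →ₚ[ℝ] ℝ :=
    { toFun := fun φ => g φ.toContinuousMap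
      map_add' := fun φ ψ => map_add g φ.toContinuousMap ψ.toContinuousMap
      map_smul' := fun c φ => map_smul g c φ.toContinuousMap
      monotone' := fun φ ψ h => by
        have := hgs (ψ.toContinuousMap - φ.toContinuousMap) fun k => sub_nonneg.mpr (h k)
        rw [map_sub] at this
        exact sub_nonneg.mp this }
  have hΛ : ∀ φ : C(K, ℝ), ∫ k, φ k ∂(RealRMK.rieszMeasure Λ) = g φ := fun φ =>
    RealRMK.integral_rieszMeasure Λ ⟨φ, HasCompactSupport.of_compactSpace _⟩
  have hev : ∀ i, ∫ k, ev i k ∂(RealRMK.rieszMeasure Λ) = E i := by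
    intro i
    have e : A (Finsupp.single i 1) = ev i := by
      ext k
      rw [hA]
      simp
    rw [hΛ, ← e]
    refine (hgf ⟨A (Finsupp.single i 1), LinearMap.mem_range_self A _⟩).trans ?_
    rw [hf, hB]
    simp
  have hprob : IsProbabilityMeasure (RealRMK.rieszMeasure Λ) := by
    constructor
    have := hev i₁
    simp only [h1, hE, integral_const, smul_eq_mul, mul_one] at this
    rwa [Measure.real, ENNReal.toReal_eq_one_iff] at this
  exact ⟨⟨RealRMK.rieszMeasure Λ, hprob⟩, RealRMK.regular_rieszMeasure Λ, hev⟩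

end

end ContLogic

namespace ContLogic

open Filter Topology

noncomputable section

/-! ### Infima and suprema of bounded families -/

theorem bddBelow_range_of_mem {ι : Sort*} {f : ι → ℝ} (hf : ∀ i, f i ∈ Set.Icc (0 : ℝ) 1) :
    BddBelow (Set.range f) := ⟨0, by rintro _ ⟨i, rfl⟩; exact (hf i).1⟩

theorem bddAbove_range_of_mem {ι : Sort*} {f : ι → ℝ} (hf : ∀ i, f i ∈ Set.Icc (0 : ℝ) 1) :
    BddAbove (Set.range f) := ⟨1, by rintro _ ⟨i, rfl⟩; exact (hf i).2⟩

theorem iInf_mem_Icc {ι : Sort*} [Nonempty ι] {f : ι → ℝ} (hf : ∀ i, f i ∈ Set.Icc (0 : ℝ) 1) :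
    ⨅ i, f i ∈ Set.Icc (0 : ℝ) 1 :=
  ⟨le_ciInf fun i => (hf i).1,
    (ciInf_le (bddBelow_range_of_mem hf) (Classical.arbitrary ι)).trans (hf _).2⟩

theorem iSup_eq_one_sub_iInf {ι : Sort*} [Nonempty ι] {f : ι → ℝ}
    (hf : ∀ i, f i ∈ Set.Icc (0 : ℝ) 1) : ⨆ i, f i = 1 - ⨅ i, (1 - f i) := by
  have hg : ∀ i, 1 - f i ∈ Set.Icc (0 : ℝ) 1 := fun i => CPL.neg_mem (hf i)
  refine le_antisymm (ciSup_le fun i => ?_) ?_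
  · have := ciInf_le (bddBelow_range_of_mem hg) i
    linarith
  · have : 1 - ⨆ i, f i ≤ ⨅ i, (1 - f i) := le_ciInf fun i => by
      have := le_ciSup (bddAbove_range_of_mem hf) i
      linarith
    linarith

theorem iInf_le_iInf_add {ι : Sort*} [Nonempty ι] {f g : ι → ℝ} {ε : ℝ}
    (hf : BddBelow (Set.range f)) (h : ∀ i, f i ≤ g i + ε) : ⨅ i, f i ≤ (⨅ i, g i) + ε := by
  rw [← sub_le_iff_le_add]
  exact le_ciInf fun i => sub_le_iff_le_add.mpr ((ciInf_le hf i).trans (h i))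

/-! ### Formulae as a propositional logic -/

instance BFormula.instCPL {L : Signature.{u}} {I : Type v} {n : ℕ} : CPL (BFormula L I n) :=
  ⟨.neg, .half, .tsub⟩

namespace BFormula

variable {L : Signature.{u}} {I : Type v}

/-- A formula that is identically `0`. -/
def zero {n : ℕ} : BFormula L I n :=
  .inf (.dist (.var (Sum.inr (Fin.last n))) (.var (Sum.inr (Fin.last n))))

theorem isHom_value (M : Str L) (a : I → M.Carrier) {n : ℕ} (b : Fin n → M.Carrier) :
    CPL.IsHom (fun φ : BFormula L I n => φ.value M a b) :=
  ⟨fun _ => rfl, fun _ => rfl, fun _ _ => rfl⟩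

@[simp]
theorem value_zero (M : Str L) (a : I → M.Carrier) {n : ℕ} (b : Fin n → M.Carrier) :
    (zero : BFormula L I n).value M a b = 0 := by
  simp [zero, value]

theorem value_mem (M : Str L) (a : I → M.Carrier) {n : ℕ} (φ : BFormula L I n)
    (b : Fin n → M.Carrier) : φ.value M a b ∈ Set.Icc (0 : ℝ) 1 := by
  induction φ with
  | dist s t => exact ⟨dist_nonneg, M.dist_le_one _ _⟩
  | pred P ts => exact M.pred_mem _ _
  | neg φ ih => exact CPL.neg_mem (ih b)
  | half φ ih => exact CPL.half_mem (ih b)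
  | tsub φ ψ ih ih' => exact CPL.tsub_mem (ih b) (ih' b)
  | inf φ ih => exact iInf_mem_Icc fun c => ih _
  | sup φ ih =>
    simp only [value]
    rw [iSup_eq_one_sub_iInf fun c => ih _]
    exact CPL.neg_mem (iInf_mem_Icc fun c => CPL.neg_mem (ih _))

theorem value_sup (M : Str L) (a : I → M.Carrier) {n : ℕ} (φ : BFormula L I (n + 1))
    (b : Fin n → M.Carrier) : φ.sup.value M a b = φ.neg.inf.neg.value M a b :=
  iSup_eq_one_sub_iInf fun _ => φ.value_mem M a _

end BFormula

/-! ### Uniform continuity -/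

/-- The coordinates are changed one at a time; each change costs at most `ε / (n + 1)`, so the total
stays strictly below `ε`. -/
theorem uniformContinuous_of_coordinates {A B : Type*} [PseudoMetricSpace A]
    [PseudoMetricSpace B] {n : ℕ} (g : (Fin n → A) → B)
    (h : ∀ ε > 0, ∀ i, ∃ δ > 0, ∀ x y, dist (x i) y < δ →
      dist (g x) (g (Function.update x i y)) ≤ ε) : UniformContinuous g := by
  refine Metric.uniformContinuous_iff.mpr fun ε hε => ?_
  have hε' : 0 < ε / (n + 1) := by positivity
  choose δ hδ hg using h _ hε'
  obtain ⟨r, hr, hrδ⟩ : ∃ r > 0, ∀ i, r ≤ δ i := by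
    rcases Nat.eq_zero_or_pos n with rfl | hn
    · exact ⟨1, one_pos, fun i => i.elim0⟩
    · have : Nonempty (Fin n) := ⟨⟨0, hn⟩⟩
      obtain ⟨i, hi⟩ := Finite.exists_min δ
      exact ⟨δ i, hδ i, hi⟩
  refine ⟨r, hr, fun x y hxy => ?_⟩
  have key : ∀ s : Finset (Fin n),
      dist (g x) (g fun i => if i ∈ s then y i else x i) ≤ s.card * (ε / (n + 1)) := by
    intro s
    induction s using Finset.induction_on with
    | empty => simp
    | insert i s hi ih =>
      have e : (fun j => if j ∈ insert i s then y j else x j)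
          = Function.update (fun j => if j ∈ s then y j else x j) i (y i) := by
        funext j
        by_cases hj : j = i
        · subst hj; simp
        · simp [hj]
      rw [e, Finset.card_insert_of_notMem hi]
      have h1 := hg i (fun j => if j ∈ s then y j else x j) (y i) (by
        simp only [hi, if_false]
        exact (dist_le_pi_dist x y i).trans_lt (hxy.trans_le (hrδ i)))
      push_cast
      linarith [dist_triangle (g x) (g fun j => if j ∈ s then y j else x j)
        (g (Function.update (fun j => if j ∈ s then y j else x j) i (y i)))]
  have := key Finset.univ
  simp only [Finset.mem_univ, if_true, Finset.card_univ, Fintype.card_fin] at this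
  refine this.trans_lt ?_
  rw [← mul_div_assoc, div_lt_iff₀ (by positivity)]
  nlinarith

/-- For every positive real there is a smaller argument for moduli. -/
theorem exists_modulus_arg {ε : ℝ} (hε : 0 < ε) : ∃ ε' : Set.Ioc (0 : ℝ) 1, (ε' : ℝ) ≤ ε :=
  ⟨⟨min ε 1, lt_min hε one_pos, min_le_right _ _⟩, min_le_left _ _⟩

namespace Str

variable {L : Signature.{u}} (M : Str L)

theorem uniformContinuous_func {n : ℕ} (f : L.Func n) :
    UniformContinuous (M.func f : (Fin n → M.Carrier) → M.Carrier) := by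
  refine uniformContinuous_of_coordinates _ fun ε hε i => ?_
  obtain ⟨ε', h⟩ := exists_modulus_arg hε
  exact ⟨_, (L.funMod f i ε').2.1, fun x y hxy => (M.func_unif f i ε' x y hxy).trans h⟩

theorem uniformContinuous_pred {n : ℕ} (P : L.Pred n) :
    UniformContinuous (M.pred P : (Fin n → M.Carrier) → ℝ) := by
  refine uniformContinuous_of_coordinates _ fun ε hε i => ?_
  obtain ⟨ε', h⟩ := exists_modulus_arg hε
  exact ⟨_, (L.predMod P i ε').2.1, fun x y hxy => (M.pred_unif P i ε' x y hxy).trans h⟩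

end Str

theorem Term.uniformContinuous_eval {L : Signature.{u}} (M : Str L) {I : Type v}
    (a : I → M.Carrier) {n : ℕ} (t : Term L (I ⊕ Fin n)) :
    UniformContinuous fun b : Fin n → M.Carrier => t.eval M.func (Sum.elim a b) := by
  induction t with
  | var x =>
    rcases x with i | j
    · exact uniformContinuous_const
    · exact Pi.uniformContinuous_proj _ j
  | func f ts ih => exact (M.uniformContinuous_func f).comp (uniformContinuous_pi.mpr ih)

theorem BFormula.uniformContinuous_value {L : Signature.{u}} (M : Str L) {I : Type v}
    (a : I → M.Carrier) {n : ℕ} (φ : BFormula L I n) : UniformContinuous (φ.value M a) := by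
  have inf_step : ∀ {n : ℕ} (φ : BFormula L I (n + 1)), UniformContinuous (φ.value M a) →
      UniformContinuous (φ.inf.value M a) := by
    intro n φ ih
    rw [Metric.uniformContinuous_iff] at ih ⊢
    intro ε hε
    obtain ⟨δ, hδ, h⟩ := ih (ε / 2) (half_pos hε)
    refine ⟨δ, hδ, ?_⟩
    have key : ∀ b b' : Fin n → M.Carrier, Dist.dist b b' < δ →
        φ.inf.value M a b ≤ φ.inf.value M a b' + ε / 2 := by
      intro b b' hb
      refine iInf_le_iInf_add (bddBelow_range_of_mem fun c => φ.value_mem M a _) fun c => ?_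
      have hs : Dist.dist (Fin.snoc b c : Fin (n + 1) → M.Carrier)
          (Fin.snoc b' c : Fin (n + 1) → M.Carrier) < δ := by
        refine (dist_pi_lt_iff hδ).mpr fun i => ?_
        refine Fin.lastCases ?_ (fun j => ?_) i
        · simpa using hδ
        · simpa using (dist_le_pi_dist b b' j).trans_lt hb
      have := h hs
      rw [Real.dist_eq] at this
      linarith [(abs_lt.mp this).2]
    intro b b' hb
    have h1 := key b b' hb
    have h2 := key b' b (by rwa [dist_comm])
    rw [Real.dist_eq, abs_lt]
    constructor <;> linarith
  have neg_step : ∀ {n : ℕ} (φ : BFormula L I n), UniformContinuous (φ.value M a) →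
      UniformContinuous (φ.neg.value M a) := fun φ ih => uniformContinuous_const.sub ih
  induction φ with
  | dist s t => exact (s.uniformContinuous_eval M a).dist (t.uniformContinuous_eval M a)
  | pred P ts =>
    exact (M.uniformContinuous_pred P).comp
      (uniformContinuous_pi.mpr fun i => (ts i).uniformContinuous_eval M a)
  | neg φ ih => exact neg_step φ ih
  | half φ ih =>
    have : UniformContinuous fun x : ℝ => x / 2 := by
      simpa [div_eq_inv_mul] using (Real.uniformContinuous_const_mul (x := (2 : ℝ)⁻¹))
    exact this.comp ih
  | tsub φ ψ ih ih' =>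
    have h : UniformContinuous fun x : ℝ => max x 0 :=
      (LipschitzWith.id.max_const (0 : ℝ)).uniformContinuous
    exact h.comp (ih.sub ih')
  | inf φ ih => exact inf_step φ ih
  | sup φ ih =>
    have := neg_step _ (inf_step _ (neg_step _ ih))
    rwa [show φ.sup.value M a = φ.neg.inf.neg.value M a from funext (φ.value_sup M a)]

/-- Allows a quantifier in a completed structure to range over the dense pre-structure only, since
the value is continuous in the quantified variable. -/
theorem BFormula.iInf_value_dense {L : Signature.{u}} (M : Str L) {I : Type v} {A : Type*}
    [Nonempty A] {ι : A → M.Carrier} (hι : DenseRange ι) (a : I → M.Carrier) {n : ℕ}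
    (φ : BFormula L I (n + 1)) (b : Fin n → M.Carrier) :
    φ.inf.value M a b = ⨅ c : A, φ.value M a (Fin.snoc b (ι c)) := by
  have hc : Continuous fun c : M.Carrier => φ.value M a (Fin.snoc b c) := by
    refine (φ.uniformContinuous_value M a).continuous.comp (continuous_pi fun i => ?_)
    refine Fin.lastCases ?_ (fun j => ?_) i
    · simp only [Fin.snoc_last]
      exact continuous_id
    · simp only [Fin.snoc_castSucc]
      exact continuous_const
  refine le_antisymm (le_ciInf fun c => ciInf_le
    (bddBelow_range_of_mem fun c => φ.value_mem M a _) (ι c)) (le_ciInf fun c => ?_)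
  refine hι.induction_on (p := fun c => ⨅ c : A, φ.value M a (Fin.snoc b (ι c)) ≤
    φ.value M a (Fin.snoc b c)) c (isClosed_le continuous_const hc) fun c => ?_
  exact ciInf_le (bddBelow_range_of_mem fun c => φ.value_mem M a _) c

theorem Term.eval_map {L : Signature.{u}} {α : Type v} {A B : Type*}
    {F : ∀ {n : ℕ}, L.Func n → (Fin n → A) → A} {F' : ∀ {n : ℕ}, L.Func n → (Fin n → B) → B}
    {h : A → B} (hh : ∀ {n : ℕ} (f : L.Func n) (x : Fin n → A), F' f (h ∘ x) = h (F f x))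
    (v : α → A) (t : Term L α) : t.eval F' (h ∘ v) = h (t.eval F v) := by
  induction t with
  | var x => rfl
  | func f ts ih =>
    simp only [eval, ih]
    exact hh f _

/-! ### Completions of pre-structures -/

/-- Every pseudo-metric pre-structure is dense in a structure. -/
theorem exists_str_completion (L : Signature.{u}) {A : Type u} [PseudoMetricSpace A] [Nonempty A]
    (hd : ∀ x y : A, dist x y ≤ 1)
    (func : ∀ {n : ℕ}, L.Func n → (Fin n → A) → A) (pred : ∀ {n : ℕ}, L.Pred n → (Fin n → A) → ℝ)
    (pred_mem : ∀ {n : ℕ} (P : L.Pred n) (x : Fin n → A), pred P x ∈ Set.Icc (0 : ℝ) 1)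
    (func_unif : ∀ {n : ℕ} (f : L.Func n) (i : Fin n) (ε : Set.Ioc (0 : ℝ) 1)
      (x : Fin n → A) (y : A), dist (x i) y < L.funMod f i ε →
        dist (func f x) (func f (Function.update x i y)) ≤ ε)
    (pred_unif : ∀ {n : ℕ} (P : L.Pred n) (i : Fin n) (ε : Set.Ioc (0 : ℝ) 1)
      (x : Fin n → A) (y : A), dist (x i) y < L.predMod P i ε →
        |pred P x - pred P (Function.update x i y)| ≤ ε) :
    ∃ (M : Str L) (ι : A → M.Carrier), DenseRange ι ∧ (∀ x y, dist (ι x) (ι y) = dist x y) ∧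
      (∀ {n : ℕ} (f : L.Func n) (x : Fin n → A), M.func f (ι ∘ x) = ι (func f x)) ∧
      (∀ {n : ℕ} (P : L.Pred n) (x : Fin n → A), M.pred P (ι ∘ x) = pred P x) := by
  let B := UniformSpace.Completion A
  have hB : Nonempty B := ⟨((Classical.arbitrary A : A) : UniformSpace.Completion A)⟩
  let ι : A → B := fun x => (x : UniformSpace.Completion A)
  have hι : DenseRange ι := UniformSpace.Completion.denseRange_coe
  have hιd : ∀ x y, dist (ι x) (ι y) = dist x y := UniformSpace.Completion.dist_eq
  have hιc : Continuous ι := UniformSpace.Completion.continuous_coe A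
  let e : ∀ n : ℕ, (Fin n → A) → (Fin n → B) := fun n x => ι ∘ x
  have he : ∀ n, IsUniformInducing (e n) := by
    intro n
    refine Metric.isUniformInducing_iff.mpr ⟨?_, fun δ hδ => ⟨δ, hδ, fun {x y} h => ?_⟩⟩
    · exact uniformContinuous_pi.mpr fun i =>
        (UniformSpace.Completion.uniformContinuous_coe A).comp (Pi.uniformContinuous_proj _ i)
    · rw [dist_pi_lt_iff hδ] at h ⊢
      exact fun i => by simpa [e, hιd] using h i
  have hde : ∀ n, DenseRange (e n) := fun n => DenseRange.piMap fun _ => hι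
  have ucf : ∀ {n : ℕ} (f : L.Func n), UniformContinuous fun x : Fin n → A => ι (func f x) := by
    intro n f
    refine uniformContinuous_of_coordinates _ fun ε hε i => ?_
    obtain ⟨ε', h⟩ := exists_modulus_arg hε
    exact ⟨_, (L.funMod f i ε').2.1, fun x y hxy =>
      (hιd _ _).le.trans ((func_unif f i ε' x y hxy).trans h)⟩
  have ucp : ∀ {n : ℕ} (P : L.Pred n), UniformContinuous (pred P : (Fin n → A) → ℝ) := by
    intro n P
    refine uniformContinuous_of_coordinates _ fun ε hε i => ?_
    obtain ⟨ε', h⟩ := exists_modulus_arg hε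
    exact ⟨_, (L.predMod P i ε').2.1, fun x y hxy => (pred_unif P i ε' x y hxy).trans h⟩
  let F : ∀ {n : ℕ}, L.Func n → (Fin n → B) → B := fun {n} f =>
    ((he n).isDenseInducing (hde n)).extend fun x => ι (func f x)
  let G : ∀ {n : ℕ}, L.Pred n → (Fin n → B) → ℝ := fun {n} P =>
    ((he n).isDenseInducing (hde n)).extend (pred P)
  have hF : ∀ {n : ℕ} (f : L.Func n) (x : Fin n → A), F f (ι ∘ x) = ι (func f x) := fun f x =>
    uniformly_extend_of_ind (he _) (hde _) (ucf f) x
  have hG : ∀ {n : ℕ} (P : L.Pred n) (x : Fin n → A), G P (ι ∘ x) = pred P x := fun P x =>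
    uniformly_extend_of_ind (he _) (hde _) (ucp P) x
  have cF : ∀ {n : ℕ} (f : L.Func n), Continuous (F f : (Fin n → B) → B) := fun f =>
    (uniformContinuous_uniformly_extend (he _) (hde _) (ucf f)).continuous
  have cG : ∀ {n : ℕ} (P : L.Pred n), Continuous (G P : (Fin n → B) → ℝ) := fun P =>
    (uniformContinuous_uniformly_extend (he _) (hde _) (ucp P)).continuous
  have upd : ∀ {n : ℕ} (x : Fin n → A) (i : Fin n) (y : A),
      Function.update (ι ∘ x) i (ι y) = ι ∘ Function.update x i y := fun x i y =>
    (Function.comp_update ι x i y).symm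
  have cu : ∀ {n : ℕ} (i : Fin n),
      Continuous fun q : (Fin n → B) × B => Function.update q.1 i q.2 := fun i =>
    continuous_fst.update i continuous_snd
  let M : Str L :=
    { Carrier := B
      nonempty := hB
      dist_le_one := fun x y => by
        refine UniformSpace.Completion.induction_on₂ x y
          (isClosed_le continuous_dist continuous_const) fun x y => ?_
        rw [UniformSpace.Completion.dist_eq]
        exact hd x y
      func := F
      pred := G
      pred_mem := fun {n} P x => (hde n).induction_on x
        (isClosed_Icc.preimage (cG P)) fun x => by
          change G P (ι ∘ x) ∈ _
          rw [hG]
          exact pred_mem P x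
      func_unif := fun {n} f i ε x y => by
        -- Since the hypothesis on the distance is strict, the implication is the disjunction of two
        -- closed conditions, and it passes from a dense set to the whole completion.
        have : ∀ q : (Fin n → B) × B, (L.funMod f i ε : ℝ) ≤ dist (q.1 i) q.2 ∨
            dist (F f q.1) (F f (Function.update q.1 i q.2)) ≤ ε := fun q =>
          ((hde n).prodMap hι).induction_on q
            ((isClosed_le continuous_const (((continuous_apply i).comp continuous_fst).dist
              continuous_snd)).union (isClosed_le (((cF f).comp continuous_fst).dist
              ((cF f).comp (cu i))) continuous_const)) (fun ⟨x, y⟩ => by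
                change _ ≤ dist (ι (x i)) (ι y) ∨ dist (F f (ι ∘ x))
                  (F f (Function.update (ι ∘ x) i (ι y))) ≤ _
                rw [upd, hF, hF, hιd, hιd]
                exact (le_or_gt _ _).imp id (func_unif f i ε x y))
        exact fun hxy => (this (x, y)).resolve_left hxy.not_ge
      pred_unif := fun {n} P i ε x y => by
        have : ∀ q : (Fin n → B) × B, (L.predMod P i ε : ℝ) ≤ dist (q.1 i) q.2 ∨
            |G P q.1 - G P (Function.update q.1 i q.2)| ≤ ε := fun q =>
          ((hde n).prodMap hι).induction_on q
            ((isClosed_le continuous_const (((continuous_apply i).comp continuous_fst).dist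
              continuous_snd)).union (isClosed_le (((cG P).comp continuous_fst).sub
              ((cG P).comp (cu i))).abs continuous_const)) (fun ⟨x, y⟩ => by
                change _ ≤ dist (ι (x i)) (ι y) ∨ |G P (ι ∘ x) -
                  G P (Function.update (ι ∘ x) i (ι y))| ≤ _
                rw [upd, hG, hG, hιd]
                exact (le_or_gt _ _).imp id (pred_unif P i ε x y))
        exact fun hxy => (this (x, y)).resolve_left hxy.not_ge }
  exact ⟨M, ι, hι, hιd, hF, hG⟩

/-! ### Limits along ultrafilters -/

/-- The limit of a real-valued function along an ultrafilter. -/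
def ulim {J : Type*} (U : Ultrafilter J) (f : J → ℝ) : ℝ := limUnder (U : Filter J) f

theorem tendsto_ulim {J : Type*} (U : Ultrafilter J) {f : J → ℝ} {C : ℝ} (hf : ∀ j, |f j| ≤ C) :
    Tendsto f U (𝓝 (ulim U f)) := by
  obtain ⟨x, -, hx⟩ := (isCompact_Icc (a := -C) (b := C)).ultrafilter_le_nhds (U.map f)
    (le_principal_iff.mpr (Ultrafilter.mem_map.mpr (Filter.univ_mem' fun j => abs_le.mp (hf j))))
  exact tendsto_nhds_limUnder ⟨x, hx⟩

theorem ulim_eq {J : Type*} (U : Ultrafilter J) {f : J → ℝ} {x : ℝ}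
    (h : Tendsto f U (𝓝 x)) : ulim U f = x := h.limUnder_eq

/-! ### Ultraproducts and compactness -/

/-- Łoś's theorem. -/
theorem exists_ultraproduct {L : Signature.{u}} {J : Type u} (U : Ultrafilter J)
    (M : J → Str L) : ∃ (P : Str L) (ι : (∀ j, (M j).Carrier) → P.Carrier),
      ∀ (I : Type v) (a : I → ∀ j, (M j).Carrier) (φ : Formula L I),
        Tendsto (fun j => (M j).tp (fun i => a i j) φ) U (𝓝 (P.tp (ι ∘ a) φ)) := by
  have bd : ∀ x y : ∀ j, (M j).Carrier, ∀ j, |dist (x j) (y j)| ≤ 1 := fun x y j => by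
    rw [abs_of_nonneg dist_nonneg]
    exact (M j).dist_le_one _ _
  have hlim : ∀ x y : ∀ j, (M j).Carrier,
      Tendsto (fun j => dist (x j) (y j)) U (𝓝 (ulim U fun j => dist (x j) (y j))) :=
    fun x y => tendsto_ulim U (bd x y)
  -- The ultraproduct is the completion of the full product with the limit pseudo-metric; no
  -- preliminary quotient is needed.
  let _ : PseudoMetricSpace (∀ j, (M j).Carrier) :=
    { dist := fun x y => ulim U fun j => dist (x j) (y j)
      dist_self := fun x => ulim_eq U (by simp)
      dist_comm := fun x y => by simp only [dist_comm]
      dist_triangle := fun x y z => le_of_tendsto_of_tendsto' (hlim x z)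
        ((hlim x y).add (hlim y z)) fun j => dist_triangle _ _ _ }
  have hdist : ∀ x y : ∀ j, (M j).Carrier,
      Tendsto (fun j => dist (x j) (y j)) U (𝓝 (dist x y)) := hlim
  have hpred : ∀ {n : ℕ} (P : L.Pred n) (x : Fin n → ∀ j, (M j).Carrier),
      Tendsto (fun j => (M j).pred P fun i => x i j) U
        (𝓝 (ulim U fun j => (M j).pred P fun i => x i j)) := fun P x =>
    tendsto_ulim U (C := 1) fun j => by
      have := (M j).pred_mem P fun i => x i j
      rw [abs_of_nonneg this.1]
      exact this.2
  have hupd : ∀ {n : ℕ} (x : Fin n → ∀ j, (M j).Carrier) (i : Fin n) (y : ∀ j, (M j).Carrier)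
      (j : J), (fun k => Function.update x i y k j) = Function.update (fun k => x k j) i (y j) := by
    intro n x i y j
    funext k
    by_cases hk : k = i
    · subst hk; simp
    · simp [hk]
  obtain ⟨P, ι, hι, hιd, hιf, hιp⟩ := exists_str_completion L (A := ∀ j, (M j).Carrier)
    (fun x y => le_of_tendsto' (hdist x y) fun j => (M j).dist_le_one _ _)
    (fun {n} f (x : Fin n → ∀ j, (M j).Carrier) j => (M j).func f fun i => x i j)
    (fun P x => ulim U fun j => (M j).pred P fun i => x i j)
    (fun P x => isClosed_Icc.mem_of_tendsto (hpred P x)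
      (Eventually.of_forall fun j => (M j).pred_mem P _))
    (fun f i ε x y hxy => by
      refine le_of_tendsto (hdist _ _) ?_
      filter_upwards [(hdist (x i) y).eventually_lt_const hxy] with j hj
      have := (M j).func_unif f i ε (fun k => x k j) (y j) hj
      rwa [← hupd] at this)
    (fun P i ε x y hxy => by
      refine le_of_tendsto ((hpred P x).sub (hpred P _)).abs ?_
      filter_upwards [(hdist (x i) y).eventually_lt_const hxy] with j hj
      have := (M j).pred_unif P i ε (fun k => x k j) (y j) hj
      rwa [← hupd] at this)
  refine ⟨P, ι, fun I a φ => ?_⟩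
  have hfun : ∀ {α : Type v} (t : Term L α) (w : α → ∀ j, (M j).Carrier) (j : J),
      t.eval (fun {n} f (x : Fin n → ∀ j, (M j).Carrier) j => (M j).func f fun i => x i j) w j
        = t.eval (M j).func (fun x => w x j) := by
    intro α t w j
    induction t with
    | var x => rfl
    | func f ts ih => simp only [Term.eval, ih]
  have hterm : ∀ {n : ℕ} (t : Term L (I ⊕ Fin n)) (b : Fin n → ∀ j, (M j).Carrier),
      t.eval P.func (Sum.elim (ι ∘ a) (ι ∘ b)) = ι fun j => t.eval (M j).func
        (Sum.elim (fun i => a i j) (fun k => b k j)) := by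
    intro n t b
    rw [← Sum.comp_elim, Term.eval_map hιf]
    congr 1
    funext j
    rw [hfun]
    congr 1
    funext x
    cases x <;> rfl
  have snoc_eq : ∀ {n : ℕ} (b : Fin n → ∀ j, (M j).Carrier) (c : ∀ j, (M j).Carrier) (j : J),
      (fun k => (Fin.snoc b c : Fin (n + 1) → ∀ j, (M j).Carrier) k j)
        = (Fin.snoc (fun k => b k j) (c j) : Fin (n + 1) → (M j).Carrier) := by
    intro n b c j
    funext k
    refine Fin.lastCases ?_ (fun i => ?_) k <;> simp
  have snoc_eq' : ∀ {n : ℕ} (b : Fin n → ∀ j, (M j).Carrier) (c : ∀ j, (M j).Carrier),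
      ι ∘ (Fin.snoc b c : Fin (n + 1) → ∀ j, (M j).Carrier)
        = (Fin.snoc (ι ∘ b) (ι c) : Fin (n + 1) → P.Carrier) := by
    intro n b c
    funext k
    refine Fin.lastCases ?_ (fun i => ?_) k <;> simp
  have neg_step : ∀ {n : ℕ} (φ : BFormula L I n), (∀ b : Fin n → ∀ j, (M j).Carrier,
      Tendsto (fun j => φ.value (M j) (fun i => a i j) fun k => b k j) U
        (𝓝 (φ.value P (ι ∘ a) (ι ∘ b)))) → ∀ b : Fin n → ∀ j, (M j).Carrier,
      Tendsto (fun j => φ.neg.value (M j) (fun i => a i j) fun k => b k j) U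
        (𝓝 (φ.neg.value P (ι ∘ a) (ι ∘ b))) := fun φ ih b => tendsto_const_nhds.sub (ih b)
  have inf_step : ∀ {n : ℕ} (φ : BFormula L I (n + 1)), (∀ b : Fin (n + 1) → ∀ j, (M j).Carrier,
      Tendsto (fun j => φ.value (M j) (fun i => a i j) fun k => b k j) U
        (𝓝 (φ.value P (ι ∘ a) (ι ∘ b)))) → ∀ b : Fin n → ∀ j, (M j).Carrier,
      Tendsto (fun j => φ.inf.value (M j) (fun i => a i j) fun k => b k j) U
        (𝓝 (φ.inf.value P (ι ∘ a) (ι ∘ b))) := by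
    intro n φ ih b
    have h0 : Tendsto (fun j => φ.inf.value (M j) (fun i => a i j) fun k => b k j) U
        (𝓝 (ulim U _)) := tendsto_ulim U (C := 1) fun j => by
      have := φ.inf.value_mem (M j) (fun i => a i j) fun k => b k j
      rw [abs_of_nonneg this.1]
      exact this.2
    have ih' : ∀ c : ∀ j, (M j).Carrier, Tendsto (fun j => φ.value (M j) (fun i => a i j)
        (Fin.snoc (fun k => b k j) (c j))) U
        (𝓝 (φ.value P (ι ∘ a) (Fin.snoc (ι ∘ b) (ι c)))) := fun c => by
      have := ih (Fin.snoc b c)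
      simpa only [snoc_eq, snoc_eq'] using this
    convert h0 using 2
    rw [BFormula.iInf_value_dense P hι]
    refine le_antisymm ?_ ?_
    · refine le_of_forall_pos_le_add fun ε hε => ?_
      -- Near-minimisers chosen in each factor form one element of the product, which bounds the
      -- infimum in the ultraproduct from above.
      have : ∀ j, ∃ c : (M j).Carrier, φ.value (M j) (fun i => a i j)
          (Fin.snoc (fun k => b k j) c) <
          (φ.inf.value (M j) (fun i => a i j) fun k => b k j) + ε := fun j =>
        exists_lt_of_ciInf_lt (lt_add_of_pos_right _ hε)
      choose c hc using this
      exact (ciInf_le (bddBelow_range_of_mem fun c => φ.value_mem P _ _) c).trans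
        (le_of_tendsto_of_tendsto' (ih' c) (h0.add_const ε) fun j => (hc j).le)
    · exact le_ciInf fun c => le_of_tendsto_of_tendsto' h0 (ih' c) fun j =>
        ciInf_le (bddBelow_range_of_mem fun c => φ.value_mem (M j) _ _) (c j)
  have main : ∀ {n : ℕ} (φ : BFormula L I n) (b : Fin n → ∀ j, (M j).Carrier),
      Tendsto (fun j => φ.value (M j) (fun i => a i j) fun k => b k j) U
        (𝓝 (φ.value P (ι ∘ a) (ι ∘ b))) := by
    intro n φ
    induction φ with
    | dist s t =>
      intro b
      simp only [BFormula.value, hterm, hιd]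
      exact hdist _ _
    | pred Q ts =>
      intro b
      have e : (fun i => (ts i).eval P.func (Sum.elim (ι ∘ a) (ι ∘ b)))
          = ι ∘ fun i j => (ts i).eval (M j).func
            (Sum.elim (fun i => a i j) (fun k => b k j)) := funext fun i => hterm (ts i) b
      simp only [BFormula.value]
      rw [e, hιp]
      exact hpred Q _
    | neg φ ih => exact neg_step φ ih
    | half φ ih => exact fun b => (ih b).div_const 2
    | tsub φ ψ ih ih' => exact fun b => ((ih b).sub (ih' b)).max tendsto_const_nhds
    | inf φ ih => exact inf_step φ ih
    | sup φ ih =>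
      intro b
      simp only [BFormula.value_sup]
      exact neg_step _ (inf_step _ (neg_step _ ih)) b
  have := main φ Fin.elim0
  have e1 : ∀ j, (fun k : Fin 0 => (Fin.elim0 k : ∀ j, (M j).Carrier) j)
      = (Fin.elim0 : Fin 0 → (M j).Carrier) := fun j => funext fun k => k.elim0
  have e2 : ι ∘ (Fin.elim0 : Fin 0 → ∀ j, (M j).Carrier) = Fin.elim0 := funext fun k => k.elim0
  simp only [e1, e2] at this
  exact this

namespace TypeSpace

variable {L : Signature.{u}} {T : Set (Sentence L)} {I : Type u}

theorem continuous_apply (φ : Formula L I) : Continuous fun q : TypeSpace T I => q.1 φ :=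
  (_root_.continuous_apply φ).comp continuous_induced_dom

theorem apply_mem (q : TypeSpace T I) (φ : Formula L I) : q.1 φ ∈ Set.Icc (0 : ℝ) 1 := by
  obtain ⟨M, -, a, h⟩ := q.2
  rw [h]
  exact φ.value_mem M a _

/-- The continuous function defined by a formula. -/
def ev (φ : Formula L I) : C(TypeSpace T I, ℝ) := ⟨fun q => q.1 φ, continuous_apply φ⟩

instance : T2Space (TypeSpace T I) :=
  inferInstanceAs (T2Space {p : Formula L I → ℝ // ∃ M : Str L, M.Models T ∧
    ∃ a : I → M.Carrier, p = M.tp a})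

theorem isCompact_realised (T : Set (Sentence L)) (I : Type u) :
    IsCompact {p : Formula L I → ℝ | ∃ M : Str L, M.Models T ∧
      ∃ a : I → M.Carrier, p = M.tp a} := by
  refine IsCompact.of_isClosed_subset
    (isCompact_univ_pi fun _ : Formula L I => isCompact_Icc (a := (0 : ℝ)) (b := 1)) ?_ ?_
  · refine isClosed_of_closure_subset fun p hp => ?_
    -- For a point of the closure, models are indexed by a finite set of formulae and a precision;
    -- along an ultrafilter finer than `atTop` every formula is eventually treated with every
    -- precision.
    have hp' : ∀ i : Finset (Formula L I) × ℕ, ∃ M : Str L, M.Models T ∧ ∃ a : I → M.Carrier,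
        ∀ φ ∈ i.1, |M.tp a φ - p φ| < 1 / ((i.2 : ℝ) + 1) := by
      rintro ⟨Δ, n⟩
      have ho : IsOpen (⋂ φ ∈ Δ, {q : Formula L I → ℝ | |q φ - p φ| < 1 / ((n : ℝ) + 1)}) :=
        isOpen_biInter_finset fun φ _ =>
          isOpen_lt (((_root_.continuous_apply φ).sub continuous_const).abs) continuous_const
      obtain ⟨q, hq, M, hM, a, rfl⟩ := mem_closure_iff.mp hp _ ho (by
        simp only [Set.mem_iInter, Set.mem_ofPred_eq, sub_self, abs_zero]
        intro φ _
        positivity)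
      simp only [Set.mem_iInter, Set.mem_ofPred_eq] at hq
      exact ⟨M, hM, a, hq⟩
    choose M hM a ha using hp'
    classical
    let U : Ultrafilter (Finset (Formula L I) × ℕ) := Ultrafilter.of atTop
    have hU : (U : Filter (Finset (Formula L I) × ℕ)) ≤ atTop := Ultrafilter.of_le atTop
    obtain ⟨P, ι, hP⟩ := exists_ultraproduct.{u, u} U M
    refine ⟨P, fun φ hφ => ?_, ι ∘ fun i j => a j i, ?_⟩
    · have h1 := hP PEmpty.{u + 1} PEmpty.elim φ
      have e1 : ∀ j, (fun i : PEmpty.{u + 1} => (PEmpty.elim i : ∀ j, (M j).Carrier) j)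
          = PEmpty.elim := fun j => funext fun i => i.elim
      have e2 : ι ∘ (PEmpty.elim : PEmpty.{u + 1} → ∀ j, (M j).Carrier) = PEmpty.elim :=
        funext fun i => i.elim
      simp only [e1, e2] at h1
      refine tendsto_nhds_unique h1 ?_
      have : ∀ j, (M j).tp PEmpty.elim φ = 0 := fun j => hM j φ hφ
      simp only [this]
      exact tendsto_const_nhds
    · funext φ
      refine tendsto_nhds_unique ?_ (hP I (fun i j => a j i) φ)
      rw [Metric.tendsto_nhds]
      intro ε hε
      obtain ⟨n, hn⟩ := exists_nat_one_div_lt hε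
      filter_upwards [hU (Ici_mem_atTop (({φ}, n) : Finset (Formula L I) × ℕ))] with j hj
      have h1 := ha j φ (hj.1 (Finset.mem_singleton_self φ))
      rw [Real.dist_eq]
      refine h1.trans (lt_of_le_of_lt ?_ hn)
      have : (n : ℝ) ≤ j.2 := by exact_mod_cast hj.2
      exact one_div_le_one_div_of_le (by positivity) (by linarith)
  · rintro p ⟨M, -, a, rfl⟩
    exact Set.mem_univ_pi.mpr fun φ => φ.value_mem M a _

instance : CompactSpace (TypeSpace T I) :=
  isCompact_iff_compactSpace.mp (isCompact_realised T I)

theorem connClosed : ConnClosed (Set.range (ev : Formula L I → C(TypeSpace T I, ℝ))) := by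
  have tp_hom : ∀ q : TypeSpace T I, CPL.IsHom q.1 := by
    rintro ⟨_, M, -, a, rfl⟩
    exact BFormula.isHom_value M a _
  refine ⟨⟨_, .zero, rfl⟩, ?_, ?_, ?_, ?_⟩
  · rintro _ ⟨φ, rfl⟩ q
    exact q.apply_mem φ
  · rintro _ ⟨φ, rfl⟩
    exact ⟨_, ⟨φ.neg, rfl⟩, fun q => (tp_hom q).neg φ⟩
  · rintro _ ⟨φ, rfl⟩
    exact ⟨_, ⟨φ.half, rfl⟩, fun q => (tp_hom q).half φ⟩
  · rintro _ ⟨φ, rfl⟩ _ ⟨ψ, rfl⟩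
    exact ⟨_, ⟨φ.tsub ψ, rfl⟩, fun q => (tp_hom q).tsub φ ψ⟩

/-- Continuous functions are approximated by affine functions of formulae. -/
theorem exists_formula_abs_sub_le (F : C(TypeSpace T I, ℝ)) {ε : ℝ} (hε : 0 < ε) :
    ∃ (φ : Formula L I) (c d : ℝ), ∀ q : TypeSpace T I, |F q - (c * q.1 φ + d)| ≤ ε := by
  set C : ℝ := ‖F‖ + 1 with hC
  have hC0 : 0 < C := by positivity
  -- An affine rescaling of `F` from `[-C, C]` to `[0,1]`, where formulae are dense; it is undone by
  -- the constants `2 * C` and `-C`.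
  let G : C(TypeSpace T I, ℝ) := ⟨fun q => (F q / C + 1) / 2, by fun_prop⟩
  have hb : ∀ q, |F q| ≤ C := fun q => by
    have := F.norm_coe_le_norm q
    rw [Real.norm_eq_abs] at this
    linarith
  have hG : ∀ q, G q ∈ Set.Icc (0 : ℝ) 1 := by
    intro q
    have h1 : |F q / C| ≤ 1 := by
      rw [abs_div, abs_of_pos hC0]
      exact (div_le_one hC0).mpr (hb q)
    rw [abs_le] at h1
    change (F q / C + 1) / 2 ∈ _
    constructor <;> linarith
  obtain ⟨_, ⟨φ, rfl⟩, h⟩ := connClosed.exists_abs_sub_le (fun x y hxy => by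
    obtain ⟨φ, hφ⟩ := Function.ne_iff.mp fun h => hxy (Subtype.ext h)
    exact ⟨_, ⟨φ, rfl⟩, hφ⟩) G hG (show 0 < ε / (2 * C) by positivity)
  refine ⟨φ, 2 * C, -C, fun q => ?_⟩
  have h1 := h q
  have e : F q - (2 * C * q.1 φ + -C) = 2 * C * (G q - q.1 φ) := by
    change _ = 2 * C * ((F q / C + 1) / 2 - _)
    field_simp
    ring
  rw [e, abs_mul, abs_of_pos (by positivity)]
  calc 2 * C * |G q - q.1 φ| ≤ 2 * C * (ε / (2 * C)) := by gcongr; exact h1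
    _ = ε := by field_simp

theorem integrable_apply (μ : Measure (TypeSpace T I)) [IsFiniteMeasure μ] (φ : Formula L I) :
    Integrable (fun q : TypeSpace T I => q.1 φ) μ :=
  Integrable.of_mem_Icc 0 1 (continuous_apply φ).measurable.aemeasurable
    (Eventually.of_forall fun q => q.apply_mem φ)

theorem integrable_continuous (μ : Measure (TypeSpace T I)) [IsFiniteMeasure μ]
    (F : C(TypeSpace T I, ℝ)) : Integrable F μ :=
  Integrable.of_bound F.continuous.measurable.aestronglyMeasurable ‖F‖
    (Eventually.of_forall fun q => F.norm_coe_le_norm q)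

theorem abs_integral_sub_le {μ : Measure (TypeSpace T I)} [IsProbabilityMeasure μ]
    {F : C(TypeSpace T I, ℝ)} {φ : Formula L I} {c d ε : ℝ}
    (h : ∀ q : TypeSpace T I, |F q - (c * q.1 φ + d)| ≤ ε) :
    |∫ q, F q ∂μ - (c * ∫ q, q.1 φ ∂μ + d)| ≤ ε := by
  have hi : Integrable (fun q : TypeSpace T I => c * q.1 φ + d) μ :=
    ((integrable_apply μ φ).const_mul c).add (integrable_const d)
  have e : ∫ q, F q ∂μ - (c * ∫ q, q.1 φ ∂μ + d) = ∫ q, (F q - (c * q.1 φ + d)) ∂μ := by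
    rw [integral_sub (integrable_continuous μ F) hi,
      integral_add ((integrable_apply μ φ).const_mul c) (integrable_const d), integral_const_mul]
    simp
  rw [e]
  have := norm_integral_le_of_norm_le_const (μ := μ)
    (Eventually.of_forall fun q => (Real.norm_eq_abs _).le.trans (h q))
  simpa using this

/-- A regular probability measure is determined by the integrals of formulae. -/
theorem regProb_ext {μ ν : RegProb (TypeSpace T I)}
    (h : ∀ φ : Formula L I, ∫ q, q.1 φ ∂μ.meas = ∫ q, q.1 φ ∂ν.meas) : μ = ν := by
  have : (μ.1 : Measure (TypeSpace T I)).Regular := μ.2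
  have : (ν.1 : Measure (TypeSpace T I)).Regular := ν.2
  refine Subtype.ext (Subtype.ext ?_)
  change (μ.1 : Measure (TypeSpace T I)) = (ν.1 : Measure (TypeSpace T I))
  refine Measure.ext_of_integral_eq_on_compactlySupported fun f => ?_
  have : ∀ ε > 0, |∫ q, f q ∂(μ.1 : Measure (TypeSpace T I)) -
      ∫ q, f q ∂(ν.1 : Measure (TypeSpace T I))| ≤ ε := by
    intro ε hε
    obtain ⟨φ, c, d, hφ⟩ := exists_formula_abs_sub_le f.toContinuousMap (half_pos hε)
    have h1 := abs_integral_sub_le (μ := (μ.1 : Measure (TypeSpace T I))) hφ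
    have h2 := abs_integral_sub_le (μ := (ν.1 : Measure (TypeSpace T I))) hφ
    have h3 := h φ
    change ∫ q, q.1 φ ∂(μ.1 : Measure (TypeSpace T I)) =
      ∫ q, q.1 φ ∂(ν.1 : Measure (TypeSpace T I)) at h3
    rw [h3] at h1
    rw [abs_le] at h1 h2 ⊢
    change _ ≤ ∫ q, f q ∂_ - _ ∧ ∫ q, f q ∂_ - _ ≤ _ at h1
    change _ ≤ ∫ q, f q ∂_ - _ ∧ ∫ q, f q ∂_ - _ ≤ _ at h2
    constructor <;> linarith
  exact sub_eq_zero.mp (abs_eq_zero.mp (le_antisymm (le_of_forall_pos_le_add fun ε hε => by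
    simpa using this ε hε) (abs_nonneg _)))

end TypeSpace

end

end ContLogic

namespace ContLogic

open Filter Topology

noncomputable section

/-! ### The calculus of expectations in models of `RV` -/

namespace RStr.IsRV

variable {L : Signature.{u}} {N : RStr L}

/-- The axiom scheme speaks of variables in `ℕ`. Only finitely many variables occur in a term, so
they can be numbered. -/
theorem eval_eq_zero (h : N.IsRV) {α : Type v} {τ : FreeCPL α} (hτ : τ.Valid) (X : α → N.Aux) :
    τ.eval X = N.zero := by
  classical
  obtain ⟨g, k, hgk⟩ : ∃ (g : α → ℕ) (k : ℕ → N.Aux), ∀ x ∈ τ.vars, k (g x) = X x := by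
    refine ⟨fun x => if hx : x ∈ τ.vars then (τ.vars.equivFin ⟨x, hx⟩ : ℕ) else 0,
      fun n => if hn : n < τ.vars.card then X (τ.vars.equivFin.symm ⟨n, hn⟩) else N.zero,
      fun x hx => ?_⟩
    simp [hx]
  let σ : FreeCPL ℕ := τ.eval fun x => FreeCPL.var (g x)
  have hσ : ∀ {S : Type u} [CPL S] (v : ℕ → S), σ.eval v = τ.eval fun x => v (g x) := fun v =>
    FreeCPL.map_eval (FreeCPL.isHom_eval v) _ τ
  have hσ' : ∀ v : ℕ → ℝ, σ.eval v = τ.eval fun x => v (g x) := fun v =>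
    FreeCPL.map_eval (FreeCPL.isHom_eval v) _ τ
  have := h.rv4 σ (fun v hv => by rw [hσ']; exact hτ _ fun x => hv _) k
  rw [hσ] at this
  rw [← this]
  exact τ.eval_congr fun x hx => (hgk x hx).symm

theorem tsub_eq_zero_of_le (h : N.IsRV) {α : Type v} {τ σ : FreeCPL α}
    (hτ : ∀ v : α → ℝ, (∀ x, v x ∈ Set.Icc (0 : ℝ) 1) → τ.eval v ≤ σ.eval v) (X : α → N.Aux) :
    CPL.tsub (τ.eval X) (σ.eval X) = N.zero :=
  h.eval_eq_zero (τ := τ.tsub σ) (fun v hv => max_eq_right (sub_nonpos.mpr (hτ v hv))) X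

theorem E_zero (N : RStr L) : N.E N.zero = 0 := dist_self _

theorem E_nonneg (X : N.Aux) : 0 ≤ N.E X := dist_nonneg

theorem E_le_one (X : N.Aux) : N.E X ≤ 1 := N.distAux_le_one _ _

theorem le_antisymm (h : N.IsRV) {X Y : N.Aux} (h1 : CPL.tsub X Y = N.zero)
    (h2 : CPL.tsub Y X = N.zero) : X = Y := by
  rw [← dist_eq_zero, h.rv3, h1, h2, E_zero, add_zero]

/-- The transfer principle of the calculus: an identity between connectives that holds for real
numbers in `[0,1]` holds in the auxiliary sort. -/
theorem eval_congr (h : N.IsRV) {α : Type v} {τ σ : FreeCPL α}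
    (hτ : ∀ v : α → ℝ, (∀ x, v x ∈ Set.Icc (0 : ℝ) 1) → τ.eval v = σ.eval v) (X : α → N.Aux) :
    τ.eval X = σ.eval X :=
  h.le_antisymm (h.tsub_eq_zero_of_le (fun v hv => (hτ v hv).le) X)
    (h.tsub_eq_zero_of_le (fun v hv => (hτ v hv).ge) X)

theorem E_mono (h : N.IsRV) {X Y : N.Aux} (hXY : CPL.tsub X Y = N.zero) : N.E X ≤ N.E Y := by
  have h1 := h.rv1 X Y
  have h2 := h.rv1 Y X
  have e : CPL.inf X Y = CPL.inf Y X := by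
    let τ : FreeCPL (Fin 2) := CPL.inf (.var 0) (.var 1)
    let σ : FreeCPL (Fin 2) := CPL.inf (.var 1) (.var 0)
    have := h.eval_congr (τ := τ) (σ := σ) (fun v hv => by
      simp only [τ, σ, (FreeCPL.isHom_eval v).inf, FreeCPL.eval]
      rw [CPL.inf_real (hv 0).1 (hv 1).1, CPL.inf_real (hv 1).1 (hv 0).1, min_comm]) ![X, Y]
    simpa [τ, σ, (FreeCPL.isHom_eval _).inf, FreeCPL.eval] using this
  rw [hXY, E_zero, zero_add] at h1
  rw [h1, h2, e]
  linarith [E_nonneg (CPL.tsub Y X)]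

theorem E_half (h : N.IsRV) (X : N.Aux) : N.E (CPL.half X) = N.E X / 2 := by
  have h1 := h.rv1 X (CPL.half X)
  have e1 := h.eval_congr (τ := FreeCPL.tsub (.var ()) (.half (.var ())))
    (σ := .half (.var ())) (fun v hv => by
      simp only [FreeCPL.eval, CPL.tsub_real, CPL.half_real]
      have := (hv ()).1
      grind) fun _ => X
  have e2 := h.eval_congr (τ := CPL.inf (.half (.var ())) (FreeCPL.var ()))
    (σ := .half (.var ())) (fun v hv => by
      have := (hv ()).1
      simp only [(FreeCPL.isHom_eval v).inf, FreeCPL.eval, CPL.half_real]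
      rw [CPL.inf_real (by linarith) this]
      grind) fun _ => X
  simp only [(FreeCPL.isHom_eval _).inf, FreeCPL.eval] at e1 e2
  rw [e1, e2] at h1
  linarith

/-- Where truncation has no effect, the sum decomposes into `σ` and `τ`: this is the first axiom of
`RV` for the sum and `τ`. -/
theorem E_tadd (h : N.IsRV) {α : Type v} {τ σ : FreeCPL α}
    (hτ : ∀ v : α → ℝ, (∀ x, v x ∈ Set.Icc (0 : ℝ) 1) → τ.eval v + σ.eval v ≤ 1)
    (X : α → N.Aux) :
    N.E ((CPL.tadd τ σ).eval X) = N.E (τ.eval X) + N.E (σ.eval X) := by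
  have key : ∀ v : α → ℝ, (∀ x, v x ∈ Set.Icc (0 : ℝ) 1) →
      (CPL.tadd τ σ).eval v = τ.eval v + σ.eval v := fun v hv => by
    rw [(FreeCPL.isHom_eval v).tadd, CPL.tadd_real, min_eq_left (hτ v hv)]
  have h1 := h.rv1 ((CPL.tadd τ σ).eval X) (τ.eval X)
  have e1 := h.eval_congr (τ := (CPL.tadd τ σ).tsub τ) (σ := σ) (fun v hv => by
    have := (σ.eval_mem hv).1
    change max ((CPL.tadd τ σ).eval v - τ.eval v) 0 = _
    rw [key v hv]
    grind) X
  have e2 := h.eval_congr (τ := CPL.inf τ (CPL.tadd τ σ)) (σ := τ) (fun v hv => by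
    have h1 := (σ.eval_mem hv).1
    have h2 := (τ.eval_mem hv).1
    rw [(FreeCPL.isHom_eval v).inf, key v hv, CPL.inf_real h2 (by linarith)]
    grind) X
  rw [(FreeCPL.isHom_eval X).inf] at e2
  change CPL.tsub _ _ = _ at e1
  rw [e1, e2] at h1
  linarith

end RStr.IsRV

/-- The cube `[0,1]^A`, with its Borel `σ`-algebra. -/
def Cube (A : Type u) : Type u := A → Set.Icc (0 : ℝ) 1

namespace Cube

variable {A : Type u}

instance : TopologicalSpace (Cube A) := inferInstanceAs (TopologicalSpace (A → Set.Icc (0 : ℝ) 1))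
instance : CompactSpace (Cube A) := inferInstanceAs (CompactSpace (A → Set.Icc (0 : ℝ) 1))
instance : T2Space (Cube A) := inferInstanceAs (T2Space (A → Set.Icc (0 : ℝ) 1))
instance : MeasurableSpace (Cube A) := borel _
instance : BorelSpace (Cube A) := ⟨rfl⟩

/-- The coordinate functions. -/
def coord (X : A) (k : Cube A) : ℝ := k X

theorem continuous_coord (X : A) : Continuous (coord X) :=
  continuous_subtype_val.comp (continuous_apply X)

theorem coord_mem (X : A) (k : Cube A) : coord X k ∈ Set.Icc (0 : ℝ) 1 := (k X).2

/-- The continuous function on the cube that is defined by a term. -/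
def ev (τ : FreeCPL A) : C(Cube A, ℝ) :=
  ⟨fun k => τ.eval fun X => coord X k, τ.continuous_eval continuous_coord⟩

theorem ev_mem (τ : FreeCPL A) (k : Cube A) : ev τ k ∈ Set.Icc (0 : ℝ) 1 :=
  τ.eval_mem fun X => coord_mem X k

end Cube

/-! ### Positivity of the expectation on real linear combinations. -/

namespace RStr.IsRV

variable {L : Signature.{u}} {N : RStr L}

theorem E_eval_le (h : N.IsRV) {τ σ : FreeCPL N.Aux} (hτ : ∀ k, Cube.ev τ k ≤ Cube.ev σ k) :
    N.E (τ.eval id) ≤ N.E (σ.eval id) :=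
  h.E_mono (h.tsub_eq_zero_of_le (fun v hv => hτ fun X => ⟨v X, hv X⟩) id)

/-- Non-negative multiples of terms, together with the multiples of their expectations. -/
def multiples (h : N.IsRV) : AddSubmonoid ((Cube N.Aux → ℝ) × ℝ) where
  -- The factor `2 ^ n` shrinks the terms so much that sums are never truncated; natural multiples
  -- thereby become available although the logic has only truncated addition.
  carrier := {F | ∃ m : ℕ, ∀ n ≥ m, ∃ σ : FreeCPL N.Aux,
    (∀ k, F.1 k = 2 ^ n * Cube.ev σ k) ∧ F.2 = 2 ^ n * N.E (σ.eval id)}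
  zero_mem' := by
    have e0 := h.eval_eq_zero (τ := (FreeCPL.var N.zero).tsub (.var N.zero))
      (fun v _ => by simp [FreeCPL.eval, CPL.tsub_real]) id
    refine ⟨0, fun n _ => ⟨(FreeCPL.var N.zero).tsub (.var N.zero), fun k => ?_, ?_⟩⟩
    · simp [Cube.ev, FreeCPL.eval, CPL.tsub_real]
    · rw [e0, E_zero]
      simp
  add_mem' := by
    rintro F F' ⟨m, hm⟩ ⟨m', hm'⟩
    refine ⟨m + m' + 1, fun n hn => ?_⟩
    obtain ⟨n, rfl⟩ : ∃ l, n = l + 1 := ⟨n - 1, by omega⟩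
    obtain ⟨σ, h1, h2⟩ := hm n (by omega)
    obtain ⟨σ', h1', h2'⟩ := hm' n (by omega)
    have hle : ∀ v : N.Aux → ℝ, (∀ x, v x ∈ Set.Icc (0 : ℝ) 1) →
        σ.half.eval v + σ'.half.eval v ≤ 1 := by
      intro v hv
      have e1 := (σ.eval_mem hv).2
      have e2 := (σ'.eval_mem hv).2
      simp only [FreeCPL.eval, CPL.half_real]
      linarith
    refine ⟨CPL.tadd σ.half σ'.half, fun k => ?_, ?_⟩
    · have e : Cube.ev (CPL.tadd σ.half σ'.half) k = Cube.ev σ k / 2 + Cube.ev σ' k / 2 := by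
        change (CPL.tadd σ.half σ'.half).eval _ = _
        rw [(FreeCPL.isHom_eval _).tadd, CPL.tadd_real,
          min_eq_left (hle _ fun X => Cube.coord_mem X k)]
        rfl
      rw [e, Prod.fst_add, Pi.add_apply, h1 k, h1' k]
      ring
    · rw [h.E_tadd hle id, Prod.snd_add, h2, h2']
      simp only [FreeCPL.eval, h.E_half]
      ring

theorem mem_multiples (h : N.IsRV) (τ : FreeCPL N.Aux) :
    ((Cube.ev τ, N.E (τ.eval id)) : (Cube N.Aux → ℝ) × ℝ) ∈ h.multiples := by
  have key : ∀ n : ℕ, ∃ σ : FreeCPL N.Aux,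
      (∀ k, Cube.ev τ k = 2 ^ n * Cube.ev σ k) ∧ N.E (τ.eval id) = 2 ^ n * N.E (σ.eval id) := by
    intro n
    induction n with
    | zero => exact ⟨τ, by simp, by simp⟩
    | succ n ih =>
      obtain ⟨σ, h1, h2⟩ := ih
      refine ⟨σ.half, fun k => ?_, ?_⟩
      · rw [h1 k]
        change _ = _ * (Cube.ev σ k / 2)
        ring
      · rw [h2]
        simp only [FreeCPL.eval, h.E_half]
        ring
  exact ⟨0, fun n _ => key n⟩

theorem le_of_mem_multiples (h : N.IsRV) {F F' : (Cube N.Aux → ℝ) × ℝ} (hF : F ∈ h.multiples)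
    (hF' : F' ∈ h.multiples) (hle : ∀ k, F.1 k ≤ F'.1 k) : F.2 ≤ F'.2 := by
  obtain ⟨m, hm⟩ := hF
  obtain ⟨m', hm'⟩ := hF'
  obtain ⟨σ, h1, h2⟩ := hm (m + m') (by omega)
  obtain ⟨σ', h1', h2'⟩ := hm' (m + m') (by omega)
  have hp : (0 : ℝ) < 2 ^ (m + m') := by positivity
  rw [h2, h2']
  refine mul_le_mul_of_nonneg_left (h.E_eval_le fun k => ?_) hp.le
  have := hle k
  rw [h1, h1'] at this
  exact le_of_mul_le_mul_left this hp

/-- The expectation is a positive functional. -/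
theorem sum_E_nonneg (h : N.IsRV) (c : FreeCPL N.Aux →₀ ℝ)
    (hc : ∀ k, 0 ≤ c.sum fun τ a => a * Cube.ev τ k) :
    0 ≤ c.sum fun τ a => a * N.E (τ.eval id) := by
  have step : ∀ n : ℕ, -(2 * c.support.card : ℝ) ≤ n * c.sum fun τ a => a * N.E (τ.eval id) := by
    intro n
    -- The combination is multiplied by `n`, and its coefficients are rounded to integers: positive
    -- parts up, negative parts down. The pointwise inequality survives, and each expectation
    -- changes by at most `2`, which is negligible relative to `n`.
    let p : FreeCPL N.Aux → ℕ := fun τ => ⌈max (n * c τ) 0⌉₊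
    let q : FreeCPL N.Aux → ℕ := fun τ => ⌊max (-(n * c τ)) 0⌋₊
    have hp : ∀ τ, max (n * c τ) 0 ≤ p τ := fun τ => Nat.le_ceil _
    have hp' : ∀ τ, (p τ : ℝ) ≤ max (n * c τ) 0 + 1 := fun τ =>
      (Nat.ceil_lt_add_one (le_max_right _ _)).le
    have hq : ∀ τ, (q τ : ℝ) ≤ max (-(n * c τ)) 0 := fun τ => Nat.floor_le (le_max_right _ _)
    have hq' : ∀ τ, max (-(n * c τ)) 0 - 1 ≤ q τ := fun τ => (Nat.sub_one_lt_floor _).le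
    have hmm : ∀ τ, n * c τ = max (n * c τ) 0 - max (-(n * c τ)) 0 := fun τ => by grind
    have m1 := sum_mem (S := h.multiples) (t := c.support) fun τ _ =>
      nsmul_mem (h.mem_multiples τ) (p τ)
    have m2 := sum_mem (S := h.multiples) (t := c.support) fun τ _ =>
      nsmul_mem (h.mem_multiples τ) (q τ)
    have := h.le_of_mem_multiples m2 m1 (fun k => by
      simp only [Prod.fst_sum, Prod.smul_fst, Finset.sum_apply, Pi.smul_apply]
      simp only [nsmul_eq_mul]
      have h0 : (0 : ℝ) ≤ n * c.sum fun τ a => a * Cube.ev τ k :=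
        mul_nonneg n.cast_nonneg (hc k)
      rw [Finsupp.sum, Finset.mul_sum] at h0
      rw [← sub_nonneg, ← Finset.sum_sub_distrib]
      refine h0.trans (Finset.sum_le_sum fun τ _ => ?_)
      have := (Cube.ev_mem τ k).1
      have h1 := hp τ
      have h2 := hq τ
      have h3 := hmm τ
      rw [← mul_assoc, ← sub_mul]
      exact mul_le_mul_of_nonneg_right (by linarith) this)
    simp only [Prod.snd_sum, Prod.smul_snd] at this
    simp only [nsmul_eq_mul] at this
    rw [← sub_nonneg, ← Finset.sum_sub_distrib] at this
    have h4 : ∑ τ ∈ c.support, ((p τ : ℝ) * N.E (τ.eval id) - q τ * N.E (τ.eval id)) ≤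
        ∑ τ ∈ c.support, (n * (c τ * N.E (τ.eval id)) + 2) := by
      refine Finset.sum_le_sum fun τ _ => ?_
      have h1 := hp' τ
      have h2 := hq' τ
      have h3 := hmm τ
      have h5 : (p τ : ℝ) - q τ ≤ n * c τ + 2 := by linarith
      have h6 := E_nonneg (τ.eval id : N.Aux)
      have h7 := E_le_one (τ.eval id : N.Aux)
      nlinarith
    rw [Finset.sum_add_distrib, ← Finset.mul_sum, Finset.sum_const, nsmul_eq_mul] at h4
    rw [Finsupp.sum]
    linarith
  by_contra hneg
  push Not at hneg
  obtain ⟨n, hn⟩ := exists_nat_gt (2 * c.support.card /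
    -(c.sum fun τ a => a * N.E (τ.eval id)) : ℝ)
  rw [div_lt_iff₀ (by linarith)] at hn
  linarith [step n]

end RStr.IsRV

/-! ### Representation of models of `RV` by random variables -/

/-- A representation of the auxiliary sort by `[0,1]`-valued random variables, where the
operations are respected pointwise. -/
structure Rep {L : Signature.{u}} (N : RStr L) where
  Ω : Type u
  [measurableSpace : MeasurableSpace Ω]
  μ : Measure Ω
  [isProbabilityMeasure : IsProbabilityMeasure μ]
  r : N.Aux → Ω → ℝ
  measurable : ∀ X, Measurable (r X)
  mem : ∀ X ω, r X ω ∈ Set.Icc (0 : ℝ) 1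
  hom : ∀ ω, CPL.IsHom fun X => r X ω
  zero : ∀ ω, r N.zero ω = 0
  E_eq : ∀ X, N.E X = ∫ ω, r X ω ∂μ
  surj : ∀ f : Ω → ℝ, Measurable f → (∀ ω, f ω ∈ Set.Icc (0 : ℝ) 1) → ∃ X, r X =ᵐ[μ] f

attribute [instance] Rep.measurableSpace Rep.isProbabilityMeasure

/-- For uncountable unions this uses regularity: a compact subset of the union is locally, hence
globally, null, and open sets are measured by their compact subsets. -/
theorem measure_iUnion_null_of_isOpen {K : Type*} [TopologicalSpace K] [MeasurableSpace K]
    [BorelSpace K] {μ : Measure K} [μ.Regular] {ι : Type*} {O : ι → Set K}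
    (ho : ∀ i, IsOpen (O i)) (h0 : ∀ i, μ (O i) = 0) : μ (⋃ i, O i) = 0 := by
  rw [(isOpen_iUnion ho).measure_eq_iSup_isCompact]
  simp only [ENNReal.iSup_eq_zero]
  intro C hC hc
  refine hc.measure_zero_of_nhdsWithin fun x hx => ?_
  obtain ⟨i, hi⟩ := Set.mem_iUnion.mp (hC hx)
  exact ⟨O i, mem_nhdsWithin_of_mem_nhds ((ho i).mem_nhds hi), h0 i⟩

theorem integrable_of_mem_Icc {Ω : Type*} [MeasurableSpace Ω] {μ : Measure Ω} [IsFiniteMeasure μ]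
    {f : Ω → ℝ} (hf : Measurable f) (h : ∀ ω, f ω ∈ Set.Icc (0 : ℝ) 1) : Integrable f μ :=
  Integrable.of_mem_Icc 0 1 hf.aemeasurable (Eventually.of_forall h)

theorem RStr.IsRV.exists_measure {L : Signature.{u}} {N : RStr L} (h : N.IsRV) :
    ∃ μ : ProbabilityMeasure (Cube N.Aux), (μ : Measure (Cube N.Aux)).Regular ∧
      ∀ τ : FreeCPL N.Aux, ∫ k, Cube.ev τ k ∂(μ : Measure (Cube N.Aux)) = N.E (τ.eval id) := by
  let z : FreeCPL N.Aux := (FreeCPL.var N.zero).tsub (.var N.zero)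
  have e0 : z.eval id = N.zero := h.eval_eq_zero
    (fun v _ => by simp [z, FreeCPL.eval, CPL.tsub_real]) id
  refine exists_regular_probability Cube.ev (fun τ => N.E (τ.eval id)) h.sum_E_nonneg z.neg
    (fun k => ?_) ?_
  · simp [Cube.ev, z, FreeCPL.eval, CPL.tsub_real, CPL.neg_real]
  · change N.E (CPL.neg (z.eval id)) = 1
    rw [e0, h.rv2]

theorem RStr.IsRV.nonempty_rep {L : Signature.{u}} {N : RStr L} (h : N.IsRV) :
    Nonempty (Rep N) := by
  obtain ⟨μ', hreg, hμ⟩ := h.exists_measure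
  let μ : Measure (Cube N.Aux) := μ'
  have hreg : μ.Regular := hreg
  have hE : ∀ X : N.Aux, ∫ k, Cube.coord X k ∂μ = N.E X := fun X => hμ (.var X)
  have hci : ∀ X : N.Aux, Integrable (Cube.coord X) μ := fun X =>
    integrable_of_mem_Icc (Cube.continuous_coord X).measurable (Cube.coord_mem X)
  have hnull : ∀ τ : FreeCPL N.Aux,
      ∀ᵐ k ∂μ, Cube.ev τ k = Cube.coord (τ.eval id) k := by
    have key : ∀ σ : FreeCPL N.Aux, σ.eval id = N.zero → ∀ᵐ k ∂μ, Cube.ev σ k = 0 := by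
      intro σ hσ
      have := hμ σ
      rw [hσ, E_zero] at this
      exact (integral_eq_zero_iff_of_nonneg (fun k => (Cube.ev_mem σ k).1)
        (integrable_of_mem_Icc (Cube.ev σ).continuous.measurable (Cube.ev_mem σ))).mp this
    have hself : ∀ X : N.Aux, CPL.tsub X X = N.zero := fun X =>
      h.tsub_eq_zero_of_le (τ := .var ()) (σ := .var ()) (fun _ _ => le_rfl) fun _ => X
    intro τ
    filter_upwards [key (τ.tsub (.var (τ.eval id))) (hself _),
      key ((FreeCPL.var (τ.eval id)).tsub τ) (hself _)] with k h1 h2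
    change max (Cube.ev τ k - Cube.coord (τ.eval id) k) 0 = 0 at h1
    change max (Cube.coord (τ.eval id) k - Cube.ev τ k) 0 = 0 at h2
    grind
  -- The homomorphisms from the auxiliary sort to `[0,1]`. Each defining equation holds almost
  -- everywhere and is a closed condition, so by regularity all of them hold together almost
  -- everywhere. Restricting to `G` makes the operations pointwise without exceptional sets.
  let G : Set (Cube N.Aux) := {k | ∀ τ : FreeCPL N.Aux, Cube.ev τ k = Cube.coord (τ.eval id) k}
  have hGc : IsClosed G := by
    have : G = ⋂ τ : FreeCPL N.Aux, {k | Cube.ev τ k = Cube.coord (τ.eval id) k} := by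
      ext k
      simp [G]
    rw [this]
    exact isClosed_iInter fun τ => isClosed_eq (Cube.ev τ).continuous (Cube.continuous_coord _)
  have hG : ∀ᵐ k ∂μ, k ∈ G := by
    have : μ (⋃ τ : FreeCPL N.Aux, {k | Cube.ev τ k ≠ Cube.coord (τ.eval id) k}) = 0 :=
      measure_iUnion_null_of_isOpen
        (fun τ => isOpen_ne_fun (Cube.ev τ).continuous (Cube.continuous_coord _))
        fun τ => hnull τ
    refine measure_mono_null (fun k hk => ?_) this
    by_contra hk'
    refine hk fun τ => ?_
    by_contra hτ
    exact hk' (Set.mem_iUnion.mpr ⟨τ, hτ⟩)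
  have hdist : ∀ X Y : N.Aux, dist X Y = ∫ k, |Cube.coord X k - Cube.coord Y k| ∂μ := by
    intro X Y
    rw [h.rv3, ← hE, ← hE, ← integral_add (hci _) (hci _)]
    refine integral_congr_ae ?_
    filter_upwards [hG] with k hk
    have h1 := hk ((FreeCPL.var X).tsub (.var Y))
    have h2 := hk ((FreeCPL.var Y).tsub (.var X))
    change max (Cube.coord X k - Cube.coord Y k) 0 = Cube.coord (CPL.tsub X Y) k at h1
    change max (Cube.coord Y k - Cube.coord X k) 0 = Cube.coord (CPL.tsub Y X) k at h2
    rw [← h1, ← h2]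
    grind
  have hcd : ∀ X Y : N.Aux, Integrable (fun k => |Cube.coord X k - Cube.coord Y k|) μ :=
    fun X Y => ((hci X).sub (hci Y)).abs
  have hsurj : ∀ f : Cube N.Aux → ℝ, Measurable f → (∀ k, f k ∈ Set.Icc (0 : ℝ) 1) →
      ∃ X, ∀ᵐ k ∂μ, Cube.coord X k = f k := by
    intro f hf hf01
    have hfi : Integrable f μ := integrable_of_mem_Icc hf hf01
    have hsub : ∀ X : N.Aux, Integrable (fun k => |Cube.coord X k - f k|) μ := fun X =>
      ((hci X).sub hfi).abs
    -- A continuous function close to `f` in mean is clipped to `[0,1]` and approximated uniformly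
    -- by a term, which on `G` coincides with the coordinate of its own value.
    have happrox : ∀ ε > 0, ∃ X : N.Aux, ∫ k, |Cube.coord X k - f k| ∂μ ≤ ε := by
      intro ε hε
      obtain ⟨g, -, hg, hgc, hgi⟩ := hfi.exists_hasCompactSupport_integral_sub_le (half_pos hε)
      let g' : Cube N.Aux → ℝ := fun k => min (max (g k) 0) 1
      have hg' : Continuous g' := (hgc.max continuous_const).min continuous_const
      have hg01 : ∀ k, g' k ∈ Set.Icc (0 : ℝ) 1 := fun k =>
        ⟨le_min (le_max_right _ _) zero_le_one, min_le_right _ _⟩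
      have : Nonempty N.Aux := ⟨N.zero⟩
      obtain ⟨τ, hτ⟩ := exists_term_abs_sub_le (J := N.Aux) g' hg' hg01 (half_pos hε)
      refine ⟨τ.eval id, ?_⟩
      have hb : ∀ᵐ k ∂μ, |Cube.coord (τ.eval id) k - f k| ≤ ‖f k - g k‖ + ε / 2 := by
        filter_upwards [hG] with k hk
        rw [← hk τ, Real.norm_eq_abs]
        have h1 : |g' k - Cube.ev τ k| ≤ ε / 2 := hτ k
        have h2 := hf01 k
        have h3 : |f k - g' k| ≤ |f k - g k| := by
          simp only [g', Set.mem_Icc] at h2 ⊢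
          grind
        calc |Cube.ev τ k - f k| = |(f k - g' k) + (g' k - Cube.ev τ k)| := by
              rw [abs_sub_comm]
              ring_nf
          _ ≤ _ := (abs_add_le _ _).trans (add_le_add h3 h1)
      calc ∫ k, |Cube.coord (τ.eval id) k - f k| ∂μ ≤ ∫ k, (‖f k - g k‖ + ε / 2) ∂μ :=
            integral_mono_ae (hsub _) ((hfi.sub hgi).norm.add (integrable_const _)) hb
        _ = ∫ k, ‖f k - g k‖ ∂μ + ε / 2 := by
            have hd : Integrable (fun k => ‖f k - g k‖) μ := (hfi.sub hgi).norm
            rw [integral_add hd (integrable_const _)]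
            simp
        _ ≤ ε := by linarith
    choose X hX using fun n : ℕ => happrox ((1 / 2 : ℝ) ^ n) (by positivity)
    have htri : ∀ Y Z : N.Aux, dist Y Z ≤
        ∫ k, |Cube.coord Y k - f k| ∂μ + ∫ k, |Cube.coord Z k - f k| ∂μ := by
      intro Y Z
      rw [hdist, ← integral_add (hsub _) (hsub _)]
      refine integral_mono ((hci Y).sub (hci Z)).abs ((hsub _).add (hsub _)) fun k => ?_
      change |_| ≤ |_| + |_|
      rw [abs_sub_comm (Cube.coord Z k)]
      exact abs_sub_le _ _ _
    -- The distance of the auxiliary sort is the mean distance of coordinates, so its completeness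
    -- produces an element that represents `f` exactly.
    have hcau : CauchySeq X := cauchySeq_of_le_geometric (1 / 2) 2 (by norm_num) fun n => by
      refine (htri _ _).trans ((add_le_add (hX n) (hX (n + 1))).trans ?_)
      rw [pow_succ]
      have : (0 : ℝ) ≤ (1 / 2) ^ n := by positivity
      linarith
    obtain ⟨Y, hY⟩ := cauchySeq_tendsto_of_complete hcau
    refine ⟨Y, ?_⟩
    have hle : ∀ n, ∫ k, |Cube.coord Y k - f k| ∂μ ≤ dist (X n) Y + (1 / 2) ^ n := by
      intro n
      refine le_trans ?_ (add_le_add le_rfl (hX n))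
      rw [hdist, ← integral_add (hcd _ _) (hsub _)]
      refine integral_mono (hsub _) ((hcd _ _).add (hsub _)) fun k => ?_
      change |_| ≤ |_| + |_|
      rw [abs_sub_comm (Cube.coord (X n) k)]
      exact abs_sub_le _ _ _
    have hz : ∫ k, |Cube.coord Y k - f k| ∂μ ≤ 0 := by
      refine ge_of_tendsto' (x := atTop) ?_ hle
      have := (tendsto_iff_dist_tendsto_zero.mp hY).add
        (tendsto_pow_atTop_nhds_zero_of_lt_one (by norm_num : (0 : ℝ) ≤ 1 / 2) (by norm_num))
      simpa using this
    have := (integral_eq_zero_iff_of_nonneg (fun k => abs_nonneg _) (hsub Y)).mp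
      (_root_.le_antisymm hz (integral_nonneg fun k => abs_nonneg _))
    filter_upwards [this] with k hk
    exact sub_eq_zero.mp (abs_eq_zero.mp hk)
  have hGm : MeasurableSet G := hGc.measurableSet
  have hrestr : μ.restrict G = μ := Measure.restrict_eq_self_of_ae_mem hG
  let ν : Measure G := μ.comap Subtype.val
  have hmap : ν.map Subtype.val = μ := by
    rw [map_comap_subtype_coe hGm, hrestr]
  have hint : ∀ X : N.Aux, ∫ ω, Cube.coord X ω.1 ∂ν = N.E X := fun X => by
    rw [integral_subtype_comap hGm, hrestr, hE]
  refine ⟨{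
    Ω := G
    μ := ν
    isProbabilityMeasure := ⟨?_⟩
    r := fun X ω => Cube.coord X ω.1
    measurable := fun X => (Cube.continuous_coord X).measurable.comp measurable_subtype_coe
    mem := fun X ω => Cube.coord_mem X ω.1
    hom := fun ω => ⟨fun X => (ω.2 (.neg (.var X))).symm, fun X => (ω.2 (.half (.var X))).symm,
      fun X Y => (ω.2 (.tsub (.var X) (.var Y))).symm⟩
    zero := fun ω => ?_
    E_eq := fun X => (hint X).symm
    surj := fun f hf hf01 => ?_ }⟩
  · have h1 : (ν.map Subtype.val) Set.univ = 1 := by rw [hmap]; exact measure_univ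
    rwa [Measure.map_apply measurable_subtype_coe MeasurableSet.univ, Set.preimage_univ] at h1
  · have h1 := ω.2 ((FreeCPL.var N.zero).tsub (.var N.zero))
    have e0 := h.eval_eq_zero (τ := (FreeCPL.var N.zero).tsub (.var N.zero))
      (fun v _ => by simp [FreeCPL.eval, CPL.tsub_real]) id
    rw [e0] at h1
    rw [← h1]
    simp [Cube.ev, FreeCPL.eval, CPL.tsub_real]
  · obtain ⟨g, hg, hgf⟩ := (MeasurableEmbedding.subtype_coe hGm).exists_measurable_extend hf
      fun _ => ⟨0⟩
    obtain ⟨X, hX⟩ := hsurj (fun k => min (max (g k) 0) 1)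
      ((hg.max measurable_const).min measurable_const) fun k =>
        ⟨le_min (le_max_right _ _) zero_le_one, min_le_right _ _⟩
    refine ⟨X, ?_⟩
    rw [← hmap] at hX
    filter_upwards [ae_of_ae_map measurable_subtype_coe.aemeasurable hX] with ω hω
    rw [hω, show g ω.1 = f ω from congrFun hgf ω]
    have := hf01 ω
    simp only [Set.mem_Icc] at this
    grind

end

end ContLogic

namespace ContLogic

open Filter Topology

noncomputable section

/-! ### The random variables of a representation -/

theorem exists_dyadic_between {x y : ℝ} (hx : 0 ≤ x) (hxy : x < y) :
    ∃ k n : ℕ, x < (k : ℝ) / 2 ^ n ∧ (k : ℝ) / 2 ^ n ≤ y := by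
  obtain ⟨n, hn⟩ := exists_pow_lt_of_lt_one (sub_pos.mpr hxy) (show (1 / 2 : ℝ) < 1 by norm_num)
  have h2 : (0 : ℝ) < 2 ^ n := by positivity
  have hn' : 1 < (y - x) * 2 ^ n := by
    rw [div_pow, one_pow, div_lt_iff₀ h2] at hn
    exact hn
  refine ⟨⌊y * 2 ^ n⌋₊, n, ?_, ?_⟩
  · rw [lt_div_iff₀ h2]
    have := Nat.sub_one_lt_floor (y * 2 ^ n)
    linarith
  · rw [div_le_iff₀ h2]
    exact Nat.floor_le (mul_nonneg (hx.trans hxy.le) h2.le)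

namespace Rep

variable {L : Signature.{u}} {N : RStr L} (R : Rep N)

theorem r_neg (X : N.Aux) (ω : R.Ω) : R.r (CPL.neg X) ω = 1 - R.r X ω := (R.hom ω).neg X

theorem r_half (X : N.Aux) (ω : R.Ω) : R.r (CPL.half X) ω = R.r X ω / 2 := (R.hom ω).half X

theorem r_tsub (X Y : N.Aux) (ω : R.Ω) : R.r (CPL.tsub X Y) ω = max (R.r X ω - R.r Y ω) 0 :=
  (R.hom ω).tsub X Y

theorem r_inf (X Y : N.Aux) (ω : R.Ω) : R.r (CPL.inf X Y) ω = min (R.r X ω) (R.r Y ω) := by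
  rw [(R.hom ω).inf, CPL.inf_real (R.mem _ _).1 (R.mem _ _).1]

theorem r_sup (X Y : N.Aux) (ω : R.Ω) : R.r (CPL.sup X Y) ω = max (R.r X ω) (R.r Y ω) := by
  rw [(R.hom ω).sup, CPL.sup_real (R.mem _ _).2 (R.mem _ _).2]

theorem r_tadd (X Y : N.Aux) (ω : R.Ω) : R.r (CPL.tadd X Y) ω = min (R.r X ω + R.r Y ω) 1 := by
  rw [(R.hom ω).tadd, CPL.tadd_real]

theorem r_dyadic (k n : ℕ) (ω : R.Ω) :
    R.r (CPL.dyadic N.zero k n) ω = min ((k : ℝ) / 2 ^ n) 1 := by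
  have h := (R.hom ω).dyadic N.zero k n
  simp only [R.zero] at h
  rw [h, CPL.dyadic_real]

theorem r_eval {α : Type v} (τ : FreeCPL α) (X : α → N.Aux) (ω : R.Ω) :
    R.r (τ.eval X) ω = τ.eval fun x => R.r (X x) ω := FreeCPL.map_eval (R.hom ω) X τ

theorem integrable (X : N.Aux) : Integrable (R.r X) R.μ :=
  integrable_of_mem_Icc (R.measurable X) (R.mem X)

theorem integrable_abs_sub (X Y : N.Aux) : Integrable (fun ω => |R.r X ω - R.r Y ω|) R.μ :=
  ((R.integrable X).sub (R.integrable Y)).abs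

theorem dist_eq (h : N.IsRV) (X Y : N.Aux) : dist X Y = ∫ ω, |R.r X ω - R.r Y ω| ∂(R.μ) := by
  rw [h.rv3, R.E_eq, R.E_eq, ← integral_add (R.integrable _) (R.integrable _)]
  refine integral_congr_ae (Eventually.of_forall fun ω => ?_)
  change R.r (CPL.tsub X Y) ω + R.r (CPL.tsub Y X) ω = |R.r X ω - R.r Y ω|
  rw [R.r_tsub, R.r_tsub]
  grind

theorem eq_of_ae (h : N.IsRV) {X Y : N.Aux} (hXY : R.r X =ᵐ[R.μ] R.r Y) : X = Y := by
  rw [← dist_eq_zero, R.dist_eq h]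
  refine (integral_congr_ae ?_).trans (integral_zero' _ _)
  filter_upwards [hXY] with ω hω
  simp [hω]

theorem ext (h : N.IsRV) {X Y : N.Aux} (hXY : ∀ ω, R.r X ω = R.r Y ω) : X = Y :=
  R.eq_of_ae h (Eventually.of_forall hXY)

theorem auxLE_of_ae (h : N.IsRV) {X Y : N.Aux} (hXY : ∀ᵐ ω ∂(R.μ), R.r X ω ≤ R.r Y ω) :
    N.AuxLE X Y := by
  refine R.eq_of_ae h ?_
  filter_upwards [hXY] with ω hω
  rw [R.r_tsub, R.zero]
  exact max_eq_right (sub_nonpos.mpr hω)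

theorem le_of_auxLE {X Y : N.Aux} (hXY : N.AuxLE X Y) (ω : R.Ω) : R.r X ω ≤ R.r Y ω := by
  have h := R.r_tsub X Y ω
  rw [show CPL.tsub X Y = N.zero from hXY, R.zero] at h
  exact sub_nonpos.mp (max_eq_right_iff.mp h.symm)

theorem auxLE_iff (h : N.IsRV) {X Y : N.Aux} : N.AuxLE X Y ↔ ∀ ω, R.r X ω ≤ R.r Y ω :=
  ⟨R.le_of_auxLE, fun hXY => R.auxLE_of_ae h (Eventually.of_forall hXY)⟩

/-- An almost sure inequality amounts to the equation `X ∸ Y = 0` in the auxiliary sort, which the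
representation respects at every point. This repeatedly removes null sets. -/
theorem le_of_ae (h : N.IsRV) {X Y : N.Aux} (hXY : ∀ᵐ ω ∂(R.μ), R.r X ω ≤ R.r Y ω) (ω : R.Ω) :
    R.r X ω ≤ R.r Y ω := R.le_of_auxLE (R.auxLE_of_ae h hXY) ω

theorem auxInf_eq (h : N.IsRV) {S : Set N.Aux} {Y : N.Aux}
    (h1 : ∀ X ∈ S, N.AuxLE Y X) (h2 : ∀ Z, (∀ X ∈ S, N.AuxLE Z X) → N.AuxLE Z Y) :
    N.auxInf S = Y := by
  have hex : ∃ X, (∀ Y ∈ S, N.AuxLE X Y) ∧ ∀ Z, (∀ Y ∈ S, N.AuxLE Z Y) → N.AuxLE Z X :=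
    ⟨Y, h1, h2⟩
  rw [RStr.auxInf, dif_pos hex]
  exact h.le_antisymm (h2 _ hex.choose_spec.1) (hex.choose_spec.2 _ h1)

theorem auxSup_eq (h : N.IsRV) {S : Set N.Aux} {Y : N.Aux}
    (h1 : ∀ X ∈ S, N.AuxLE X Y) (h2 : ∀ Z, (∀ X ∈ S, N.AuxLE X Z) → N.AuxLE Y Z) :
    N.auxSup S = Y := by
  have hex : ∃ X, (∀ Y ∈ S, N.AuxLE Y X) ∧ ∀ Z, (∀ Y ∈ S, N.AuxLE Y Z) → N.AuxLE X Z :=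
    ⟨Y, h1, h2⟩
  rw [RStr.auxSup, dif_pos hex]
  exact h.le_antisymm (hex.choose_spec.2 _ h1) (h2 _ hex.choose_spec.1)

/-! ### The fibres -/

/-- If `D < δ ε` and `X > ε` at `ω`, dyadic constants fit strictly between; with them, both sides of
the minimum in the axiom are positive at `ω`. -/
theorem le_of_controls {δ : Modulus} {D X : N.Aux} (h : N.Controls δ D X) (ω : R.Ω)
    (ε : Set.Ioc (0 : ℝ) 1) (hD : R.r D ω < δ ε) : R.r X ω ≤ ε := by
  by_contra hX
  push Not at hX
  obtain ⟨k, n, h1, h2⟩ := exists_dyadic_between (R.mem D ω).1 hD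
  obtain ⟨j, m, h3, h4⟩ := exists_dyadic_between ε.2.1.le
    (show (ε : ℝ) < (ε + R.r X ω) / 2 by linarith)
  have h5 := congrArg (fun Y => R.r Y ω) (h ε k n j m h2 h3.le)
  simp only [R.r_inf, R.r_tsub, R.r_dyadic, R.zero] at h5
  have h6 := (δ ε).2.2
  have h7 := (R.mem D ω).1
  have h8 := (R.mem X ω).2
  grind

variable (h : N.IsT0R)
include h

theorem r_brDist_self (x : N.Main) (ω : R.Ω) : R.r (N.brDist x x) ω = 0 := by
  have h1 : N.brDist x x = N.zero := by
    have := h.r2 x x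
    rw [dist_self] at this
    exact dist_eq_zero.mp this.symm
  rw [h1, R.zero]

omit h in
theorem le_of_controls_id {D X : N.Aux} (h : N.Controls id D X) (ω : R.Ω) :
    R.r X ω ≤ R.r D ω := by
  refine le_of_forall_gt_imp_ge_of_dense fun e he => ?_
  rcases le_or_gt e 1 with he1 | he1
  · exact R.le_of_controls h ω ⟨e, (R.mem D ω).1.trans_lt he, he1⟩ he
  · exact (R.mem X ω).2.trans he1.le

/-- Symmetry is not an axiom. It follows from R1 for the right argument of `⟦d⟧`, comparing
distances from `y` and using that `⟦d(y,y)⟧` vanishes. -/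
theorem r_brDist_comm (x y : N.Main) (ω : R.Ω) :
    R.r (N.brDist x y) ω = R.r (N.brDist y x) ω := by
  have key : ∀ x y : N.Main, R.r (N.brDist y x) ω ≤ R.r (N.brDist x y) ω := fun x y => by
    have := R.le_of_controls_id (h.r1_dist_right x y y) ω
    rw [R.r_tsub, R.r_brDist_self h, sub_zero, max_eq_left (R.mem _ _).1] at this
    exact this
  exact le_antisymm (key y x) (key x y)

theorem r_brDist_triangle (x y z : N.Main) (ω : R.Ω) :
    R.r (N.brDist x z) ω ≤ R.r (N.brDist x y) ω + R.r (N.brDist y z) ω := by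
  have := R.le_of_controls_id (h.r1_dist_left x y z) ω
  rw [R.r_tsub] at this
  linarith [le_max_left (R.r (N.brDist x z) ω - R.r (N.brDist y z) ω) 0]

theorem r_brPred_le {n : ℕ} (P : L.Pred n) (i : Fin n) (ω : R.Ω) (ε : Set.Ioc (0 : ℝ) 1)
    (x : Fin n → N.Main) (y : N.Main) (hxy : R.r (N.brDist (x i) y) ω < L.predMod P i ε) :
    R.r (N.brPred P x) ω - R.r (N.brPred P (Function.update x i y)) ω ≤ ε := by
  have := R.le_of_controls (h.r1_pred P i x y) ω ε hxy
  rw [R.r_tsub] at this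
  exact (le_max_left _ _).trans this

/-- Each point of the probability space of a representation defines a structure. -/
theorem exists_fibre (ω : R.Ω) : ∃ (M : Str L) (ι : N.Main → M.Carrier), DenseRange ι ∧
    (∀ x y, dist (ι x) (ι y) = R.r (N.brDist x y) ω) ∧
    (∀ {n : ℕ} (f : L.Func n) (x : Fin n → N.Main), M.func f (ι ∘ x) = ι (N.func f x)) ∧
    (∀ {n : ℕ} (P : L.Pred n) (x : Fin n → N.Main),
      M.pred P (ι ∘ x) = R.r (N.brPred P x) ω) := by
  let pm : PseudoMetricSpace N.Main :=
    { dist := fun x y => R.r (N.brDist x y) ω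
      dist_self := fun x => R.r_brDist_self h x ω
      dist_comm := fun x y => R.r_brDist_comm h x y ω
      dist_triangle := fun x y z => R.r_brDist_triangle h x y z ω }
  refine @exists_str_completion L N.Main pm _ (fun x y => (R.mem _ _).2) N.func
    (fun P x => R.r (N.brPred P x) ω) (fun P x => R.mem _ _)
    (fun f i ε x y hxy => R.le_of_controls (h.r1_func f i x y) ω ε hxy)
    (fun {n} P i ε x y hxy => abs_le.mpr ⟨?_, R.r_brPred_le h P i ω ε x y hxy⟩)
  -- R1 is one-sided for predicates; exchanging the old and the new argument gives the other
  -- inequality.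
  have h1 := R.r_brPred_le h P i ω ε (Function.update x i y) (x i) (by
    rw [Function.update_self, R.r_brDist_comm h]
    exact hxy)
  rw [Function.update_idem, Function.update_eq_self] at h1
  linarith

/-- The fibre at a point. -/
def fib (ω : R.Ω) : Str L := (R.exists_fibre h ω).choose

/-- The value of a random element at a point. -/
def pt (ω : R.Ω) : N.Main → (R.fib h ω).Carrier := (R.exists_fibre h ω).choose_spec.choose

theorem denseRange_pt (ω : R.Ω) : DenseRange (R.pt h ω) :=
  (R.exists_fibre h ω).choose_spec.choose_spec.1

theorem dist_pt (ω : R.Ω) (x y : N.Main) :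
    dist (R.pt h ω x) (R.pt h ω y) = R.r (N.brDist x y) ω :=
  (R.exists_fibre h ω).choose_spec.choose_spec.2.1 x y

theorem func_pt (ω : R.Ω) {n : ℕ} (f : L.Func n) (x : Fin n → N.Main) :
    (R.fib h ω).func f (R.pt h ω ∘ x) = R.pt h ω (N.func f x) :=
  (R.exists_fibre h ω).choose_spec.choose_spec.2.2.1 f x

theorem pred_pt (ω : R.Ω) {n : ℕ} (P : L.Pred n) (x : Fin n → N.Main) :
    (R.fib h ω).pred P (R.pt h ω ∘ x) = R.r (N.brPred P x) ω :=
  (R.exists_fibre h ω).choose_spec.choose_spec.2.2.2 P x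

theorem pt_eq_iff (ω : R.Ω) (x y : N.Main) :
    R.pt h ω x = R.pt h ω y ↔ R.r (N.brDist x y) ω = 0 := by
  rw [← R.dist_pt h, dist_eq_zero]

theorem dist_main_eq (x y : N.Main) : dist x y = ∫ ω, R.r (N.brDist x y) ω ∂(R.μ) := by
  rw [h.r2, R.E_eq]

/-! ### Gluing -/

/-- R3 provides `z` for which the mean error `g z` is small. Since `dist a b` is at most the sum of
the errors of `a` and `b`, such elements form a Cauchy sequence, and the limit has error `0`. -/
theorem exists_glue (x y : N.Main) {B : Set R.Ω} (hB : MeasurableSet B) :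
    ∃ z, ∀ᵐ ω ∂(R.μ), (ω ∈ B → R.pt h ω z = R.pt h ω x) ∧ (ω ∉ B → R.pt h ω z = R.pt h ω y) := by
  classical
  let g : N.Main → R.Ω → ℝ := fun z ω =>
    if ω ∈ B then R.r (N.brDist x z) ω else R.r (N.brDist y z) ω
  have hgm : ∀ z, Measurable (g z) := fun z => Measurable.ite hB (R.measurable _) (R.measurable _)
  have hg01 : ∀ z ω, g z ω ∈ Set.Icc (0 : ℝ) 1 := fun z ω => by
    simp only [g]
    split_ifs <;> exact R.mem _ _
  have hgi : ∀ z, Integrable (g z) R.μ := fun z => integrable_of_mem_Icc (hgm z) (hg01 z)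
  obtain ⟨U, hU⟩ := R.surj (B.indicator 1) (measurable_one.indicator hB) fun ω => by
    by_cases hω : ω ∈ B <;> simp [hω]
  have hU0 : N.E (CPL.inf U (CPL.neg U)) = 0 := by
    rw [R.E_eq]
    refine (integral_congr_ae ?_).trans (integral_zero' _ _)
    filter_upwards [hU] with ω hω
    rw [R.r_inf, R.r_neg, hω]
    by_cases hω' : ω ∈ B <;> simp [hω']
  have hval : ∀ z, N.E (CPL.sup (CPL.inf (N.brDist x z) U) (CPL.inf (N.brDist y z) (CPL.neg U)))
      = ∫ ω, g z ω ∂(R.μ) := by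
    intro z
    rw [R.E_eq]
    refine integral_congr_ae ?_
    filter_upwards [hU] with ω hω
    rw [R.r_sup, R.r_inf, R.r_inf, R.r_neg, hω]
    have h1 := R.mem (N.brDist x z) ω
    have h2 := R.mem (N.brDist y z) ω
    simp only [Set.mem_Icc] at h1 h2
    by_cases hω' : ω ∈ B
    · simp [g, hω', h1]
    · simp [g, hω', h2]
  have hex : ∀ ε > 0, ∃ z, ∫ ω, g z ω ∂(R.μ) < ε := by
    intro ε hε
    have := h.r3 x y U hU0
    rw [← this] at hε
    obtain ⟨z, hz⟩ := exists_lt_of_ciInf_lt hε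
    exact ⟨z, hval z ▸ (hz.trans_eq rfl)⟩
  have hex' : ∀ n : ℕ, ∃ z, ∫ ω, g z ω ∂(R.μ) < (1 / 2 : ℝ) ^ n := fun n => hex _ (by positivity)
  choose z hz using hex'
  have hdg : ∀ a b, dist a b ≤ ∫ ω, g a ω ∂(R.μ) + ∫ ω, g b ω ∂(R.μ) := by
    intro a b
    rw [R.dist_main_eq h, ← integral_add (hgi a) (hgi b)]
    refine integral_mono (R.integrable _) ((hgi a).add (hgi b)) fun ω => ?_
    simp only [g]
    split_ifs
    · rw [R.r_brDist_comm h x a]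
      exact R.r_brDist_triangle h _ _ _ ω
    · rw [R.r_brDist_comm h y a]
      exact R.r_brDist_triangle h _ _ _ ω
  have hcau : CauchySeq z := cauchySeq_of_le_geometric (1 / 2) 2 (by norm_num) fun n => by
    refine (hdg _ _).trans ((add_le_add (hz n).le (hz (n + 1)).le).trans ?_)
    rw [pow_succ]
    have : (0 : ℝ) ≤ (1 / 2) ^ n := by positivity
    linarith
  obtain ⟨c, hc⟩ := cauchySeq_tendsto_of_complete hcau
  have hle : ∀ n, ∫ ω, g c ω ∂(R.μ) ≤ dist (z n) c + (1 / 2) ^ n := by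
    intro n
    refine le_trans ?_ (add_le_add le_rfl (hz n).le)
    rw [R.dist_main_eq h, ← integral_add (R.integrable _) (hgi _)]
    refine integral_mono (hgi _) ((R.integrable _).add (hgi _)) fun ω => ?_
    simp only [g]
    split_ifs
    · rw [add_comm]
      exact R.r_brDist_triangle h _ _ _ ω
    · rw [add_comm]
      exact R.r_brDist_triangle h _ _ _ ω
  have h0 : ∫ ω, g c ω ∂(R.μ) ≤ 0 := by
    refine ge_of_tendsto' (x := atTop) ?_ hle
    have := (tendsto_iff_dist_tendsto_zero.mp hc).add
      (tendsto_pow_atTop_nhds_zero_of_lt_one (by norm_num : (0 : ℝ) ≤ 1 / 2) (by norm_num))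
    simpa using this
  refine ⟨c, ?_⟩
  filter_upwards [(integral_eq_zero_iff_of_nonneg (fun ω => (hg01 c ω).1) (hgi c)).mp
    (le_antisymm h0 (integral_nonneg fun ω => (hg01 c ω).1))] with ω hω
  simp only [g, Pi.zero_apply] at hω
  refine ⟨fun hB => ?_, fun hB => ?_⟩
  · rw [if_pos hB] at hω
    exact ((R.pt_eq_iff h ω x c).mpr hω).symm
  · rw [if_neg hB] at hω
    exact ((R.pt_eq_iff h ω y c).mpr hω).symm

/-- Gluing along a random choice from a finite set. -/
theorem exists_glue_finite {J : Type*} [Finite J] [Nonempty J] [MeasurableSpace J]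
    [MeasurableSingletonClass J] (c : J → N.Main) {s : R.Ω → J} (hs : Measurable s) :
    ∃ z, ∀ᵐ ω ∂(R.μ), R.pt h ω z = R.pt h ω (c (s ω)) := by
  classical
  have : ∀ F : Finset J, ∃ z, ∀ᵐ ω ∂(R.μ), s ω ∈ F → R.pt h ω z = R.pt h ω (c (s ω)) := by
    intro F
    induction F using Finset.induction_on with
    | empty => exact ⟨c (Classical.arbitrary J), by simp⟩
    | insert j F hj ih =>
      obtain ⟨z, hz⟩ := ih
      obtain ⟨z', hz'⟩ := R.exists_glue h (c j) z (hs (measurableSet_singleton j))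
      refine ⟨z', ?_⟩
      filter_upwards [hz, hz'] with ω h1 h2 h3
      by_cases hj' : s ω = j
      · rw [h2.1 hj', hj']
      · rw [h2.2 hj']
        exact h1 ((Finset.mem_insert.mp h3).resolve_left hj')
  obtain ⟨z, hz⟩ := this (Set.toFinite Set.univ).toFinset
  refine ⟨z, ?_⟩
  filter_upwards [hz] with ω hω
  exact hω (by simp)

/-! ### Infima over the main sort -/

/-- Infima of local families over the main sort are attained up to `ε`. -/
theorem exists_inf (X : N.Main → N.Aux)
    (loc : ∀ ω c c', R.pt h ω c = R.pt h ω c' → R.r (X c) ω = R.r (X c') ω) :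
    ∃ Y : N.Aux, (∀ c ω, R.r Y ω ≤ R.r (X c) ω) ∧
      ∀ ε > 0, ∃ c, ∀ ω, R.r (X c) ω ≤ R.r Y ω + ε := by
  have hRV : N.IsRV := h.toIsRV
  have hbd : BddBelow (Set.range fun c => N.E (X c)) :=
    ⟨0, by rintro _ ⟨c, rfl⟩; exact RStr.IsRV.E_nonneg _⟩
  -- A sequence minimising the expectation, which will also converge to the infimum in the lattice.
  have hex : ∀ n : ℕ, ∃ c, N.E (X c) < (⨅ c, N.E (X c)) + (1 / 2 : ℝ) ^ n := fun n =>
    exists_lt_of_ciInf_lt (lt_add_of_pos_right _ (by positivity))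
  choose c hc using hex
  have hmi : ∀ Y Z : N.Aux, Integrable (fun ω => max (R.r Y ω - R.r Z ω) 0) R.μ := fun Y Z => by
    have := R.integrable (CPL.tsub Y Z)
    exact this.congr (Eventually.of_forall fun ω => R.r_tsub Y Z ω)
  -- Using `b` wherever it is better than `c n` lowers the expectation by exactly this integral, and
  -- no element gains more than `(1/2) ^ n` over `c n`.
  have hbelow : ∀ n b, ∫ ω, max (R.r (X (c n)) ω - R.r (X b) ω) 0 ∂(R.μ) ≤ (1 / 2 : ℝ) ^ n := by
    intro n b
    obtain ⟨z, hz⟩ := R.exists_glue h b (c n)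
      (measurableSet_lt (R.measurable (X b)) (R.measurable (X (c n))))
    have h1 : N.E (X z) = N.E (X (c n)) - ∫ ω, max (R.r (X (c n)) ω - R.r (X b) ω) 0 ∂(R.μ) := by
      rw [R.E_eq, R.E_eq, ← integral_sub (R.integrable _) (hmi _ _)]
      refine integral_congr_ae ?_
      filter_upwards [hz] with ω hω
      by_cases hlt : R.r (X b) ω < R.r (X (c n)) ω
      · rw [loc ω _ _ (hω.1 hlt), max_eq_left (by linarith)]
        ring
      · rw [loc ω _ _ (hω.2 hlt), max_eq_right (by linarith)]
        ring
    have h2 : (⨅ c, N.E (X c)) ≤ N.E (X z) := ciInf_le hbd z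
    linarith [hc n]
  have hcau : CauchySeq fun n => X (c n) :=
    cauchySeq_of_le_geometric (1 / 2) 2 (by norm_num) fun n => by
      rw [R.dist_eq hRV]
      have e : ∀ ω, |R.r (X (c n)) ω - R.r (X (c (n + 1))) ω| =
          max (R.r (X (c n)) ω - R.r (X (c (n + 1))) ω) 0 +
          max (R.r (X (c (n + 1))) ω - R.r (X (c n)) ω) 0 := fun ω => by grind
      simp only [e]
      rw [integral_add (hmi _ _) (hmi _ _)]
      have h1 := hbelow n (c (n + 1))
      have h2 := hbelow (n + 1) (c n)
      rw [pow_succ] at h2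
      have : (0 : ℝ) ≤ (1 / 2) ^ n := by positivity
      linarith
  obtain ⟨Y, hY⟩ := cauchySeq_tendsto_of_complete hcau
  have hYd := tendsto_iff_dist_tendsto_zero.mp hY
  have hYle : ∀ b ω, R.r Y ω ≤ R.r (X b) ω := by
    intro b
    refine R.le_of_ae hRV ?_
    have h0 : ∫ ω, max (R.r Y ω - R.r (X b) ω) 0 ∂(R.μ) ≤ 0 := by
      refine ge_of_tendsto' (x := atTop) (f := fun n => dist (X (c n)) Y + (1 / 2 : ℝ) ^ n)
        ?_ fun n => ?_
      · simpa using hYd.add (tendsto_pow_atTop_nhds_zero_of_lt_one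
          (by norm_num : (0 : ℝ) ≤ 1 / 2) (by norm_num))
      · refine le_trans ?_ (add_le_add le_rfl (hbelow n b))
        rw [R.dist_eq hRV, ← integral_add (R.integrable_abs_sub _ _) (hmi _ _)]
        refine integral_mono (hmi _ _) ((R.integrable_abs_sub _ _).add (hmi _ _)) fun ω => ?_
        grind
    filter_upwards [(integral_eq_zero_iff_of_nonneg (fun ω => le_max_right _ _)
      (hmi _ _)).mp (le_antisymm h0 (integral_nonneg fun ω => le_max_right _ _))] with ω hω
    exact sub_nonpos.mp (max_eq_right_iff.mp hω)
  refine ⟨Y, hYle, ?_⟩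
  have main : ∀ ε > 0, ∃ z, ∀ᵐ ω ∂(R.μ), R.r (X z) ω ≤ R.r Y ω + ε := by
    intro ε hε
    have hb : ∀ k : ℕ, ∃ b, dist (X b) Y ≤ ε * (1 / 2) ^ k := fun k => by
      obtain ⟨n, hn⟩ := (hYd.eventually_lt_const
        (show 0 < ε * (1 / 2 : ℝ) ^ k by positivity)).exists
      exact ⟨c n, hn.le⟩
    choose b hb using hb
    let g : ℕ → R.Ω → ℝ := fun k ω => |R.r (X (b k)) ω - R.r Y ω| / ε
    have hgi : ∀ k, Integrable (g k) R.μ := fun k => (R.integrable_abs_sub _ _).div_const ε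
    have hg : ∀ k, ∫ ω, g k ω ∂(R.μ) ≤ (1 / 2) ^ k := fun k => by
      simp only [g]
      rw [integral_div, ← R.dist_eq hRV, div_le_iff₀ hε, mul_comm]
      exact hb k
    have hgood : ∀ a : N.Main, MeasurableSet {ω | R.r (X a) ω ≤ R.r Y ω + ε} := fun a =>
      measurableSet_le (R.measurable _) ((R.measurable _).add_const _)
    choose G hG using fun a a' : N.Main => R.exists_glue h a a' (hgood a)
    -- Step `k + 1` keeps the current element where it is already within `ε` of `Y`, and takes `b (k
    -- + 1)` elsewhere.
    let z : ℕ → N.Main := fun k => Nat.rec (b 0) (fun k a => G a (b (k + 1))) k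
    have hzs : ∀ k, z (k + 1) = G (z k) (b (k + 1)) := fun k => rfl
    have hall : ∀ᵐ ω ∂(R.μ), ∀ k, (R.r (X (z k)) ω ≤ R.r Y ω + ε →
        R.pt h ω (z (k + 1)) = R.pt h ω (z k)) ∧ (¬ R.r (X (z k)) ω ≤ R.r Y ω + ε →
        R.pt h ω (z (k + 1)) = R.pt h ω (b (k + 1))) :=
      ae_all_iff.mpr fun k => hG (z k) (b (k + 1))
    -- If `z k` is still bad at `ω`, then so is `b k`. The bad events therefore have measure at most
    -- `(1/2) ^ k`, and off them `z` no longer moves.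
    have hbad : ∀ᵐ ω ∂(R.μ), ∀ k, ¬ R.r (X (z k)) ω ≤ R.r Y ω + ε → 1 ≤ g k ω := by
      filter_upwards [hall] with ω hω k hk
      have hbk : ¬ R.r (X (b k)) ω ≤ R.r Y ω + ε := by
        cases k with
        | zero => exact hk
        | succ k =>
          by_cases hg' : R.r (X (z k)) ω ≤ R.r Y ω + ε
          · rw [loc ω _ _ ((hω k).1 hg')] at hk
            exact absurd hg' hk
          · rwa [loc ω _ _ ((hω k).2 hg')] at hk
      rw [le_div_iff₀ hε, one_mul]
      exact le_trans (by linarith) (le_abs_self _)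
    have hcz : CauchySeq z := cauchySeq_of_le_geometric (1 / 2) 1 (by norm_num) fun k => by
      rw [one_mul, R.dist_main_eq h]
      refine le_trans (integral_mono_ae (R.integrable _) (hgi k) ?_) (hg k)
      filter_upwards [hall, hbad] with ω h1 h2
      by_cases hk : R.r (X (z k)) ω ≤ R.r Y ω + ε
      · rw [← R.dist_pt h, (h1 k).1 hk, dist_self]
        exact div_nonneg (abs_nonneg _) hε.le
      · exact (R.mem _ _).2.trans (h2 k hk)
    obtain ⟨a, ha⟩ := cauchySeq_tendsto_of_complete hcz
    refine ⟨a, ?_⟩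
    have hstay : ∀ᵐ ω ∂(R.μ), ∀ k, R.r (X (z k)) ω ≤ R.r Y ω + ε → ∀ m,
        R.pt h ω (z (k + m)) = R.pt h ω (z k) := by
      filter_upwards [hall] with ω hω k hk m
      induction m with
      | zero => rfl
      | succ m ih =>
        rw [← add_assoc, (hω (k + m)).1 (by rwa [loc ω _ _ ih]), ih]
    classical
    -- The limit agrees with `z k` on the event where `z k` is good: there all later terms coincide
    -- with `z k`, and the mean distance to the limit tends to `0`.
    have hlim : ∀ᵐ ω ∂(R.μ), ∀ k, R.r (X (z k)) ω ≤ R.r Y ω + ε →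
        R.pt h ω a = R.pt h ω (z k) := by
      refine ae_all_iff.mpr fun k => ?_
      let q : R.Ω → ℝ := fun ω => if R.r (X (z k)) ω ≤ R.r Y ω + ε then
        R.r (N.brDist a (z k)) ω else 0
      have hq01 : ∀ ω, q ω ∈ Set.Icc (0 : ℝ) 1 := fun ω => by
        simp only [q]
        split_ifs
        · exact R.mem _ _
        · exact ⟨le_rfl, zero_le_one⟩
      have hqi : Integrable q R.μ := integrable_of_mem_Icc
        (Measurable.ite (hgood _) (R.measurable _) measurable_const) hq01
      have h0 : ∫ ω, q ω ∂(R.μ) ≤ 0 := by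
        refine ge_of_tendsto' (x := atTop) (f := fun m => dist (z (m + k)) a)
          ((tendsto_iff_dist_tendsto_zero.mp ha).comp (tendsto_add_atTop_nat k)) fun m => ?_
        rw [R.dist_main_eq h]
        refine integral_mono_ae hqi (R.integrable _) ?_
        filter_upwards [hstay] with ω hω
        simp only [q]
        split_ifs with hk
        · rw [← R.dist_pt h, ← R.dist_pt h, ← hω k hk m, add_comm m k, dist_comm]
        · exact (R.mem _ _).1
      filter_upwards [(integral_eq_zero_iff_of_nonneg (fun ω => (hq01 ω).1) hqi).mp
        (le_antisymm h0 (integral_nonneg fun ω => (hq01 ω).1))] with ω hω hk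
      simp only [q, if_pos hk, Pi.zero_apply] at hω
      exact (R.pt_eq_iff h ω _ _).mpr hω
    let e : R.Ω → ℝ := fun ω => if R.r (X a) ω ≤ R.r Y ω + ε then 0 else 1
    have he01 : ∀ ω, e ω ∈ Set.Icc (0 : ℝ) 1 := fun ω => by
      simp only [e]
      split_ifs <;> simp
    have hei : Integrable e R.μ := integrable_of_mem_Icc
      (Measurable.ite (hgood _) measurable_const measurable_const) he01
    have he0 : ∫ ω, e ω ∂(R.μ) ≤ 0 := by
      refine ge_of_tendsto' (x := atTop) (f := fun k : ℕ => (1 / 2 : ℝ) ^ k)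
        (tendsto_pow_atTop_nhds_zero_of_lt_one (by norm_num) (by norm_num)) fun k => ?_
      refine le_trans (integral_mono_ae hei (hgi k) ?_) (hg k)
      filter_upwards [hbad, hlim] with ω h1 h2
      simp only [e]
      split_ifs with hk
      · exact div_nonneg (abs_nonneg _) hε.le
      · refine h1 k fun hk' => hk ?_
        rwa [loc ω _ _ (h2 k hk')]
    filter_upwards [(integral_eq_zero_iff_of_nonneg (fun ω => (he01 ω).1) hei).mp
      (le_antisymm he0 (integral_nonneg fun ω => (he01 ω).1))] with ω hω
    by_contra hk
    simp only [e, if_neg hk, Pi.zero_apply, one_ne_zero] at hω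
  intro ε hε
  -- A dyadic bound makes `Y + ε` an element of the auxiliary sort, so that the almost sure
  -- inequality can be upgraded to every point.
  obtain ⟨k, n, h1, h2⟩ := exists_dyadic_between le_rfl hε
  obtain ⟨z, hz⟩ := main _ h1
  refine ⟨z, fun ω => ?_⟩
  have := R.le_of_ae hRV (Y := CPL.tadd Y (CPL.dyadic N.zero k n)) (X := X z) (by
    filter_upwards [hz] with ω hω
    have h3 := (R.mem (X z) ω).2
    have h4 := (R.mem Y ω).1
    rw [R.r_tadd, R.r_dyadic]
    grind) ω
  rw [R.r_tadd, R.r_dyadic] at this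
  grind

theorem auxInf_spec (X : N.Main → N.Aux)
    (loc : ∀ ω c c', R.pt h ω c = R.pt h ω c' → R.r (X c) ω = R.r (X c') ω) :
    (∀ c ω, R.r (N.auxInf (Set.range X)) ω ≤ R.r (X c) ω) ∧
      ∀ ε > 0, ∃ c, ∀ ω, R.r (X c) ω ≤ R.r (N.auxInf (Set.range X)) ω + ε := by
  obtain ⟨Y, h1, h2⟩ := R.exists_inf h X loc
  have hY : N.auxInf (Set.range X) = Y := by
    refine auxInf_eq h.toIsRV ?_ fun Z hZ => ?_
    · rintro _ ⟨c, rfl⟩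
      exact (R.auxLE_iff h.toIsRV).mpr (h1 c)
    · refine (R.auxLE_iff h.toIsRV).mpr fun ω => le_of_forall_pos_le_add fun ε hε => ?_
      obtain ⟨c, hc⟩ := h2 ε hε
      exact (R.le_of_auxLE (hZ _ ⟨c, rfl⟩) ω).trans (hc ω)
  rw [hY]
  exact ⟨h1, h2⟩

/-- A lattice infimum of uncountably many random variables need not be pointwise; here it is,
because one element attains it up to `ε` at all points simultaneously. -/
theorem r_auxInf (X : N.Main → N.Aux)
    (loc : ∀ ω c c', R.pt h ω c = R.pt h ω c' → R.r (X c) ω = R.r (X c') ω) (ω : R.Ω) :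
    R.r (N.auxInf (Set.range X)) ω = ⨅ c, R.r (X c) ω := by
  obtain ⟨h1, h2⟩ := R.auxInf_spec h X loc
  refine le_antisymm (le_ciInf fun c => h1 c ω) (le_of_forall_pos_le_add fun ε hε => ?_)
  obtain ⟨c, hc⟩ := h2 ε hε
  exact (ciInf_le (bddBelow_range_of_mem fun c => R.mem _ _) c).trans (hc ω)

theorem auxSup_eq_neg (X : N.Main → N.Aux)
    (loc : ∀ ω c c', R.pt h ω c = R.pt h ω c' → R.r (X c) ω = R.r (X c') ω) :
    N.auxSup (Set.range X) = CPL.neg (N.auxInf (Set.range fun c => CPL.neg (X c))) := by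
  obtain ⟨h1, h2⟩ := R.auxInf_spec h (fun c => CPL.neg (X c)) fun ω c c' hc => by
    rw [R.r_neg, R.r_neg, loc ω c c' hc]
  simp only [R.r_neg] at h1 h2
  refine auxSup_eq h.toIsRV ?_ fun Z hZ => ?_
  · rintro _ ⟨c, rfl⟩
    refine (R.auxLE_iff h.toIsRV).mpr fun ω => ?_
    rw [R.r_neg]
    linarith [h1 c ω]
  · refine (R.auxLE_iff h.toIsRV).mpr fun ω => le_of_forall_pos_le_add fun ε hε => ?_
    obtain ⟨c, hc⟩ := h2 ε hε
    have := R.le_of_auxLE (hZ _ ⟨c, rfl⟩) ω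
    rw [R.r_neg]
    linarith [hc ω]

/-! ### Evaluation of formulae in the fibres -/

theorem eval_pt {I : Type v} (a : I → N.Main) {n : ℕ} (b : Fin n → N.Main) (ω : R.Ω)
    (t : Term L (I ⊕ Fin n)) :
    t.eval (R.fib h ω).func (Sum.elim (R.pt h ω ∘ a) (R.pt h ω ∘ b))
      = R.pt h ω (t.eval N.func (Sum.elim a b)) := by
  rw [← Sum.comp_elim, Term.eval_map (R.func_pt h ω)]

omit h in
theorem comp_snoc {A B : Type*} (f : A → B) {n : ℕ} (b : Fin n → A) (c : A) :
    f ∘ (Fin.snoc b c : Fin (n + 1) → A) = (Fin.snoc (f ∘ b) (f c) : Fin (n + 1) → B) := by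
  funext k
  refine Fin.lastCases ?_ (fun i => ?_) k <;> simp

/-- By induction on `φ`. For a quantifier, the values depend on the new element only through its
value at the point; this is the induction hypothesis at all points, hence the generalisation over
`ω`. -/
theorem r_bracket {I : Type v} (a : I → N.Main) {n : ℕ} (φ : BFormula L I n)
    (b : Fin n → N.Main) (ω : R.Ω) :
    R.r (φ.bracket N a b) ω = φ.value (R.fib h ω) (R.pt h ω ∘ a) (R.pt h ω ∘ b) := by
  induction φ generalizing ω with
  | dist s t =>
    simp only [BFormula.bracket, BFormula.value, R.eval_pt h, R.dist_pt h]
  | pred P ts =>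
    simp only [BFormula.bracket, BFormula.value, R.eval_pt h]
    exact (R.pred_pt h ω P _).symm
  | neg φ ih => simp only [BFormula.bracket, BFormula.value, R.r_neg, ih, CPL.neg_real]
  | half φ ih => simp only [BFormula.bracket, BFormula.value, R.r_half, ih, CPL.half_real]
  | tsub φ ψ ih ih' =>
    simp only [BFormula.bracket, BFormula.value, R.r_tsub, ih, ih', CPL.tsub_real]
  | inf φ ih =>
    simp only [BFormula.bracket]
    rw [R.r_auxInf h, BFormula.iInf_value_dense _ (R.denseRange_pt h ω)]
    · exact iInf_congr fun c => by rw [ih, comp_snoc]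
    · intro ω' c c' hc
      rw [ih, ih, comp_snoc, comp_snoc, hc]
  | sup φ ih =>
    have loc : ∀ ω c c', R.pt h ω c = R.pt h ω c' →
        R.r (φ.bracket N a (Fin.snoc b c)) ω = R.r (φ.bracket N a (Fin.snoc b c')) ω := by
      intro ω' c c' hc
      rw [ih, ih, comp_snoc, comp_snoc, hc]
    rw [BFormula.value_sup]
    simp only [BFormula.bracket]
    rw [R.auxSup_eq_neg h _ loc, R.r_neg, R.r_auxInf h _ fun ω c c' hc => by
      rw [R.r_neg, R.r_neg, loc ω c c' hc]]
    change _ = 1 - φ.neg.inf.value _ _ _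
    rw [BFormula.iInf_value_dense _ (R.denseRange_pt h ω)]
    refine congrArg _ (iInf_congr fun c => ?_)
    rw [R.r_neg, ih, comp_snoc]
    rfl

theorem r_bracket_local {I : Type v} (a : I → N.Main) {n : ℕ} (φ : BFormula L I (n + 1))
    (b : Fin n → N.Main) (ω : R.Ω) {c c' : N.Main} (hc : R.pt h ω c = R.pt h ω c') :
    R.r (φ.bracket N a (Fin.snoc b c)) ω = R.r (φ.bracket N a (Fin.snoc b c')) ω := by
  rw [R.r_bracket h, R.r_bracket h, comp_snoc, comp_snoc, hc]

theorem bracket_inf_spec {I : Type v} (a : I → N.Main) {n : ℕ} (φ : BFormula L I (n + 1))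
    (b : Fin n → N.Main) :
    (∀ c ω, R.r (φ.inf.bracket N a b) ω ≤ R.r (φ.bracket N a (Fin.snoc b c)) ω) ∧
      ∀ ε > 0, ∃ c, ∀ ω, R.r (φ.bracket N a (Fin.snoc b c)) ω
        ≤ R.r (φ.inf.bracket N a b) ω + ε :=
  R.auxInf_spec h _ fun ω _ _ hc => R.r_bracket_local h a φ b ω hc

theorem bracket_sup (R : Rep N) {I : Type v} (a : I → N.Main) {n : ℕ} (φ : BFormula L I (n + 1))
    (b : Fin n → N.Main) : φ.sup.bracket N a b = φ.neg.inf.neg.bracket N a b :=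
  R.auxSup_eq_neg h _ fun ω _ _ hc => R.r_bracket_local h a φ b ω hc

theorem r_br {I : Type v} (a : I → N.Main) (φ : Formula L I) (ω : R.Ω) :
    R.r (N.br a φ) ω = (R.fib h ω).tp (R.pt h ω ∘ a) φ := by
  rw [RStr.br, R.r_bracket h, Str.tp]
  congr 1
  exact funext fun k => k.elim0

/-- Since `⟦φ⟧ = 0` is an equation in the auxiliary sort, every fibre, and not just almost every
one, is a model. -/
theorem fib_models {T : Set (Sentence L)} (hT : ∀ φ ∈ T, N.br PEmpty.elim φ = N.zero)
    (ω : R.Ω) : (R.fib h ω).Models T := by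
  intro φ hφ
  have h1 := R.r_br h PEmpty.elim φ ω
  rw [hT φ hφ, R.zero] at h1
  rw [Str.sval, h1]
  congr 1
  exact funext fun i => i.elim

end Rep

end

end ContLogic

namespace ContLogic

open Filter Topology

noncomputable section

/-! ### Definability of the random variables `⟦φ⟧` -/

namespace RBFormula

variable {L : Signature.{u}} {I : Type v}

instance instCPL {m k : ℕ} : CPL (RBFormula L I m k) := ⟨.neg, .half, .tsub⟩

theorem isHom_value (N : RStr L) (a : I → N.Main) {m k : ℕ} (b : Fin m → N.Main)
    (X : Fin k → N.Aux) : CPL.IsHom fun φ : RBFormula L I m k => φ.value N a b X :=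
  ⟨fun _ => rfl, fun _ => rfl, fun _ _ => rfl⟩

theorem value_tadd (N : RStr L) (a : I → N.Main) {m k : ℕ} (b : Fin m → N.Main)
    (X : Fin k → N.Aux) (φ ψ : RBFormula L I m k) :
    (CPL.tadd φ ψ).value N a b X = min (φ.value N a b X + ψ.value N a b X) 1 := by
  rw [(isHom_value N a b X).tadd, CPL.tadd_real]

theorem value_mem (N : RStr L) (a : I → N.Main) {m k : ℕ} (φ : RBFormula L I m k)
    (b : Fin m → N.Main) (X : Fin k → N.Aux) : φ.value N a b X ∈ Set.Icc (0 : ℝ) 1 := by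
  induction φ with
  | distMain s t => exact ⟨dist_nonneg, N.distMain_le_one _ _⟩
  | distAux s t => exact ⟨dist_nonneg, N.distAux_le_one _ _⟩
  | neg φ ih => exact CPL.neg_mem (ih b X)
  | half φ ih => exact CPL.half_mem (ih b X)
  | tsub φ ψ ih ih' => exact CPL.tsub_mem (ih b X) (ih' b X)
  | infMain φ ih => exact iInf_mem_Icc fun c => ih _ _
  | supMain φ ih =>
    simp only [value]
    rw [iSup_eq_one_sub_iInf fun c => ih _ _]
    exact CPL.neg_mem (iInf_mem_Icc fun c => CPL.neg_mem (ih _ _))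
  | infAux φ ih =>
    have : Nonempty N.Aux := ⟨N.zero⟩
    exact iInf_mem_Icc fun c => ih _ _
  | supAux φ ih =>
    have : Nonempty N.Aux := ⟨N.zero⟩
    simp only [value]
    rw [iSup_eq_one_sub_iInf fun c => ih _ _]
    exact CPL.neg_mem (iInf_mem_Icc fun c => CPL.neg_mem (ih _ _))

theorem value_supMain (N : RStr L) (a : I → N.Main) {m k : ℕ} (φ : RBFormula L I (m + 1) k)
    (b : Fin m → N.Main) (X : Fin k → N.Aux) :
    φ.supMain.value N a b X = φ.neg.infMain.neg.value N a b X :=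
  iSup_eq_one_sub_iInf fun _ => φ.value_mem N a _ _

theorem value_supAux (N : RStr L) (a : I → N.Main) {m k : ℕ} (φ : RBFormula L I m (k + 1))
    (b : Fin m → N.Main) (X : Fin k → N.Aux) :
    φ.supAux.value N a b X = φ.neg.infAux.neg.value N a b X := by
  have : Nonempty N.Aux := ⟨N.zero⟩
  exact iSup_eq_one_sub_iInf fun _ => φ.value_mem N a _ _

end RBFormula

namespace BFormula

variable {L : Signature.{u}} {I : Type v}

/-- Given a formula for the distance to `Z_c`, the formula `E(X_i ∸ Z_c)`. -/
def excess {n k : ℕ} (i : Fin k) (D : RBFormula L I (n + 1) (k + 1)) :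
    RBFormula L I (n + 1) k :=
  .infAux (CPL.tadd (.distAux (.tsub (.var i.castSucc) (.var (Fin.last k))) .zero) D)

/-- Given a formula for the distance to `Z_c`, the formula `E(Z_c ∸ X_i)`. -/
def defect {n k : ℕ} (i : Fin k) (D : RBFormula L I (n + 1) (k + 1)) :
    RBFormula L I (n + 1) k :=
  .infAux (CPL.tadd (.distAux (.tsub (.var (Fin.last k)) (.var i.castSucc)) .zero) D)

/-- An `L^R`-formula for the distance of the auxiliary variable `i` to `⟦φ⟧`. -/
def distTo : ∀ {n : ℕ}, BFormula L I n → ∀ k : ℕ, Fin k → RBFormula L I n k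
  | _, dist s t, _, i => .distAux (.var i) (.brDist s t)
  | _, pred P ts, _, i => .distAux (.var i) (.brPred P ts)
  -- The new variable `k` stands for `⟦φ⟧`, and its distance to `⟦φ⟧` is added as a penalty; since
  -- the connective is contractive, the infimum is attained at `⟦φ⟧` itself.
  | _, neg φ, k, i => .infAux (CPL.tadd
      (.distAux (.var i.castSucc) (.neg (.var (Fin.last k)))) (φ.distTo (k + 1) (Fin.last k)))
  | _, half φ, k, i => .infAux (CPL.tadd
      (.distAux (.var i.castSucc) (.half (.var (Fin.last k)))) (φ.distTo (k + 1) (Fin.last k)))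
  | _, tsub φ ψ, k, i => .infAux (CPL.tadd (.infAux (CPL.tadd
      (.distAux (.var i.castSucc.castSucc)
        (.tsub (.var (Fin.last k).castSucc) (.var (Fin.last (k + 1)))))
      (ψ.distTo (k + 2) (Fin.last (k + 1))))) (φ.distTo (k + 1) (Fin.last k)))
  -- With `Z_c` the instances of `⟦φ⟧` and `Y` their infimum, `E(X ∸ Y)` is the supremum of the `E(X
  -- ∸ Z_c)` and `E(Y ∸ X)` the infimum of the `E(Z_c ∸ X)`; together they give `d(X, Y)`.
  | _, inf φ, k, i => CPL.tadd (.supMain (excess i (φ.distTo (k + 1) (Fin.last k))))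
      (.infMain (defect i (φ.distTo (k + 1) (Fin.last k))))
  | _, sup φ, k, i => CPL.tadd (.supMain (defect i (φ.distTo (k + 1) (Fin.last k))))
      (.infMain (excess i (φ.distTo (k + 1) (Fin.last k))))

/-- An `L^R`-formula for `E⟦φ⟧`. -/
def expectation (φ : Formula L I) : RFormula L I :=
  .infAux (CPL.tadd (.distAux (.var (Fin.last 0)) .zero) (φ.distTo 1 (Fin.last 0)))

end BFormula

/-- A function that does not exceed `g W + dist W Z` at `Z` is recovered from the distance to `Z`,
without naming `Z`; the minimum with `1` comes from truncated addition. -/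
theorem iInf_min_add_dist {A : Type*} [PseudoMetricSpace A] (Z : A) (g : A → ℝ)
    (hg : ∀ W, g W ∈ Set.Icc (0 : ℝ) 1) (hZ : ∀ W, g Z ≤ g W + dist W Z) :
    ⨅ W, min (g W + dist W Z) 1 = g Z := by
  have : Nonempty A := ⟨Z⟩
  refine le_antisymm ?_ (le_ciInf fun W => le_min (hZ W) (hg Z).2)
  refine (ciInf_le ⟨0, ?_⟩ Z).trans ?_
  · rintro _ ⟨W, rfl⟩
    exact le_min (add_nonneg (hg W).1 dist_nonneg) zero_le_one
  · simp

theorem Rep.E_le_add {L : Signature.{u}} {N : RStr L} (R : Rep N) {X Y : N.Aux} {ε : ℝ}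
    (h : ∀ ω, R.r X ω ≤ R.r Y ω + ε) : N.E X ≤ N.E Y + ε := by
  rw [R.E_eq, R.E_eq]
  calc ∫ ω, R.r X ω ∂(R.μ) ≤ ∫ ω, (R.r Y ω + ε) ∂(R.μ) :=
        integral_mono (R.integrable _) ((R.integrable _).add (integrable_const _)) h
    _ = ∫ ω, R.r Y ω ∂(R.μ) + ε := by
        rw [integral_add (R.integrable _) (integrable_const _)]
        simp

namespace BFormula

variable {L : Signature.{u}} {I : Type v} {N : RStr L}

theorem value_excess (a : I → N.Main) {n k : ℕ} (b : Fin (n + 1) → N.Main) (X : Fin k → N.Aux)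
    (i : Fin k) (D : RBFormula L I (n + 1) (k + 1)) (Z : N.Aux)
    (hD : ∀ W, D.value N a b (Fin.snoc X W) = Dist.dist W Z) :
    (excess i D).value N a b X = N.E (CPL.tsub (X i) Z) := by
  simp only [excess, RBFormula.value, RBFormula.value_tadd, AuxTerm.eval, hD, Fin.snoc_castSucc,
    Fin.snoc_last]
  refine iInf_min_add_dist Z (fun W => N.E (CPL.tsub (X i) W))
    (fun W => ⟨RStr.IsRV.E_nonneg _, RStr.IsRV.E_le_one _⟩) fun W => ?_
  have h1 := N.tsub_unif_right Z W (X i)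
  rw [dist_comm Z W] at h1
  linarith [dist_triangle (CPL.tsub (X i) Z) (CPL.tsub (X i) W) N.zero,
    show N.E (CPL.tsub (X i) Z) = Dist.dist (CPL.tsub (X i) Z) N.zero from rfl,
    show N.E (CPL.tsub (X i) W) = Dist.dist (CPL.tsub (X i) W) N.zero from rfl]

theorem value_defect (a : I → N.Main) {n k : ℕ} (b : Fin (n + 1) → N.Main) (X : Fin k → N.Aux)
    (i : Fin k) (D : RBFormula L I (n + 1) (k + 1)) (Z : N.Aux)
    (hD : ∀ W, D.value N a b (Fin.snoc X W) = Dist.dist W Z) :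
    (defect i D).value N a b X = N.E (CPL.tsub Z (X i)) := by
  simp only [defect, RBFormula.value, RBFormula.value_tadd, AuxTerm.eval, hD, Fin.snoc_castSucc,
    Fin.snoc_last]
  refine iInf_min_add_dist Z (fun W => N.E (CPL.tsub W (X i)))
    (fun W => ⟨RStr.IsRV.E_nonneg _, RStr.IsRV.E_le_one _⟩) fun W => ?_
  have h1 := N.tsub_unif_left Z W (X i)
  rw [dist_comm Z W] at h1
  linarith [dist_triangle (CPL.tsub Z (X i)) (CPL.tsub W (X i)) N.zero,
    show N.E (CPL.tsub Z (X i)) = Dist.dist (CPL.tsub Z (X i)) N.zero from rfl,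
    show N.E (CPL.tsub W (X i)) = Dist.dist (CPL.tsub W (X i)) N.zero from rfl]

/-- If `Y` is an approximately attained infimum of the `Z_c`, this computes the distance to `Y`. -/
theorem dist_of_attained_inf {A : Type*} [Nonempty A] (h : N.IsRV) (R : Rep N) (Z : A → N.Aux)
    (Y X : N.Aux) (h1 : ∀ c ω, R.r Y ω ≤ R.r (Z c) ω)
    (h2 : ∀ ε > 0, ∃ c, ∀ ω, R.r (Z c) ω ≤ R.r Y ω + ε) :
    min ((⨆ c, N.E (CPL.tsub X (Z c))) + ⨅ c, N.E (CPL.tsub (Z c) X)) 1 = Dist.dist X Y := by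
  have e1 : ⨆ c, N.E (CPL.tsub X (Z c)) = N.E (CPL.tsub X Y) := by
    have hb : BddAbove (Set.range fun c => N.E (CPL.tsub X (Z c))) :=
      ⟨1, by rintro _ ⟨c, rfl⟩; exact RStr.IsRV.E_le_one _⟩
    refine le_antisymm (ciSup_le fun c => ?_) (le_of_forall_pos_le_add fun ε hε => ?_)
    · have := R.E_le_add (X := CPL.tsub X (Z c)) (Y := CPL.tsub X Y) (ε := 0) fun ω => by
        rw [R.r_tsub, R.r_tsub, add_zero]
        exact max_le_max (by linarith [h1 c ω]) le_rfl
      linarith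
    · obtain ⟨c, hc⟩ := h2 ε hε
      refine le_trans ?_ (add_le_add (le_ciSup hb c) le_rfl)
      refine R.E_le_add fun ω => ?_
      rw [R.r_tsub, R.r_tsub]
      have := hc ω
      grind
  have e2 : ⨅ c, N.E (CPL.tsub (Z c) X) = N.E (CPL.tsub Y X) := by
    have hb : BddBelow (Set.range fun c => N.E (CPL.tsub (Z c) X)) :=
      ⟨0, by rintro _ ⟨c, rfl⟩; exact RStr.IsRV.E_nonneg _⟩
    refine le_antisymm (le_of_forall_pos_le_add fun ε hε => ?_) (le_ciInf fun c => ?_)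
    · obtain ⟨c, hc⟩ := h2 ε hε
      refine (ciInf_le hb c).trans ?_
      refine R.E_le_add fun ω => ?_
      rw [R.r_tsub, R.r_tsub]
      have := hc ω
      grind
    · have := R.E_le_add (X := CPL.tsub Y X) (Y := CPL.tsub (Z c) X) (ε := 0) fun ω => by
        rw [R.r_tsub, R.r_tsub, add_zero]
        exact max_le_max (by linarith [h1 c ω]) le_rfl
      linarith
  rw [e1, e2, ← h.rv3]
  exact min_eq_left (N.distAux_le_one _ _)

theorem value_distTo (h : N.IsT0R) (a : I → N.Main) {n : ℕ} (φ : BFormula L I n) :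
    ∀ (k : ℕ) (i : Fin k) (b : Fin n → N.Main) (X : Fin k → N.Aux),
      (φ.distTo k i).value N a b X = Dist.dist (X i) (φ.bracket N a b) := by
  obtain ⟨R⟩ := h.toIsRV.nonempty_rep
  have bd : ∀ (X : N.Aux) (f : N.Aux → N.Aux) (W : N.Aux),
      Dist.dist X (f W) ∈ Set.Icc (0 : ℝ) 1 := fun X f W => ⟨dist_nonneg, N.distAux_le_one _ _⟩
  have lip : ∀ (X : N.Aux) (f : N.Aux → N.Aux) (Z : N.Aux),
      (∀ W, Dist.dist (f W) (f Z) ≤ Dist.dist W Z) →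
      ∀ W, Dist.dist X (f Z) ≤ Dist.dist X (f W) + Dist.dist W Z := fun X f Z hf W =>
    (dist_triangle _ (f W) _).trans (add_le_add le_rfl (hf W))
  induction φ with
  | dist s t => intro k i b X; rfl
  | pred P ts => intro k i b X; rfl
  | neg φ ih =>
    intro k i b X
    simp only [distTo, RBFormula.value, RBFormula.value_tadd, AuxTerm.eval, ih,
      Fin.snoc_castSucc, Fin.snoc_last]
    exact iInf_min_add_dist _ (fun W => Dist.dist (X i) (CPL.neg W)) (bd _ _)
      (lip _ _ _ fun W => N.neg_unif _ _)
  | half φ ih =>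
    intro k i b X
    simp only [distTo, RBFormula.value, RBFormula.value_tadd, AuxTerm.eval, ih,
      Fin.snoc_castSucc, Fin.snoc_last]
    exact iInf_min_add_dist _ (fun W => Dist.dist (X i) (CPL.half W)) (bd _ _)
      (lip _ _ _ fun W => N.half_unif _ _)
  | tsub φ ψ ih ih' =>
    intro k i b X
    simp only [distTo, RBFormula.value, RBFormula.value_tadd, AuxTerm.eval, ih, ih',
      Fin.snoc_castSucc, Fin.snoc_last]
    have e : ∀ W, ⨅ W', min (Dist.dist (X i) (CPL.tsub W W') +
        Dist.dist W' (ψ.bracket N a b)) 1 = Dist.dist (X i) (CPL.tsub W (ψ.bracket N a b)) :=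
      fun W => iInf_min_add_dist _ (fun W' => Dist.dist (X i) (CPL.tsub W W')) (bd _ _)
        (lip _ _ _ fun W' => N.tsub_unif_right _ _ _)
    simp only [e]
    exact iInf_min_add_dist _ (fun W => Dist.dist (X i) (CPL.tsub W _)) (bd _ fun W => _)
      (lip _ (fun W => CPL.tsub W _) _ fun W => N.tsub_unif_left _ _ _)
  | inf φ ih =>
    intro k i b X
    have hD : ∀ c W, (φ.distTo (k + 1) (Fin.last k)).value N a (Fin.snoc b c) (Fin.snoc X W)
        = Dist.dist W (φ.bracket N a (Fin.snoc b c)) := fun c W => by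
      rw [ih, Fin.snoc_last]
    obtain ⟨h1, h2⟩ := R.bracket_inf_spec h a φ b
    simp only [distTo, RBFormula.value, RBFormula.value_tadd, value_excess a _ X i _ _ (hD _),
      value_defect a _ X i _ _ (hD _)]
    exact dist_of_attained_inf h.toIsRV R _ _ _ h1 h2
  | sup φ ih =>
    intro k i b X
    have hD : ∀ c W, (φ.distTo (k + 1) (Fin.last k)).value N a (Fin.snoc b c) (Fin.snoc X W)
        = Dist.dist W (φ.bracket N a (Fin.snoc b c)) := fun c W => by
      rw [ih, Fin.snoc_last]
    obtain ⟨h1, h2⟩ := R.bracket_inf_spec h a φ.neg b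
    -- The supremum reduces to the infimum of the negations, as negation exchanges the two truncated
    -- differences.
    have hneg : ∀ Y Z : N.Aux, CPL.tsub (CPL.neg Y) (CPL.neg Z) = CPL.tsub Z Y := fun Y Z => by
      refine R.ext h.toIsRV fun ω => ?_
      rw [R.r_tsub, R.r_tsub, R.r_neg, R.r_neg, sub_sub_sub_cancel_left]
    have key := dist_of_attained_inf h.toIsRV R _ _ (CPL.neg (X i)) h1 h2
    simp only [distTo, RBFormula.value, RBFormula.value_tadd, value_excess a _ X i _ _ (hD _),
      value_defect a _ X i _ _ (hD _)]
    simp only [bracket, hneg] at key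
    rw [key, R.bracket_sup h]
    simp only [bracket]
    rw [h.rv3, h.rv3, ← hneg (X i), ← hneg _ (X i)]
    have hnn : ∀ Y : N.Aux, CPL.neg (CPL.neg Y) = Y := fun Y => by
      refine R.ext h.toIsRV fun ω => ?_
      rw [R.r_neg, R.r_neg, sub_sub_cancel]
    rw [hnn, add_comm]

/-- The lattice bounds defining `⟦φ⟧` are not formulae of `L^R`, yet `E⟦φ⟧` is the value of one.
Hence it depends only on the `L^R`-type, and continuously so. -/
theorem value_expectation (h : N.IsT0R) (a : I → N.Main) (φ : Formula L I) :
    N.tp a φ.expectation = N.E (N.br a φ) := by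
  simp only [RStr.tp, expectation, RBFormula.value, RBFormula.value_tadd, AuxTerm.eval,
    value_distTo h, Fin.snoc_last]
  refine iInf_min_add_dist _ N.E
    (fun W => ⟨RStr.IsRV.E_nonneg _, RStr.IsRV.E_le_one _⟩) fun W => ?_
  rw [add_comm, dist_comm]
  exact dist_triangle _ _ _

end BFormula

end

end ContLogic

namespace ContLogic

open Filter Topology

noncomputable section

/-! ### Splitting events in atomless spaces -/

/-- Every event can approximately be halved. -/
def Halving {Ω : Type*} [MeasurableSpace Ω] (μ : Measure Ω) : Prop :=
  ∀ B : Set Ω, MeasurableSet B → ∀ η > 0, ∃ H ⊆ B, MeasurableSet H ∧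
    |μ.real H - μ.real B / 2| ≤ η

/-- The `Y` given by `ARV` is only nearly an event. Replacing it by `{Y > 1/2}` costs at most `E(Y ∧
¬Y)`, since pointwise the error is `min Y (1 - Y)`. -/
theorem Rep.halving {L : Signature.{u}} {N : RStr L} (R : Rep N) (h : N.IsARV) :
    Halving R.μ := by
  intro B hB η hη
  obtain ⟨X, hX⟩ := R.surj (B.indicator 1) (measurable_one.indicator hB) fun ω => by
    by_cases hω : ω ∈ B <;> simp [hω]
  have hη' : (⨅ Y : N.Aux, max (N.E (CPL.inf Y (CPL.neg Y)))
      |N.E (CPL.inf Y X) - N.E X / 2|) < η / 2 := by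
    rw [h.arv X]
    positivity
  have : Nonempty N.Aux := ⟨N.zero⟩
  obtain ⟨Y, hY⟩ := exists_lt_of_ciInf_lt hη'
  rw [max_lt_iff] at hY
  have hH : MeasurableSet (B ∩ {ω | 1 / 2 < R.r Y ω}) :=
    hB.inter (measurableSet_lt measurable_const (R.measurable Y))
  refine ⟨B ∩ {ω | 1 / 2 < R.r Y ω}, Set.inter_subset_left, hH, ?_⟩
  have e1 : N.E X = R.μ.real B := by
    rw [R.E_eq, integral_congr_ae hX, integral_indicator_one hB]
  have e2 : |R.μ.real (B ∩ {ω | 1 / 2 < R.r Y ω}) - N.E (CPL.inf Y X)|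
      ≤ N.E (CPL.inf Y (CPL.neg Y)) := by
    have hHi : Integrable ((B ∩ {ω | 1 / 2 < R.r Y ω}).indicator (1 : R.Ω → ℝ)) R.μ :=
      (integrable_const (1 : ℝ)).indicator hH
    rw [R.E_eq, R.E_eq, ← integral_indicator_one hH, ← integral_sub hHi (R.integrable _)]
    refine (abs_integral_le_integral_abs).trans (integral_mono_ae
      (hHi.sub (R.integrable _)).abs (R.integrable _) ?_)
    filter_upwards [hX] with ω hω
    have h0 := R.mem Y ω
    simp only [Set.mem_Icc] at h0
    simp only [R.r_inf, R.r_neg, hω]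
    by_cases hωB : ω ∈ B
    · by_cases hωY : 1 / 2 < R.r Y ω
      · rw [Set.indicator_of_mem (show ω ∈ B ∩ {ω | 1 / 2 < R.r Y ω} from ⟨hωB, hωY⟩),
          Set.indicator_of_mem hωB]
        simp only [Pi.one_apply]
        grind
      · rw [Set.indicator_of_notMem (fun hh => hωY hh.2), Set.indicator_of_mem hωB]
        simp only [Pi.one_apply]
        grind
    · rw [Set.indicator_of_notMem (fun hh => hωB hh.1), Set.indicator_of_notMem hωB]
      grind
  rw [← e1]
  calc |R.μ.real (B ∩ {ω | 1 / 2 < R.r Y ω}) - N.E X / 2|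
      ≤ |R.μ.real (B ∩ {ω | 1 / 2 < R.r Y ω}) - N.E (CPL.inf Y X)| +
        |N.E (CPL.inf Y X) - N.E X / 2| := abs_sub_le _ _ _
    _ ≤ η := by linarith [hY.1, hY.2]

namespace Halving

variable {Ω : Type*} [MeasurableSpace Ω] {μ : Measure Ω} [IsFiniteMeasure μ]

/-- Halving with error at most a quarter leaves two parts of at most `3/4` of the measure. If the
part `H` fits into `r`, it is kept and the search continues in the rest; otherwise the search
continues in `H`. The missing measure decays like `(3/4) ^ n`. -/
theorem exists_subset (h : Halving μ) {η : ℝ} (hη : 0 < η) {B : Set Ω} (hB : MeasurableSet B)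
    {r : ℝ} (hr : 0 ≤ r) (hrB : r ≤ μ.real B) :
    ∃ C ⊆ B, MeasurableSet C ∧ μ.real C ≤ r ∧ r - η ≤ μ.real C := by
  have key : ∀ (n : ℕ) (B : Set Ω), MeasurableSet B → ∀ r : ℝ, 0 ≤ r → r ≤ μ.real B →
      ∃ C ⊆ B, MeasurableSet C ∧ μ.real C ≤ r ∧ r - μ.real C ≤ (3 / 4) ^ n * μ.real B := by
    intro n
    induction n with
    | zero =>
      intro B hB r hr hrB
      exact ⟨∅, Set.empty_subset _, MeasurableSet.empty, by simpa using hr, by simpa using hrB⟩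
    | succ n ih =>
      intro B hB r hr hrB
      rcases (measureReal_nonneg (μ := μ) (s := B)).eq_or_lt with h0 | hpos
      · refine ⟨∅, Set.empty_subset _, MeasurableSet.empty, by simpa using hr, ?_⟩
        rw [← h0]
        simp
        linarith
      obtain ⟨H, hHB, hH, hd⟩ := h B hB (μ.real B / 4) (by positivity)
      rw [abs_le] at hd
      have hdiff : μ.real (B \ H) = μ.real B - μ.real H := measureReal_sdiff hHB hH
      have hp : (0 : ℝ) ≤ (3 / 4) ^ n := by positivity
      rcases le_or_gt (μ.real H) r with hle | hlt
      · obtain ⟨C, hC, hCm, h1, h2⟩ := ih (B \ H) (hB.diff hH) (r - μ.real H) (by linarith)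
          (by linarith)
        have hu : μ.real (H ∪ C) = μ.real H + μ.real C :=
          measureReal_union (Set.disjoint_of_subset_right hC Set.disjoint_sdiff_right) hCm
        refine ⟨H ∪ C, Set.union_subset hHB (hC.trans Set.sdiff_subset), hH.union hCm,
          by linarith, ?_⟩
        rw [hu, pow_succ]
        nlinarith
      · obtain ⟨C, hC, hCm, h1, h2⟩ := ih H hH r hr hlt.le
        refine ⟨C, hC.trans hHB, hCm, h1, ?_⟩
        rw [pow_succ]
        nlinarith
  obtain ⟨n, hn⟩ := exists_pow_lt_of_lt_one (show 0 < η / (μ.real B + 1) by positivity)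
    (show (3 / 4 : ℝ) < 1 by norm_num)
  obtain ⟨C, hC, hCm, h1, h2⟩ := key n B hB r hr hrB
  refine ⟨C, hC, hCm, h1, ?_⟩
  rw [lt_div_iff₀ (by positivity)] at hn
  have : (0 : ℝ) ≤ (3 / 4) ^ n := by positivity
  nlinarith

theorem exists_split (h : Halving μ) {J : Type*} {η : ℝ} (hη : 0 < η) {r : J → ℝ}
    (hr : ∀ j, 0 ≤ r j) (F : Finset J) {B : Set Ω} (hB : MeasurableSet B)
    (hrB : ∑ j ∈ F, r j ≤ μ.real B) :
    ∃ C : J → Set Ω, (∀ j, C j ⊆ B) ∧ (∀ j, MeasurableSet (C j)) ∧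
      (∀ i j, i ≠ j → Disjoint (C i) (C j)) ∧
      ∀ j ∈ F, μ.real (C j) ≤ r j ∧ r j - η ≤ μ.real (C j) := by
  classical
  induction F using Finset.induction_on generalizing B with
  | empty =>
    exact ⟨fun _ => ∅, fun _ => Set.empty_subset _, fun _ => MeasurableSet.empty,
      fun _ _ _ => Set.disjoint_empty _, by simp⟩
  | insert j F hj ih =>
    rw [Finset.sum_insert hj] at hrB
    obtain ⟨D, hD, hDm, h1, h2⟩ := h.exists_subset hη hB (hr j)
      (by linarith [Finset.sum_nonneg fun i (_ : i ∈ F) => hr i])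
    have hdiff : μ.real (B \ D) = μ.real B - μ.real D := measureReal_sdiff hD hDm
    obtain ⟨C, hC, hCm, hCd, hCr⟩ := ih (hB.diff hDm) (by linarith)
    have hdis : ∀ i, Disjoint D (C i) := fun i =>
      Set.disjoint_of_subset_right (hC i) Set.disjoint_sdiff_right
    refine ⟨Function.update C j D, fun i => ?_, fun i => ?_, fun i i' hii' => ?_,
      fun i hi => ?_⟩
    · by_cases hij : i = j
      · subst hij
        simpa using hD
      · simpa [hij] using (hC i).trans Set.sdiff_subset
    · by_cases hij : i = j
      · subst hij
        simpa using hDm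
      · simpa [hij] using hCm i
    · by_cases hij : i = j
      · subst hij
        rw [Function.update_self, Function.update_of_ne hii'.symm]
        exact hdis _
      · rw [Function.update_of_ne hij]
        by_cases hij' : i' = j
        · subst hij'
          rw [Function.update_self]
          exact (hdis _).symm
        · rw [Function.update_of_ne hij']
          exact hCd _ _ hii'
    · by_cases hij : i = j
      · subst hij
        simpa using ⟨h1, by linarith⟩
      · rw [Function.update_of_ne hij]
        exact hCr i ((Finset.mem_insert.mp hi).resolve_left hij)

end Halving

/-- Events realising a random choice with prescribed densities, on each cell of a partition. -/
theorem Halving.exists_choice {Ω : Type*} [MeasurableSpace Ω] {μ : Measure Ω}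
    [IsFiniteMeasure μ] (h : Halving μ) {J D : Type*} [Fintype J] [Fintype D]
    [MeasurableSpace D] [MeasurableSingletonClass D] {u : J → Ω → ℝ} (hu : ∀ j, Measurable (u j))
    (hu0 : ∀ j ω, 0 ≤ u j ω) (hu1 : ∀ ω, ∑ j, u j ω ≤ 1) {κ : Ω → D} (hκ : Measurable κ)
    {η : ℝ} (hη : 0 < η) :
    ∃ G : J → Set Ω, (∀ j, MeasurableSet (G j)) ∧ (∀ i j, i ≠ j → Disjoint (G i) (G j)) ∧
      ∀ j d, μ.real (G j ∩ κ ⁻¹' {d}) ≤ ∫ ω in κ ⁻¹' {d}, u j ω ∂μ ∧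
        ∫ ω in κ ⁻¹' {d}, u j ω ∂μ - η ≤ μ.real (G j ∩ κ ⁻¹' {d}) := by
  have hm : ∀ d, MeasurableSet (κ ⁻¹' {d}) := fun d => hκ (measurableSet_singleton d)
  have hui : ∀ j, Integrable (u j) μ := fun j => integrable_of_mem_Icc (hu j) fun ω =>
    ⟨hu0 j ω, (Finset.single_le_sum (fun i _ => hu0 i ω) (Finset.mem_univ j)).trans (hu1 ω)⟩
  have hex : ∀ d, ∃ C : J → Set Ω, (∀ j, C j ⊆ κ ⁻¹' {d}) ∧ (∀ j, MeasurableSet (C j)) ∧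
      (∀ i j, i ≠ j → Disjoint (C i) (C j)) ∧
      ∀ j ∈ Finset.univ, μ.real (C j) ≤ ∫ ω in κ ⁻¹' {d}, u j ω ∂μ ∧
        ∫ ω in κ ⁻¹' {d}, u j ω ∂μ - η ≤ μ.real (C j) := by
    intro d
    refine h.exists_split hη (fun j => integral_nonneg fun ω => hu0 j ω) _ (hm d) ?_
    rw [← integral_finsetSum _ fun j _ => (hui j).integrableOn]
    calc ∫ ω in κ ⁻¹' {d}, ∑ j, u j ω ∂μ ≤ ∫ ω in κ ⁻¹' {d}, (1 : ℝ) ∂μ :=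
          integral_mono (integrable_finsetSum _ fun j _ => (hui j).integrableOn)
            (integrable_const _) fun ω => hu1 ω
      _ = μ.real (κ ⁻¹' {d}) := by simp
  choose C hC hCm hCd hCr using hex
  have hint : ∀ j d, (⋃ d, C d j) ∩ κ ⁻¹' {d} = C d j := by
    intro j d
    ext ω
    constructor
    · rintro ⟨hω, hd⟩
      obtain ⟨d', hd'⟩ := Set.mem_iUnion.mp hω
      have h1 : κ ω = d' := hC d' j hd'
      have h2 : κ ω = d := hd
      rw [← h2, h1]
      exact hd'
    · exact fun hω => ⟨Set.mem_iUnion.mpr ⟨d, hω⟩, hC d j hω⟩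
  refine ⟨fun j => ⋃ d, C d j, fun j => MeasurableSet.iUnion fun d => hCm d j,
    fun i j hij => ?_, fun j d => ?_⟩
  · refine Set.disjoint_left.mpr fun ω hi hj => ?_
    obtain ⟨d, hd⟩ := Set.mem_iUnion.mp hi
    obtain ⟨d', hd'⟩ := Set.mem_iUnion.mp hj
    have h1 : κ ω = d := hC d i hd
    have h2 : κ ω = d' := hC d' j hd'
    obtain rfl : d = d' := h1.symm.trans h2
    exact Set.disjoint_left.mp (hCd d i j hij) hd hd'
  · rw [hint]
    exact hCr d j (Finset.mem_univ j)

/-! ### Transferring random choices -/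

/-- A continuous cut-off function: `1` below `ρ`, and `0` above `2ρ`. -/
def cutoff (ρ t : ℝ) : ℝ := min (max (2 - t / ρ) 0) 1

theorem continuous_cutoff (ρ : ℝ) : Continuous (cutoff ρ) := by
  unfold cutoff
  fun_prop

theorem cutoff_mem (ρ t : ℝ) : cutoff ρ t ∈ Set.Icc (0 : ℝ) 1 :=
  ⟨le_min (le_max_right _ _) zero_le_one, min_le_right _ _⟩

theorem cutoff_eq_one {ρ t : ℝ} (hρ : 0 < ρ) (ht : t ≤ ρ) : cutoff ρ t = 1 := by
  have : t / ρ ≤ 1 := (div_le_one hρ).mpr ht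
  unfold cutoff
  grind

theorem cutoff_eq_zero {ρ t : ℝ} (hρ : 0 < ρ) (ht : 2 * ρ ≤ t) : cutoff ρ t = 0 := by
  have : 2 ≤ t / ρ := (le_div_iff₀ hρ).mpr ht
  unfold cutoff
  grind

section Pieces

variable {J : Type*} [Fintype J] [DecidableEq J]

/-- A partition of unity: the piece `A` lives where exactly the coordinates in `A` are small. -/
def piece (ρ : ℝ) (A : Finset J) (z : J → ℝ) : ℝ :=
  (∏ j ∈ A, cutoff ρ (z j)) * ∏ j ∈ Finset.univ \ A, (1 - cutoff ρ (z j))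

theorem piece_mem (ρ : ℝ) (A : Finset J) (z : J → ℝ) : piece ρ A z ∈ Set.Icc (0 : ℝ) 1 := by
  have h1 : ∀ j, 0 ≤ 1 - cutoff ρ (z j) := fun j => sub_nonneg.mpr (cutoff_mem ρ _).2
  have h2 : ∀ j, 1 - cutoff ρ (z j) ≤ 1 := fun j => sub_le_self _ (cutoff_mem ρ _).1
  refine ⟨mul_nonneg (Finset.prod_nonneg fun j _ => (cutoff_mem ρ _).1)
    (Finset.prod_nonneg fun j _ => h1 j), mul_le_one₀ ?_ (Finset.prod_nonneg fun j _ => h1 j) ?_⟩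
  · exact Finset.prod_le_one (fun j _ => (cutoff_mem ρ _).1) fun j _ => (cutoff_mem ρ _).2
  · exact Finset.prod_le_one (fun j _ => h1 j) fun j _ => h2 j

theorem sum_piece (ρ : ℝ) (z : J → ℝ) : ∑ A : Finset J, piece ρ A z = 1 := by
  have := Finset.prod_add (fun j => cutoff ρ (z j)) (fun j => 1 - cutoff ρ (z j)) Finset.univ
  simp only [add_sub_cancel, Finset.prod_const_one, Finset.powerset_univ] at this
  exact this.symm

theorem continuous_piece (ρ : ℝ) (A : Finset J) : Continuous (piece ρ A : (J → ℝ) → ℝ) := by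
  have h : ∀ j, Continuous fun z : J → ℝ => cutoff ρ (z j) := fun j =>
    (continuous_cutoff ρ).comp (continuous_apply j)
  exact (continuous_finsetProd _ fun j _ => h j).mul
    (continuous_finsetProd _ fun j _ => continuous_const.sub (h j))

theorem piece_eq_zero_of_notMem {ρ : ℝ} (hρ : 0 < ρ) {A : Finset J} {z : J → ℝ} {j : J}
    (hj : j ∉ A) (hz : z j ≤ ρ) : piece ρ A z = 0 := by
  unfold piece
  have : ∏ j ∈ Finset.univ \ A, (1 - cutoff ρ (z j)) = 0 :=
    Finset.prod_eq_zero (i := j) (by simp [hj]) (by rw [cutoff_eq_one hρ hz, sub_self])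
  rw [this, mul_zero]

theorem piece_eq_zero_of_mem {ρ : ℝ} (hρ : 0 < ρ) {A : Finset J} {z : J → ℝ} {j : J}
    (hj : j ∈ A) (hz : 2 * ρ ≤ z j) : piece ρ A z = 0 := by
  unfold piece
  rw [Finset.prod_eq_zero hj (cutoff_eq_zero hρ hz), zero_mul]

/-- If two random vectors have similar laws, then a random choice of small coordinates of the
first one can be imitated for the second one. -/
theorem exists_similar_choice [Nonempty J] {Ω Ω' : Type*} [MeasurableSpace Ω] [MeasurableSpace Ω']
    {μ : Measure Ω} {μ' : Measure Ω'} [IsProbabilityMeasure μ] [IsProbabilityMeasure μ']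
    (h : Halving μ') {ρ : ℝ} (hρ : 0 < ρ) {z : Ω → J → ℝ} {z' : Ω' → J → ℝ}
    (hz : Measurable z) (hz' : Measurable z') [MeasurableSpace J] [MeasurableSingletonClass J]
    {s : Ω → J} (hs : Measurable s) (hsz : ∀ ω, z ω (s ω) ≤ ρ) {δ : ℝ} (hδ : 0 < δ)
    (hzz : ∀ A, |∫ ω, piece ρ A (z ω) ∂μ - ∫ ω, piece ρ A (z' ω) ∂μ'| ≤ δ) :
    ∃ (s' : Ω' → J) (G : J → Set Ω'), Measurable s' ∧ (∀ j, MeasurableSet (G j)) ∧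
      (∀ j, ∀ ω ∈ G j, s' ω = j ∧ z' ω j < 2 * ρ) ∧
      ∀ j, |μ'.real (G j) - μ.real (s ⁻¹' {j})| ≤ 2 * Fintype.card (Finset J) * δ := by
  have hsm : ∀ j, MeasurableSet (s ⁻¹' {j}) := fun j => hs (measurableSet_singleton j)
  have hfm : ∀ A, Measurable fun ω => piece ρ A (z ω) := fun A =>
    (continuous_piece ρ A).measurable.comp hz
  have hfm' : ∀ A, Measurable fun ω => piece ρ A (z' ω) := fun A =>
    (continuous_piece ρ A).measurable.comp hz'
  have hfi : ∀ A, Integrable (fun ω => piece ρ A (z ω)) μ := fun A =>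
    integrable_of_mem_Icc (hfm A) fun ω => piece_mem ρ A _
  have hfi' : ∀ A, Integrable (fun ω => piece ρ A (z' ω)) μ' := fun A =>
    integrable_of_mem_Icc (hfm' A) fun ω => piece_mem ρ A _
  let m : Finset J → ℝ := fun A => ∫ ω, piece ρ A (z ω) ∂μ
  -- The joint distribution of the piece `A` and of the choice `j`. It vanishes unless `j ∈ A`,
  -- because the chosen coordinate is always small.
  let e : Finset J → J → ℝ := fun A j => ∫ ω in s ⁻¹' {j}, piece ρ A (z ω) ∂μ
  have he0 : ∀ A j, 0 ≤ e A j := fun A j => integral_nonneg fun ω => (piece_mem ρ A _).1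
  have hem : ∀ A, ∑ j, e A j = m A := by
    intro A
    have hU : ⋃ j, s ⁻¹' {j} = Set.univ := by
      ext ω
      simp
    have := integral_iUnion_fintype (μ := μ) (f := fun ω => piece ρ A (z ω)) hsm (fun i j hij =>
      Set.disjoint_left.mpr fun ω hi hj => hij (hi.symm.trans hj))
      fun j => (hfi A).integrableOn
    rw [hU, setIntegral_univ] at this
    exact this.symm
  have hme : ∀ A j, e A j ≤ m A := fun A j => by
    rw [← hem]
    exact Finset.single_le_sum (fun i _ => he0 A i) (Finset.mem_univ j)
  have heA : ∀ A j, j ∉ A → e A j = 0 := fun A j hj => by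
    refine setIntegral_eq_zero_of_forall_eq_zero fun ω hω => ?_
    refine piece_eq_zero_of_notMem hρ hj ?_
    have : s ω = j := hω
    rw [← this]
    exact hsz ω
  have hep : ∀ j, ∑ A, e A j = μ.real (s ⁻¹' {j}) := by
    intro j
    simp only [e]
    rw [← integral_finsetSum _ fun A _ => (hfi A).integrableOn]
    simp [sum_piece]
  -- The conditional probability of the choice `j` given the piece `A`; when `m A = 0` the quotient
  -- is `0` by convention, which is correct since then `e A j = 0`.
  let w : Finset J → J → ℝ := fun A j => e A j / m A
  have hm0 : ∀ A, 0 ≤ m A := fun A => integral_nonneg fun ω => (piece_mem ρ A _).1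
  have hw0 : ∀ A j, 0 ≤ w A j := fun A j => div_nonneg (he0 A j) (hm0 A)
  have hw1 : ∀ A, ∑ j, w A j ≤ 1 := fun A => by
    simp only [w]
    rw [← Finset.sum_div, hem]
    exact div_self_le_one _
  have hwm : ∀ A j, w A j * m A = e A j := fun A j => by
    rcases eq_or_ne (m A) 0 with h0 | h0
    · have := hme A j
      rw [h0] at this ⊢
      rw [mul_zero]
      exact (le_antisymm this (he0 A j)).symm
    · exact div_mul_cancel₀ _ h0
  -- The same conditional probabilities applied to the pieces of the second vector: the density with
  -- which `j` should be chosen. It vanishes where coordinate `j` is at least `2 * ρ`.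
  let u : J → Ω' → ℝ := fun j ω => ∑ A, w A j * piece ρ A (z' ω)
  have hum : ∀ j, Measurable (u j) := fun j =>
    Finset.measurable_sum _ fun A _ => (hfm' A).const_mul _
  have hu0 : ∀ j ω, 0 ≤ u j ω := fun j ω =>
    Finset.sum_nonneg fun A _ => mul_nonneg (hw0 A j) (piece_mem ρ A _).1
  have hu1 : ∀ ω, ∑ j, u j ω ≤ 1 := fun ω => by
    simp only [u]
    rw [Finset.sum_comm, ← sum_piece ρ (z' ω)]
    refine Finset.sum_le_sum fun A _ => ?_
    rw [← Finset.sum_mul]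
    exact mul_le_of_le_one_left (piece_mem ρ A _).1 (hw1 A)
  have hui : ∀ j, Integrable (u j) μ' := fun j =>
    integrable_finsetSum _ fun A _ => (hfi' A).const_mul _
  have huz : ∀ j ω, 2 * ρ ≤ z' ω j → u j ω = 0 := by
    intro j ω hω
    refine Finset.sum_eq_zero fun A _ => ?_
    by_cases hj : j ∈ A
    · rw [piece_eq_zero_of_mem hρ hj hω, mul_zero]
    · simp only [w]
      rw [heA A j hj, zero_div, zero_mul]
  have hup : ∀ j, |∫ ω, u j ω ∂μ' - μ.real (s ⁻¹' {j})| ≤ Fintype.card (Finset J) * δ := by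
    intro j
    have : ∫ ω, u j ω ∂μ' - μ.real (s ⁻¹' {j})
        = ∑ A, w A j * (∫ ω, piece ρ A (z' ω) ∂μ' - m A) := by
      simp only [u, mul_sub, hwm, Finset.sum_sub_distrib, hep]
      rw [integral_finsetSum _ fun A _ => (hfi' A).const_mul _]
      simp only [integral_const_mul]
    rw [this]
    refine (Finset.abs_sum_le_sum_abs _ _).trans ?_
    rw [← nsmul_eq_mul, ← Finset.card_univ]
    refine Finset.sum_le_card_nsmul _ _ _ fun A _ => ?_
    rw [abs_mul, abs_of_nonneg (hw0 A j), abs_sub_comm]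
    have hwle : w A j ≤ 1 :=
      (Finset.single_le_sum (fun i _ => hw0 A i) (Finset.mem_univ j)).trans (hw1 A)
    exact (mul_le_of_le_one_left (abs_nonneg _) hwle).trans (hzz A)
  -- The cells record which coordinates are below `2 * ρ`, so that on each cell every `j` is either
  -- admissible throughout or has density zero.
  let κ : Ω' → Finset J := fun ω => Finset.univ.filter fun j => z' ω j < 2 * ρ
  let _ : MeasurableSpace (Finset J) := ⊤
  have hzj : ∀ j, Measurable fun ω => z' ω j := fun j => (measurable_pi_apply j).comp hz'
  have hκ : Measurable κ := by
    refine measurable_to_countable' fun D => ?_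
    have : κ ⁻¹' {D} = ⋂ j, {ω | z' ω j < 2 * ρ ↔ j ∈ D} := by
      ext ω
      simp [κ, Finset.ext_iff]
    rw [this]
    refine MeasurableSet.iInter fun j => ?_
    by_cases hj : j ∈ D
    · simpa [hj] using measurableSet_lt (hzj j) measurable_const
    · simpa [hj] using measurableSet_le measurable_const (hzj j)
  obtain ⟨G, hG, hGd, hGu⟩ := h.exists_choice hum hu0 hu1 hκ hδ
  -- Removing the points where coordinate `j` is too large loses no measure: they lie in cells where
  -- the density of `j` is zero.
  let G' : J → Set Ω' := fun j => G j ∩ {ω | z' ω j < 2 * ρ}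
  have hG'm : ∀ j, MeasurableSet (G' j) := fun j =>
    (hG j).inter (measurableSet_lt (hzj j) measurable_const)
  have hG'κ : ∀ j D, μ'.real (G' j ∩ κ ⁻¹' {D}) = μ'.real (G j ∩ κ ⁻¹' {D}) := by
    intro j D
    by_cases hj : j ∈ D
    · congr 1
      ext ω
      constructor
      · exact fun hω => ⟨hω.1.1, hω.2⟩
      · refine fun hω => ⟨⟨hω.1, ?_⟩, hω.2⟩
        have : κ ω = D := hω.2
        rw [← this] at hj
        simpa [κ] using hj
    · have h0 : ∫ ω in κ ⁻¹' {D}, u j ω ∂μ' = 0 := by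
        refine setIntegral_eq_zero_of_forall_eq_zero fun ω hω => huz j ω ?_
        have : κ ω = D := hω
        rw [← this] at hj
        simpa [κ] using hj
      have h1 := (hGu j D).1
      rw [h0] at h1
      have h2 : μ'.real (G j ∩ κ ⁻¹' {D}) = 0 := le_antisymm h1 measureReal_nonneg
      rw [h2]
      exact le_antisymm (h2 ▸ measureReal_mono (Set.inter_subset_inter_left _
        Set.inter_subset_left)) measureReal_nonneg
  have hUκ : ⋃ D, κ ⁻¹' {D} = Set.univ := by
    ext ω
    simp
  have hκm : ∀ D, MeasurableSet (κ ⁻¹' {D}) := fun D => hκ (measurableSet_singleton D)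
  have hκd : Pairwise (Function.onFun Disjoint fun D => κ ⁻¹' {D}) := fun i j hij =>
    Set.disjoint_left.mpr fun ω hi hj => hij (hi.symm.trans hj)
  have hsumG : ∀ j, ∑ D, μ'.real (G' j ∩ κ ⁻¹' {D}) = μ'.real (G' j) := by
    intro j
    rw [← measureReal_iUnion_fintype (fun D D' hDD' => (hκd hDD').mono Set.inter_subset_right
      Set.inter_subset_right) fun D => (hG'm j).inter (hκm D), ← Set.inter_iUnion, hUκ,
      Set.inter_univ]
  have hsumu : ∀ j, ∑ D, ∫ ω in κ ⁻¹' {D}, u j ω ∂μ' = ∫ ω, u j ω ∂μ' := by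
    intro j
    rw [← integral_iUnion_fintype hκm hκd fun D => (hui j).integrableOn, hUκ, setIntegral_univ]
  classical
  -- Outside the events the choice is arbitrary; the measure comparison shows that little is left
  -- over.
  let s' : Ω' → J := fun ω => if hω : ∃ j, ω ∈ G' j then hω.choose else Classical.arbitrary J
  have hG'd : ∀ i j ω, ω ∈ G' i → ω ∈ G' j → i = j := fun i j ω hi hj => by
    by_contra hij
    exact Set.disjoint_left.mp (hGd i j hij) hi.1 hj.1
  have hs' : ∀ j, ∀ ω ∈ G' j, s' ω = j := by
    intro j ω hω
    have hex : ∃ j, ω ∈ G' j := ⟨j, hω⟩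
    simp only [s', dif_pos hex]
    exact hG'd _ _ ω hex.choose_spec hω
  refine ⟨s', G', measurable_to_countable' fun j => ?_, hG'm, fun j ω hω => ⟨hs' j ω hω, hω.2⟩,
    fun j => ?_⟩
  · have : s' ⁻¹' {j} = G' j ∪ ({ω | Classical.arbitrary J = j} ∩ (⋃ i, G' i)ᶜ) := by
      ext ω
      by_cases hex : ∃ i, ω ∈ G' i
      · obtain ⟨i, hi⟩ := hex
        have h1 := hs' i ω hi
        simp only [Set.mem_preimage, h1, Set.mem_singleton_iff, Set.mem_union, Set.mem_inter_iff,
          Set.mem_compl_iff, Set.mem_iUnion]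
        constructor
        · rintro rfl
          exact Or.inl hi
        · rintro (hj | ⟨-, hj⟩)
          · exact hG'd _ _ ω hi hj
          · exact absurd ⟨i, hi⟩ hj
      · have h1 : s' ω = Classical.arbitrary J := by simp only [s', dif_neg hex]
        simp only [Set.mem_preimage, h1, Set.mem_singleton_iff, Set.mem_union, Set.mem_inter_iff,
          Set.mem_compl_iff, Set.mem_iUnion]
        constructor
        · exact fun hj => Or.inr ⟨hj, hex⟩
        · rintro (hj | ⟨hj, -⟩)
          · exact absurd ⟨j, hj⟩ hex
          · exact hj
    rw [this]
    exact (hG'm j).union ((MeasurableSet.const _).inter (MeasurableSet.iUnion hG'm).compl)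
  · have h1 : |μ'.real (G' j) - ∫ ω, u j ω ∂μ'| ≤ Fintype.card (Finset J) * δ := by
      rw [← hsumG, ← hsumu, ← Finset.sum_sub_distrib]
      refine (Finset.abs_sum_le_sum_abs _ _).trans ?_
      rw [← nsmul_eq_mul, ← Finset.card_univ]
      refine Finset.sum_le_card_nsmul _ _ _ fun D _ => ?_
      rw [hG'κ, abs_le]
      constructor <;> linarith [(hGu j D).1, (hGu j D).2]
    calc |μ'.real (G' j) - μ.real (s ⁻¹' {j})|
        ≤ |μ'.real (G' j) - ∫ ω, u j ω ∂μ'| + |∫ ω, u j ω ∂μ' - μ.real (s ⁻¹' {j})| :=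
          abs_sub_le _ _ _
      _ ≤ _ := by linarith [hup j]

omit [DecidableEq J] in
/-- Comparison of the expectations of two random variables that are almost determined by random
choices with similar distributions. -/
theorem abs_integral_sub_integral_le [MeasurableSpace J] [MeasurableSingletonClass J]
    {Ω Ω' : Type*} [MeasurableSpace Ω] [MeasurableSpace Ω']
    {μ : Measure Ω} {μ' : Measure Ω'} [IsProbabilityMeasure μ] [IsProbabilityMeasure μ']
    {f : Ω → ℝ} {f' : Ω' → ℝ} (hf : Integrable f μ) (hf' : Integrable f' μ')
    (hf01' : ∀ ω, f' ω ∈ Set.Icc (0 : ℝ) 1) {s : Ω → J} (hs : Measurable s)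
    {G : J → Set Ω'} (hG : ∀ j, MeasurableSet (G j))
    (hGd : ∀ i j ω, ω ∈ G i → ω ∈ G j → i = j) {v : J → ℝ} (hv : ∀ j, v j ∈ Set.Icc (0 : ℝ) 1)
    {e κ : ℝ} (he : 0 ≤ e) (h1 : ∀ ω, |f ω - v (s ω)| ≤ e)
    (h2 : ∀ᵐ ω ∂μ', ∀ j, ω ∈ G j → |f' ω - v j| ≤ e)
    (h3 : ∀ j, |μ'.real (G j) - μ.real (s ⁻¹' {j})| ≤ κ) :
    |∫ ω, f ω ∂μ - ∫ ω, f' ω ∂μ'| ≤ 2 * e + 2 * Fintype.card J * κ := by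
  classical
  have hsm : ∀ j, MeasurableSet (s ⁻¹' {j}) := fun j => hs (measurableSet_singleton j)
  have hvs : ∀ ω, v (s ω) = ∑ j, (s ⁻¹' {j}).indicator (fun _ => v j) ω := by
    intro ω
    rw [Finset.sum_eq_single (s ω)]
    · simp
    · intro j _ hj
      exact Set.indicator_of_notMem (fun hω => hj (Eq.symm hω)) _
    · simp
  have i1 : ∀ j, Integrable ((s ⁻¹' {j}).indicator fun _ => v j) μ := fun j =>
    (integrable_const _).indicator (hsm j)
  have i2 : ∀ j, Integrable ((G j).indicator fun _ => v j) μ' := fun j =>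
    (integrable_const _).indicator (hG j)
  have i3 : ∀ j, Integrable ((G j).indicator fun _ => (1 : ℝ)) μ' := fun j =>
    (integrable_const _).indicator (hG j)
  have ev : ∫ ω, v (s ω) ∂μ = ∑ j, μ.real (s ⁻¹' {j}) * v j := by
    simp only [hvs]
    rw [integral_finsetSum _ fun j _ => i1 j]
    exact Finset.sum_congr rfl fun j _ => by rw [integral_indicator_const _ (hsm j), smul_eq_mul]
  have a1 : |∫ ω, f ω ∂μ - ∑ j, μ.real (s ⁻¹' {j}) * v j| ≤ e := by
    have hi : Integrable (fun ω => v (s ω)) μ := by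
      simp only [hvs]
      exact integrable_finsetSum _ fun j _ => i1 j
    rw [← ev, ← integral_sub hf hi]
    have := norm_integral_le_of_norm_le_const (μ := μ)
      (Eventually.of_forall fun ω => (Real.norm_eq_abs _).le.trans (h1 ω))
    simpa using this
  have ev' : ∫ ω, ∑ j, (G j).indicator (fun _ => v j) ω ∂μ' = ∑ j, μ'.real (G j) * v j := by
    rw [integral_finsetSum _ fun j _ => i2 j]
    exact Finset.sum_congr rfl fun j _ => by rw [integral_indicator_const _ (hG j), smul_eq_mul]
  have ev1 : ∫ ω, ∑ j, (G j).indicator (fun _ => (1 : ℝ)) ω ∂μ' = ∑ j, μ'.real (G j) := by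
    rw [integral_finsetSum _ fun j _ => i3 j]
    exact Finset.sum_congr rfl fun j _ => by
      rw [integral_indicator_const _ (hG j), smul_eq_mul, mul_one]
  have i4 : Integrable (fun ω => e + (1 - ∑ j, (G j).indicator (fun _ => (1 : ℝ)) ω)) μ' :=
    (integrable_const e).add ((integrable_const 1).sub (integrable_finsetSum _ fun j _ => i3 j))
  -- Outside the union of the `G j` the only bound for `f'` is `1`, and the measure of this
  -- remainder is `1 - ∑ j, μ'.real (G j)`.
  have a2 : |∫ ω, f' ω ∂μ' - ∑ j, μ'.real (G j) * v j| ≤ e + (1 - ∑ j, μ'.real (G j)) := by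
    rw [← ev', ← integral_sub hf' (integrable_finsetSum _ fun j _ => i2 j)]
    refine abs_integral_le_integral_abs.trans ?_
    have e5 : ∫ ω, (e + (1 - ∑ j, (G j).indicator (fun _ => (1 : ℝ)) ω)) ∂μ'
        = e + (1 - ∑ j, μ'.real (G j)) := by
      have i5 : Integrable (fun ω => ∑ j, (G j).indicator (fun _ => (1 : ℝ)) ω) μ' :=
        integrable_finsetSum _ fun j _ => i3 j
      have i6 : Integrable (fun ω => 1 - ∑ j, (G j).indicator (fun _ => (1 : ℝ)) ω) μ' :=
        (integrable_const (1 : ℝ)).sub i5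
      rw [integral_add (integrable_const e) i6, integral_sub (integrable_const 1) i5, ev1]
      simp
    rw [← e5]
    refine integral_mono_ae (hf'.sub (integrable_finsetSum _ fun j _ => i2 j)).abs i4 ?_
    filter_upwards [h2] with ω hω
    by_cases hex : ∃ j, ω ∈ G j
    · obtain ⟨j, hj⟩ := hex
      have e6 : ∀ g : J → ℝ, ∑ i, (G i).indicator (fun _ => g i) ω = g j := fun g => by
        rw [Finset.sum_eq_single j]
        · simp [hj]
        · intro i _ hij
          exact Set.indicator_of_notMem (fun hi => hij (hGd i j ω hi hj)) _
        · simp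
      have e7 := e6 fun _ => 1
      simp only [e6 v, e7]
      simpa using hω j hj
    · have e6 : ∀ g : J → ℝ, ∑ i, (G i).indicator (fun _ => g i) ω = 0 := fun g =>
        Finset.sum_eq_zero fun i _ => Set.indicator_of_notMem (fun hi => hex ⟨i, hi⟩) _
      have e7 := e6 fun _ => 1
      simp only [e6 v, e7]
      rw [sub_zero, abs_of_nonneg (hf01' ω).1]
      linarith [(hf01' ω).2]
  have hp1 : ∑ j, μ.real (s ⁻¹' {j}) = 1 := by
    have hU := measureReal_iUnion_fintype (μ := μ) (f := fun j => s ⁻¹' {j})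
      (fun i j hij => Set.disjoint_left.mpr fun ω hi hj => hij (Eq.trans (Eq.symm hi) hj)) hsm
    have : ⋃ j, s ⁻¹' {j} = Set.univ := by
      ext ω
      simp
    rw [← hU, this, probReal_univ]
  have hcard : ∀ g : J → ℝ, (∀ j, |g j| ≤ κ) → |∑ j, g j| ≤ Fintype.card J * κ := fun g hg => by
    refine (Finset.abs_sum_le_sum_abs _ _).trans ?_
    rw [← nsmul_eq_mul, ← Finset.card_univ]
    exact Finset.sum_le_card_nsmul _ _ _ fun j _ => hg j
  -- The probabilities of the values of `s` add up to `1`, so the remainder has measure at most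
  -- `Fintype.card J * κ`; the comparison of the weighted sums costs the same amount once more.
  have a3 := hcard _ h3
  rw [Finset.sum_sub_distrib, hp1] at a3
  have a4 := hcard (fun j => μ'.real (G j) * v j - μ.real (s ⁻¹' {j}) * v j) fun j => by
    rw [← sub_mul, abs_mul, abs_of_nonneg (hv j).1]
    exact (mul_le_of_le_one_right (abs_nonneg _) (hv j).2).trans (h3 j)
  rw [Finset.sum_sub_distrib] at a4
  rw [abs_le] at a1 a2 a3 a4 ⊢
  constructor <;> linarith

end Pieces

end

end ContLogic

namespace ContLogic

open Filter Topology

noncomputable section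

/-! ### Finite suprema and distances in propositional logics -/

namespace CPL

variable {S : Type*} [CPL S]

/-- `|x - y|`. -/
def absDiff (x y : S) : S := sup (tsub x y) (tsub y x)

/-- The supremum of a finite family. -/
def bigSup {A : Type*} (V : Finset A) (zero : S) (x : A → S) : S :=
  (V.toList.map x).foldr sup zero

variable {h : S → ℝ}

theorem IsHom.absDiff (hh : IsHom h) (hm : ∀ x, h x ∈ Set.Icc (0 : ℝ) 1) (x y : S) :
    h (CPL.absDiff x y) = |h x - h y| := by
  have hx := hm x
  have hy := hm y
  rw [CPL.absDiff, hh.sup, hh.tsub, hh.tsub, sup_real (tsub_mem hx hy).2 (tsub_mem hy hx).2,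
    tsub_real, tsub_real]
  grind

theorem IsHom.bigSup_le_iff (hh : IsHom h) (hm : ∀ x, h x ∈ Set.Icc (0 : ℝ) 1) {A : Type*}
    (V : Finset A) {zero : S} (h0 : h zero = 0) (x : A → S) {t : ℝ} (ht : 0 ≤ t) :
    h (bigSup V zero x) ≤ t ↔ ∀ a ∈ V, h (x a) ≤ t := by
  have key : ∀ l : List A, h ((l.map x).foldr CPL.sup zero) ≤ t ↔ ∀ a ∈ l, h (x a) ≤ t := by
    intro l
    induction l with
    | nil => simpa [h0] using ht
    | cons a l ih =>
      rw [List.map_cons, List.foldr_cons, hh.sup, sup_real (hm _).2 (hm _).2, max_le_iff, ih]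
      simp
  simpa [bigSup] using key V.toList

end CPL

/-! ### Quantities determined by expectations -/

/-- The quantity `F` is uniformly determined by the expectations of the propositional
combinations of the random variables `e`. -/
def Determined {𝒞 β : Type*} {L : Signature.{u}} (N : 𝒞 → RStr L) (e : ∀ c, β → (N c).Aux)
    (F : 𝒞 → ℝ) : Prop :=
  ∀ ε > 0, ∃ Δ : Finset (FreeCPL β), ∃ δ > 0, ∀ c c',
    (∀ τ ∈ Δ, |(N c).E (τ.eval (e c)) - (N c').E (τ.eval (e c'))| ≤ δ) → F c' ≤ F c + ε

namespace Determined

variable {𝒞 β : Type*} {L : Signature.{u}} {N : 𝒞 → RStr L} {e : ∀ c, β → (N c).Aux}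
  {F F' : 𝒞 → ℝ}

theorem expectation (τ : FreeCPL β) : Determined N e fun c => (N c).E (τ.eval (e c)) := by
  intro ε hε
  refine ⟨{τ}, ε, hε, fun c c' h => ?_⟩
  have := abs_le.mp (h τ (Finset.mem_singleton_self _))
  linarith

theorem neg (h : Determined N e F) : Determined N e fun c => CPL.neg (F c) := by
  intro ε hε
  obtain ⟨Δ, δ, hδ, hΔ⟩ := h ε hε
  refine ⟨Δ, δ, hδ, fun c c' hc => ?_⟩
  have := hΔ c' c fun τ hτ => abs_sub_comm ((N c).E _) _ ▸ hc τ hτ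
  simp only [CPL.neg_real]
  linarith

theorem half (h : Determined N e F) : Determined N e fun c => CPL.half (F c) := by
  intro ε hε
  obtain ⟨Δ, δ, hδ, hΔ⟩ := h ε hε
  refine ⟨Δ, δ, hδ, fun c c' hc => ?_⟩
  have := hΔ c c' hc
  simp only [CPL.half_real]
  linarith

theorem add (h : Determined N e F) (h' : Determined N e F') :
    Determined N e fun c => F c + F' c := by
  classical
  intro ε hε
  obtain ⟨Δ, δ, hδ, hΔ⟩ := h (ε / 2) (half_pos hε)
  obtain ⟨Δ', δ', hδ', hΔ'⟩ := h' (ε / 2) (half_pos hε)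
  refine ⟨Δ ∪ Δ', min δ δ', lt_min hδ hδ', fun c c' hc => ?_⟩
  have h1 := hΔ c c' fun τ hτ => (hc τ (Finset.mem_union_left _ hτ)).trans (min_le_left _ _)
  have h2 := hΔ' c c' fun τ hτ => (hc τ (Finset.mem_union_right _ hτ)).trans (min_le_right _ _)
  linarith

theorem tsub (h : Determined N e F) (h' : Determined N e F') :
    Determined N e fun c => CPL.tsub (F c) (F' c) := by
  intro ε hε
  obtain ⟨Δ, δ, hδ, hΔ⟩ := (h.add h'.neg) ε hε
  refine ⟨Δ, δ, hδ, fun c c' hc => ?_⟩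
  have := hΔ c c' hc
  simp only [CPL.tsub_real, CPL.neg_real] at this ⊢
  grind

theorem comp {𝒞' : Type*} (h : Determined N e F) (f : 𝒞' → 𝒞) :
    Determined (fun c => N (f c)) (fun c => e (f c)) fun c => F (f c) := by
  intro ε hε
  obtain ⟨Δ, δ, hδ, hΔ⟩ := h ε hε
  exact ⟨Δ, δ, hδ, fun c c' hc => hΔ _ _ hc⟩

end Determined

theorem exists_nat_div_two_pow (l : ℕ) {t : ℝ} (ht : t ∈ Set.Icc (0 : ℝ) 1) :
    |t - (⌊t * 2 ^ l⌋₊ : ℝ) / 2 ^ l| ≤ 1 / 2 ^ l ∧ ⌊t * 2 ^ l⌋₊ < 2 ^ l + 1 := by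
  have h2 : (0 : ℝ) < 2 ^ l := by positivity
  have h0 : 0 ≤ t * 2 ^ l := mul_nonneg ht.1 h2.le
  have h1 := Nat.floor_le h0
  have h3 := Nat.lt_floor_add_one (t * 2 ^ l)
  constructor
  · rw [abs_le]
    constructor
    · have : (⌊t * 2 ^ l⌋₊ : ℝ) / 2 ^ l ≤ t := (div_le_iff₀ h2).mpr h1
      have h4 : (0 : ℝ) ≤ 1 / 2 ^ l := by positivity
      linarith
    · rw [sub_le_iff_le_add, ← add_div, le_div_iff₀ h2]
      linarith
  · have : (⌊t * 2 ^ l⌋₊ : ℝ) ≤ 2 ^ l := h1.trans (mul_le_of_le_one_left h2.le ht.2)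
    have h4 : ⌊t * 2 ^ l⌋₊ ≤ 2 ^ l := by exact_mod_cast this
    omega

/-- A choice of values on a dyadic grid, as a random assignment. -/
def gridVal {β : Type*} (V : Finset β) (l : ℕ) (j : V → Fin (2 ^ l + 1)) (θ : β) : ℝ :=
  open Classical in if h : θ ∈ V then ((j ⟨θ, h⟩ : ℕ) : ℝ) / 2 ^ l else 0

theorem gridVal_of_mem {β : Type*} {V : Finset β} {l : ℕ} (j : V → Fin (2 ^ l + 1)) (θ : V) :
    gridVal V l j θ = ((j θ : ℕ) : ℝ) / 2 ^ l := by
  rw [gridVal, dif_pos θ.2]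

theorem gridVal_mem {β : Type*} (V : Finset β) (l : ℕ) (j : V → Fin (2 ^ l + 1)) (θ : β) :
    gridVal V l j θ ∈ Set.Icc (0 : ℝ) 1 := by
  unfold gridVal
  split_ifs with h
  · refine ⟨by positivity, (div_le_one (by positivity)).mpr ?_⟩
    have := (j ⟨θ, h⟩).is_le
    exact_mod_cast this
  · simp

/-- The heart of quantifier elimination: infima of determined quantities over new random
elements are determined, provided that the joint laws of the new elements with the old ones can be
described by the old ones. -/
theorem Determined.iInf {𝒞 β β' : Type*} {L : Signature.{u}} {N : 𝒞 → RStr L}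
    {e : ∀ c, β → (N c).Aux} (hN : ∀ c, (N c).IsARV) {New : 𝒞 → Type*} [∀ c, Nonempty (New c)]
    (e' : ∀ c, New c → β' → (N c).Aux) (F : ∀ c, New c → ℝ) (hF0 : ∀ c x, 0 ≤ F c x)
    (hF : Determined (fun p : Σ c, New c => N p.1) (fun p => e' p.1 p.2) fun p => F p.1 p.2)
    (hψ : ∀ (V : Finset β') (l : ℕ), ∃ ψ : (V → Fin (2 ^ l + 1)) → FreeCPL β,
      (∀ c x (R : Rep (N c)) ω j, ∀ t ≥ 0,
        (∀ θ : V, |R.r (e' c x θ) ω - gridVal V l j θ| ≤ t) →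
          R.r ((ψ j).eval (e c)) ω ≤ t) ∧
      ∀ c (R : Rep (N c)) (s : R.Ω → V → Fin (2 ^ l + 1)), Measurable s → ∀ ρ > 0,
        ∃ x : New c, ∀ᵐ ω ∂(R.μ), ∀ θ : V,
          |R.r (e' c x θ) ω - gridVal V l (s ω) θ| ≤ R.r ((ψ (s ω)).eval (e c)) ω + ρ) :
    Determined N e fun c => ⨅ x, F c x := by
  classical
  -- In the hypothesis `hψ`, the old random variable `ψ j` measures how closely a new element can
  -- have the grid vector `j` as its values. The first clause makes it a lower bound for the error
  -- of every element, the second realises it, up to `ρ`, for random choices of `j`.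
  intro ε hε
  obtain ⟨Δ', δ', hδ', hΔ'⟩ := hF (ε / 2) (half_pos hε)
  let V := Δ'.biUnion FreeCPL.vars
  have hV : ∀ τ ∈ Δ', ∀ θ ∈ τ.vars, θ ∈ V := fun τ hτ θ hθ =>
    Finset.mem_biUnion.mpr ⟨τ, hτ, hθ⟩
  obtain ⟨Λ, hΛ1, hΛ⟩ : ∃ Λ : ℝ, 1 ≤ Λ ∧ ∀ τ ∈ Δ', τ.lip ≤ Λ := by
    refine ⟨1 + ∑ τ ∈ Δ', τ.lip, le_add_of_nonneg_right
      (Finset.sum_nonneg fun τ _ => τ.lip_nonneg), fun τ hτ => ?_⟩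
    have := Finset.single_le_sum (fun τ _ => FreeCPL.lip_nonneg τ) hτ
    linarith
  -- The values are controlled up to `3 * ρ` in both models, which contributes `2 * (Λ * (3 * ρ)) =
  -- δ' / 2` to the final error.
  set ρ := δ' / (12 * Λ) with hρdef
  have hρ : 0 < ρ := by positivity
  have hρΛ : Λ * ρ = δ' / 12 := by
    rw [hρdef]
    field_simp
  obtain ⟨l, hl⟩ := exists_pow_lt_of_lt_one hρ (show (1 / 2 : ℝ) < 1 by norm_num)
  have hl' : 1 / 2 ^ l ≤ ρ := by
    rw [div_pow, one_pow] at hl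
    exact hl.le
  obtain ⟨ψ, hψ1, hψ2⟩ := hψ V l
  let J := V → Fin (2 ^ l + 1)
  set n : ℝ := (Fintype.card J : ℝ) with hn
  set n' : ℝ := (Fintype.card (Finset J) : ℝ) with hn'
  have hnpos : 0 < n := by
    rw [hn]
    exact_mod_cast Fintype.card_pos
  have hnpos' : 0 < n' := by
    rw [hn']
    exact_mod_cast Fintype.card_pos
  -- The pieces have expectations agreeing up to `3 * κ`: one `κ` from the hypothesis and one from
  -- the approximation by a term in each model. The transfer of the choice then contributes the
  -- other `δ' / 2`.
  set κ := δ' / (24 * n * n') with hκdef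
  have hκ : 0 < κ := by positivity
  have hκn : 2 * n * (2 * n' * (3 * κ)) = δ' / 2 := by
    rw [hκdef]
    field_simp
    norm_num
  have hσ : ∀ A : Finset J, ∃ σ : FreeCPL J, ∀ z : J → Set.Icc (0 : ℝ) 1,
      |piece ρ A (fun j => (z j : ℝ)) - σ.eval fun j => (z j : ℝ)| ≤ κ := fun A =>
    exists_term_abs_sub_le (fun z => piece ρ A fun j => (z j : ℝ))
      ((continuous_piece ρ A).comp (by fun_prop)) (fun z => piece_mem ρ A _) hκ
  choose σ hσ using hσ
  -- The finitely many expectations to control are those of the pieces of the vector `ψ`,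
  -- approximated by terms.
  refine ⟨Finset.univ.image fun A => (σ A).eval ψ, κ, hκ, fun c c' hcc => ?_⟩
  obtain ⟨R⟩ := (hN c).nonempty_rep
  obtain ⟨R'⟩ := (hN c').nonempty_rep
  let z : ∀ c (R : Rep (N c)), R.Ω → J → ℝ := fun c R ω j => R.r ((ψ j).eval (e c)) ω
  have hz01 : ∀ c (R : Rep (N c)) ω j, z c R ω j ∈ Set.Icc (0 : ℝ) 1 := fun c R ω j => R.mem _ _
  have hzm : ∀ c (R : Rep (N c)), Measurable (z c R) := fun c R =>
    measurable_pi_lambda _ fun j => R.measurable _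
  have hzσ : ∀ c (R : Rep (N c)) A,
      |∫ ω, piece ρ A (z c R ω) ∂(R.μ) - (N c).E (((σ A).eval ψ).eval (e c))| ≤ κ := by
    intro c R A
    have hi : Integrable (fun ω => piece ρ A (z c R ω)) R.μ :=
      integrable_of_mem_Icc ((continuous_piece ρ A).measurable.comp (hzm c R))
        fun ω => piece_mem ρ A _
    rw [R.E_eq, ← integral_sub hi (R.integrable _)]
    refine (abs_integral_le_integral_abs).trans ?_
    have h1 : ∫ _, κ ∂(R.μ) = κ := by simp
    rw [← h1]
    refine integral_mono (hi.sub (R.integrable _)).abs (integrable_const κ) fun ω => ?_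
    dsimp only
    rw [FreeCPL.map_eval (FreeCPL.isHom_eval (e c)), R.r_eval]
    exact hσ A fun j => ⟨z c R ω j, hz01 c R ω j⟩
  have hpiece : ∀ A, |∫ ω, piece ρ A (z c R ω) ∂(R.μ) - ∫ ω, piece ρ A (z c' R' ω) ∂(R'.μ)|
      ≤ 3 * κ := by
    intro A
    have h1 := hcc _ (Finset.mem_image_of_mem (fun A => (σ A).eval ψ) (Finset.mem_univ A))
    have h2 := hzσ c R A
    have h3 := hzσ c' R' A
    rw [abs_le] at *
    constructor <;> linarith
  obtain ⟨x, hx⟩ := exists_lt_of_ciInf_lt (show ⨅ x, F c x < (⨅ x, F c x) + ε / 2 by linarith)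
  -- The values of a near-optimal new element, rounded down to the grid; this is the random choice
  -- to be imitated in the second model.
  let s : R.Ω → J := fun ω θ =>
    ⟨⌊R.r (e' c x θ) ω * 2 ^ l⌋₊, (exists_nat_div_two_pow l (R.mem _ _)).2⟩
  have hs : Measurable s := by
    refine measurable_pi_lambda _ fun θ => measurable_to_countable' fun k => ?_
    have : (fun ω => s ω θ) ⁻¹' {k} = {ω | ⌊R.r (e' c x θ) ω * 2 ^ l⌋₊ = (k : ℕ)} := by
      ext ω
      simp [s, Fin.ext_iff]
    rw [this]
    exact (Nat.measurable_floor.comp ((R.measurable _).mul_const _)) (measurableSet_singleton _)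
  have hsr : ∀ ω (θ : V), |R.r (e' c x θ) ω - gridVal V l (s ω) θ| ≤ ρ := fun ω θ => by
    rw [gridVal_of_mem]
    exact (exists_nat_div_two_pow l (R.mem _ _)).1.trans hl'
  obtain ⟨s', G, hs', hG, hsG, hGμ⟩ := exists_similar_choice (R'.halving (hN c')) hρ (hzm c R)
    (hzm c' R') hs (fun ω => hψ1 c x R ω (s ω) ρ hρ.le (hsr ω)) (by positivity) hpiece
  -- On `G j` the attainability error is below `2 * ρ`, so the new element is within `3 * ρ` of the
  -- grid vector `j` there.
  obtain ⟨x', hx'⟩ := hψ2 c' R' s' hs' ρ hρ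
  have hclose := hΔ' ⟨c, x⟩ ⟨c', x'⟩ fun τ hτ => by
    have hlip : ∀ {v v' : β' → ℝ} {t : ℝ}, 0 ≤ t → (∀ θ : V, |v θ - v' θ| ≤ t) →
        |τ.eval v - τ.eval v'| ≤ Λ * t := fun ht hv =>
      (τ.abs_eval_sub_le fun θ hθ => hv ⟨θ, hV τ hτ θ hθ⟩).trans
        (mul_le_mul_of_nonneg_right (hΛ τ hτ) ht)
    have := abs_integral_sub_integral_le (J := J) (e := Λ * (3 * ρ)) (κ := 2 * n' * (3 * κ))
      (v := fun j => τ.eval (gridVal V l j))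
      (R.integrable (τ.eval (e' c x))) (R'.integrable (τ.eval (e' c' x')))
      (fun ω => R'.mem _ _) hs hG
      (fun i j ω hi hj => (hsG i ω hi).1.symm.trans (hsG j ω hj).1)
      (fun j => τ.eval_mem fun θ => gridVal_mem V l j θ) (by positivity) (fun ω => by
        rw [R.r_eval]
        refine hlip (by positivity) fun θ => (hsr ω θ).trans (by linarith))
      (by
        filter_upwards [hx'] with ω hω j hj
        rw [R'.r_eval]
        refine hlip (by positivity) fun θ => ?_
        obtain ⟨h1, h2⟩ := hsG j ω hj
        have h3 := hω θ
        rw [h1] at h3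
        have h4 : R'.r ((ψ j).eval (e c')) ω < 2 * ρ := h2
        linarith) hGμ
    rw [← R.E_eq, ← R'.E_eq] at this
    refine this.trans ?_
    rw [← hn, hκn]
    linarith
  have hbd : BddBelow (Set.range (F c')) := ⟨0, by rintro _ ⟨y, rfl⟩; exact hF0 c' y⟩
  have := ciInf_le hbd x'
  simp only at hclose
  linarith

/-! ### Quantifier elimination -/

theorem CPL.IsHom.comp {S S' S'' : Type*} [CPL S] [CPL S'] [CPL S''] {g : S' → S''} {f : S → S'}
    (hg : CPL.IsHom g) (hf : CPL.IsHom f) : CPL.IsHom fun x => g (f x) :=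
  ⟨fun x => by rw [hf.neg, hg.neg], fun x => by rw [hf.half, hg.half],
    fun x y => by rw [hf.tsub, hg.tsub]⟩

theorem BFormula.isHom_bracket {L : Signature.{u}} {I : Type v} (N : RStr L) (a : I → N.Main)
    {m : ℕ} (b : Fin m → N.Main) : CPL.IsHom fun φ : BFormula L I m => φ.bracket N a b :=
  ⟨fun _ => rfl, fun _ => rfl, fun _ _ => rfl⟩

/-- An element of a propositional logic for the value `gridVal V l j θ`. -/
def gridElem {S : Type*} [CPL S] {β : Type*} (V : Finset β) (l : ℕ) (j : V → Fin (2 ^ l + 1))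
    (zero : S) (θ : β) : S :=
  open Classical in if h : θ ∈ V then CPL.dyadic zero (j ⟨θ, h⟩) l else zero

theorem CPL.IsHom.gridElem {S : Type*} [CPL S] {h : S → ℝ} (hh : CPL.IsHom h) {zero : S}
    (h0 : h zero = 0) {β : Type*} (V : Finset β) (l : ℕ) (j : V → Fin (2 ^ l + 1)) (θ : β) :
    h (gridElem V l j zero θ) = gridVal V l j θ := by
  unfold ContLogic.gridElem gridVal
  split_ifs with hθ
  · rw [hh.dyadic, h0, CPL.dyadic_real, min_eq_left]
    rw [div_le_one (by positivity)]
    have := (j ⟨θ, hθ⟩).is_le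
    exact_mod_cast this
  · exact h0

/-- Randomised structures with parameters. -/
structure Conf (L : Signature.{u}) (I : Type v) (m k : ℕ) where
  N : RStr L
  isT0R : N.IsT0R
  a : I → N.Main
  b : Fin m → N.Main
  X : Fin k → N.Aux

namespace Conf

variable {L : Signature.{u}} {I : Type v} {m k : ℕ}

/-- The random variables given by the parameters. -/
def vars (c : Conf L I m k) : BFormula L I m ⊕ Fin k → c.N.Aux :=
  Sum.elim (fun φ => φ.bracket c.N c.a c.b) c.X

/-- Adding a parameter of the main sort. -/
def snocMain (c : Conf L I m k) (x : c.N.Main) : Conf L I (m + 1) k :=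
  { c with b := Fin.snoc c.b x }

/-- Adding a parameter of the auxiliary sort. -/
def snocAux (c : Conf L I m k) (Y : c.N.Aux) : Conf L I m (k + 1) :=
  { c with X := Fin.snoc c.X Y }

/-- The zero of the terms in `BFormula L I m ⊕ Fin k`. -/
def zeroTerm : FreeCPL (BFormula L I m ⊕ Fin k) := .var (Sum.inl .zero)

theorem isHom_r (c : Conf L I m k) (R : Rep c.N) (ω : R.Ω) :
    CPL.IsHom fun τ : FreeCPL (BFormula L I m ⊕ Fin k) => R.r (τ.eval c.vars) ω :=
  (R.hom ω).comp (FreeCPL.isHom_eval c.vars)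

theorem r_zeroTerm (c : Conf L I m k) (R : Rep c.N) (ω : R.Ω) :
    R.r ((zeroTerm : FreeCPL (BFormula L I m ⊕ Fin k)).eval c.vars) ω = 0 := by
  change R.r ((BFormula.zero : BFormula L I m).bracket c.N c.a c.b) ω = 0
  rw [R.r_bracket c.isT0R, BFormula.value_zero]

/-- Values of auxiliary terms are propositional combinations of the random variables. -/
def ofAuxTerm : AuxTerm L (I ⊕ Fin m) (Fin k) → FreeCPL (BFormula L I m ⊕ Fin k)
  | .var i => .var (Sum.inr i)
  | .zero => zeroTerm
  | .neg τ => .neg (ofAuxTerm τ)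
  | .half τ => .half (ofAuxTerm τ)
  | .tsub τ σ => .tsub (ofAuxTerm τ) (ofAuxTerm σ)
  | .brDist s t => .var (Sum.inl (.dist s t))
  | .brPred P ts => .var (Sum.inl (.pred P ts))

theorem eval_ofAuxTerm (c : Conf L I m k) (τ : AuxTerm L (I ⊕ Fin m) (Fin k)) :
    (ofAuxTerm τ).eval c.vars = τ.eval c.N (Sum.elim c.a c.b) c.X := by
  induction τ with
  | var i => rfl
  | zero =>
    obtain ⟨R⟩ := c.isT0R.toIsRV.nonempty_rep
    exact R.ext c.isT0R.toIsRV fun ω => (c.r_zeroTerm R ω).trans (R.zero ω).symm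
  | neg τ ih => simp only [ofAuxTerm, FreeCPL.eval, AuxTerm.eval, ih]
  | half τ ih => simp only [ofAuxTerm, FreeCPL.eval, AuxTerm.eval, ih]
  | tsub τ σ ih ih' => simp only [ofAuxTerm, FreeCPL.eval, AuxTerm.eval, ih, ih']
  | brDist s t => rfl
  | brPred P ts => rfl

/-- The attainability of a grid vector is the maximum of `inf_x` of the largest error of the
formulae, a formula in the old variables, and of the error of the auxiliary variables, which `x`
does not affect. A random choice is realised by gluing near-witnesses, one for each grid vector. -/
theorem determined_iInf_main {F : Conf L I (m + 1) k → ℝ} (hF0 : ∀ c, 0 ≤ F c)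
    (hF : Determined Conf.N vars F) :
    Determined Conf.N vars fun c : Conf L I m k => ⨅ x, F (c.snocMain x) := by
  refine Determined.iInf (fun c : Conf L I m k => c.isT0R.toIsARV)
    (fun c (x : c.N.Main) => (c.snocMain x).vars) (fun c x => F (c.snocMain x)) (fun c x => hF0 _)
    (hF.comp fun p : Σ c : Conf L I m k, c.N.Main => p.1.snocMain p.2) fun V l => ?_
  let χ : (V → Fin (2 ^ l + 1)) → BFormula L I (m + 1) := fun j =>
    CPL.bigSup V .zero fun θ =>
      Sum.elim (fun φ => CPL.absDiff φ (gridElem V l j .zero θ)) (fun _ => .zero) θ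
  let ξ : (V → Fin (2 ^ l + 1)) → FreeCPL (BFormula L I m ⊕ Fin k) := fun j =>
    CPL.bigSup V zeroTerm fun θ =>
      Sum.elim (fun _ => zeroTerm)
        (fun i => CPL.absDiff (.var (Sum.inr i)) (gridElem V l j zeroTerm θ)) θ
  have hhom : ∀ (c : Conf L I m k) (x : c.N.Main) (R : Rep c.N) (ω : R.Ω),
      CPL.IsHom fun φ : BFormula L I (m + 1) => R.r (φ.bracket c.N c.a (Fin.snoc c.b x)) ω :=
    fun c x R ω => (R.hom ω).comp (BFormula.isHom_bracket c.N c.a _)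
  have hzero : ∀ (c : Conf L I m k) (x : c.N.Main) (R : Rep c.N) (ω : R.Ω),
      R.r ((BFormula.zero : BFormula L I (m + 1)).bracket c.N c.a (Fin.snoc c.b x)) ω = 0 :=
    fun c x R ω => by rw [R.r_bracket c.isT0R, BFormula.value_zero]
  have hχ : ∀ (c : Conf L I m k) (x : c.N.Main) (R : Rep c.N) (ω : R.Ω) j (t : ℝ), 0 ≤ t →
      (R.r ((χ j).bracket c.N c.a (Fin.snoc c.b x)) ω ≤ t ↔ ∀ φ, Sum.inl φ ∈ V →
        |R.r (φ.bracket c.N c.a (Fin.snoc c.b x)) ω - gridVal V l j (Sum.inl φ)| ≤ t) := by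
    intro c x R ω j t ht
    rw [(hhom c x R ω).bigSup_le_iff (fun φ => R.mem _ _) V (hzero c x R ω) _ ht]
    constructor
    · intro h φ hφ
      have := h _ hφ
      rwa [Sum.elim_inl, (hhom c x R ω).absDiff (fun φ => R.mem _ _),
        (hhom c x R ω).gridElem (hzero c x R ω)] at this
    · rintro h (φ | i) hθ
      · rw [Sum.elim_inl, (hhom c x R ω).absDiff (fun φ => R.mem _ _),
          (hhom c x R ω).gridElem (hzero c x R ω)]
        exact h φ hθ
      · rw [Sum.elim_inr, hzero]
        exact ht
  have hξ : ∀ (c : Conf L I m k) (R : Rep c.N) (ω : R.Ω) j (t : ℝ), 0 ≤ t →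
      (R.r ((ξ j).eval c.vars) ω ≤ t ↔ ∀ i, Sum.inr i ∈ V →
        |R.r (c.X i) ω - gridVal V l j (Sum.inr i)| ≤ t) := by
    intro c R ω j t ht
    rw [(c.isHom_r R ω).bigSup_le_iff (fun φ => R.mem _ _) V (c.r_zeroTerm R ω) _ ht]
    constructor
    · intro h i hi
      have := h _ hi
      rwa [Sum.elim_inr, (c.isHom_r R ω).absDiff (fun φ => R.mem _ _),
        (c.isHom_r R ω).gridElem (c.r_zeroTerm R ω)] at this
    · rintro h (φ | i) hθ
      · rw [Sum.elim_inl, c.r_zeroTerm]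
        exact ht
      · rw [Sum.elim_inr, (c.isHom_r R ω).absDiff (fun φ => R.mem _ _),
          (c.isHom_r R ω).gridElem (c.r_zeroTerm R ω)]
        exact h i hθ
  have hψ : ∀ (c : Conf L I m k) (R : Rep c.N) (ω : R.Ω) j,
      R.r ((CPL.sup (.var (Sum.inl (χ j).inf)) (ξ j)).eval c.vars) ω
        = max (R.r ((χ j).inf.bracket c.N c.a c.b) ω) (R.r ((ξ j).eval c.vars) ω) := by
    intro c R ω j
    rw [(FreeCPL.isHom_eval c.vars).sup, R.r_sup]
    rfl
  refine ⟨fun j => CPL.sup (.var (Sum.inl (χ j).inf)) (ξ j), fun c x R ω j t ht h => ?_,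
    fun c R s hs ρ hρ => ?_⟩
  · rw [hψ]
    refine max_le (((R.bracket_inf_spec c.isT0R c.a (χ j) c.b).1 x ω).trans ?_) ?_
    · exact (hχ c x R ω j t ht).mpr fun φ hφ => h ⟨_, hφ⟩
    · exact (hξ c R ω j t ht).mpr fun i hi => h ⟨_, hi⟩
  · choose w hw using fun j => (R.bracket_inf_spec c.isT0R c.a (χ j) c.b).2 ρ hρ
    obtain ⟨z, hz⟩ := R.exists_glue_finite c.isT0R w hs
    refine ⟨z, ?_⟩
    filter_upwards [hz] with ω hω θ
    rw [hψ]
    obtain ⟨φ | i, hθ⟩ := θ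
    · have h1 := (hχ c (w (s ω)) R ω (s ω) _ (R.mem _ _).1).mp le_rfl φ hθ
      have h2 := hw (s ω) ω
      have h3 := R.r_bracket_local c.isT0R c.a φ c.b ω hω
      change |R.r (φ.bracket c.N c.a (Fin.snoc c.b z)) ω - _| ≤ _
      rw [h3]
      exact (h1.trans h2).trans (add_le_add (le_max_left _ _) le_rfl)
    · have h1 := (hξ c R ω (s ω) _ (R.mem _ _).1).mp le_rfl i hθ
      exact h1.trans ((le_max_right _ _).trans (le_add_of_nonneg_right hρ.le))

/-- The new random variable may be any measurable function, so it can follow the grid exactly; only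
the old variables constrain the grid vector. -/
theorem determined_iInf_aux {F : Conf L I m (k + 1) → ℝ} (hF0 : ∀ c, 0 ≤ F c)
    (hF : Determined Conf.N vars F) :
    Determined Conf.N vars fun c : Conf L I m k => ⨅ Y, F (c.snocAux Y) := by
  have hne : ∀ c : Conf L I m k, Nonempty c.N.Aux := fun c => ⟨c.N.zero⟩
  refine Determined.iInf (fun c : Conf L I m k => c.isT0R.toIsARV)
    (fun c (Y : c.N.Aux) => (c.snocAux Y).vars) (fun c Y => F (c.snocAux Y)) (fun c x => hF0 _)
    (hF.comp fun p : Σ c : Conf L I m k, c.N.Aux => p.1.snocAux p.2) fun V l => ?_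
  -- The old name of a variable, or `none` for the newly added one.
  let old : BFormula L I m ⊕ Fin (k + 1) → Option (FreeCPL (BFormula L I m ⊕ Fin k)) :=
    Sum.elim (fun φ => some (.var (Sum.inl φ)))
      (Fin.lastCases none fun i => some (.var (Sum.inr i)))
  have hold : ∀ (c : Conf L I m k) (Y : c.N.Aux) θ τ, old θ = some τ →
      (c.snocAux Y).vars θ = τ.eval c.vars := by
    rintro c Y (φ | i) τ h
    · obtain rfl : FreeCPL.var (Sum.inl φ) = τ := Option.some.inj h
      rfl
    · induction i using Fin.lastCases with
      | last => simp [old] at h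
      | cast i =>
        simp only [old, Sum.elim_inr, Fin.lastCases_castSucc, Option.some.injEq] at h
        subst h
        exact Fin.snoc_castSucc (α := fun _ => c.N.Aux) Y c.X i
  have hnew : ∀ θ, old θ = none → θ = Sum.inr (Fin.last k) := by
    rintro (φ | i) h
    · simp [old] at h
    · induction i using Fin.lastCases with
      | last => rfl
      | cast i => simp [old] at h
  let ξ : (V → Fin (2 ^ l + 1)) → FreeCPL (BFormula L I m ⊕ Fin k) := fun j =>
    CPL.bigSup V zeroTerm fun θ =>
      (old θ).elim zeroTerm fun τ => CPL.absDiff τ (gridElem V l j zeroTerm θ)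
  have hξ : ∀ (c : Conf L I m k) (R : Rep c.N) (ω : R.Ω) j (t : ℝ), 0 ≤ t →
      (R.r ((ξ j).eval c.vars) ω ≤ t ↔ ∀ θ ∈ V, ∀ τ, old θ = some τ →
        |R.r (τ.eval c.vars) ω - gridVal V l j θ| ≤ t) := by
    intro c R ω j t ht
    rw [(c.isHom_r R ω).bigSup_le_iff (fun φ => R.mem _ _) V (c.r_zeroTerm R ω) _ ht]
    refine forall₂_congr fun θ hθ => ?_
    rcases hτ : old θ with _ | τ
    · simpa [c.r_zeroTerm] using ht
    · simp only [Option.elim_some, Option.some.injEq, forall_eq']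
      rw [(c.isHom_r R ω).absDiff (fun φ => R.mem _ _),
        (c.isHom_r R ω).gridElem (c.r_zeroTerm R ω)]
  refine ⟨ξ, fun c Y R ω j t ht h => ?_, fun c R s hs ρ hρ => ?_⟩
  · refine (hξ c R ω j t ht).mpr fun θ hθ τ hτ => ?_
    rw [← hold c Y θ τ hτ]
    exact h ⟨θ, hθ⟩
  · have hm : Measurable fun ω => gridVal V l (s ω) (Sum.inr (Fin.last k)) :=
      (measurable_of_countable fun j => gridVal V l j (Sum.inr (Fin.last k))).comp hs
    obtain ⟨Y, hY⟩ := R.surj _ hm fun ω => gridVal_mem V l _ _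
    refine ⟨Y, ?_⟩
    filter_upwards [hY] with ω hω θ
    rcases hτ : old θ with _ | τ
    · have h1 : (c.snocAux Y).vars θ = Y := by
        rw [hnew θ hτ]
        exact Fin.snoc_last (α := fun _ => c.N.Aux) Y c.X
      have h2 : R.r ((c.snocAux Y).vars θ) ω = gridVal V l (s ω) θ := by
        rw [hnew θ hτ] at h1 ⊢
        rw [h1, hω]
      rw [h2, sub_self, abs_zero]
      exact add_nonneg (R.mem _ _).1 hρ.le
    · have h1 := (hξ c R ω (s ω) _ (R.mem _ _).1).mp le_rfl θ θ.2 τ hτ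
      rw [← hold c Y θ τ hτ] at h1
      exact h1.trans (le_add_of_nonneg_right hρ.le)

/-- The values of formulae are determined by the joint law of the `⟦φ⟧`. -/
theorem determined_value {m k : ℕ} (Φ : RBFormula L I m k) :
    Determined Conf.N vars fun c => Φ.value c.N c.a c.b c.X := by
  induction Φ with
  | distMain s t =>
    convert Determined.expectation (N := Conf.N) (e := vars) (.var (Sum.inl (.dist s t)))
      using 2 with c
    exact c.isT0R.r2 _ _
  | distAux s t =>
    convert (Determined.expectation (N := Conf.N) (e := vars)
      (.tsub (ofAuxTerm s) (ofAuxTerm t))).add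
      (Determined.expectation (.tsub (ofAuxTerm t) (ofAuxTerm s))) using 2 with c
    simp only [FreeCPL.eval, eval_ofAuxTerm, RBFormula.value]
    exact c.isT0R.rv3 _ _
  | neg φ ih => exact ih.neg
  | half φ ih => exact ih.half
  | tsub φ ψ ih ih' => exact ih.tsub ih'
  | infMain φ ih => exact determined_iInf_main (fun c => (φ.value_mem _ _ _ _).1) ih
  | supMain φ ih =>
    simp only [RBFormula.value_supMain]
    exact (determined_iInf_main (fun c => (φ.neg.value_mem _ _ _ _).1) ih.neg).neg
  | infAux φ ih => exact determined_iInf_aux (fun c => (φ.value_mem _ _ _ _).1) ih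
  | supAux φ ih =>
    simp only [RBFormula.value_supAux]
    exact (determined_iInf_aux (fun c => (φ.neg.value_mem _ _ _ _).1) ih.neg).neg

end Conf

/-- A quantity determined by finitely many expectations is nearly a continuous function of them, and
continuous functions on a cube are approximated by the connectives. Adding `τ₀` keeps the list of
expectations non-empty. -/
theorem Determined.exists_term {𝒞 β : Type*} {L : Signature.{u}} {N : 𝒞 → RStr L}
    {e : ∀ c, β → (N c).Aux} {F : 𝒞 → ℝ} (hF : ∀ c, F c ∈ Set.Icc (0 : ℝ) 1)
    (h : Determined N e F) (τ₀ : FreeCPL β) {ε : ℝ} (hε : 0 < ε) :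
    ∃ σ : FreeCPL (FreeCPL β), ∀ c, |F c - σ.eval fun τ => (N c).E (τ.eval (e c))| ≤ ε := by
  classical
  rcases isEmpty_or_nonempty 𝒞 with h𝒞 | h𝒞
  · exact ⟨.var τ₀, fun c => isEmptyElim c⟩
  obtain ⟨Δ, δ, hδ, hΔ⟩ := h (ε / 2) (half_pos hε)
  let J := (insert τ₀ Δ : Finset (FreeCPL β))
  have : Nonempty J := ⟨⟨τ₀, Finset.mem_insert_self _ _⟩⟩
  let z : 𝒞 → J → Set.Icc (0 : ℝ) 1 := fun c τ =>
    ⟨(N c).E (τ.1.eval (e c)), RStr.IsRV.E_nonneg _, RStr.IsRV.E_le_one _⟩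
  -- A McShane extension with Lipschitz constant `1 / δ`: structures at distance more than `δ`
  -- contribute at least `1`, and nearer ones at least `F c - ε / 2`.
  let G : (J → Set.Icc (0 : ℝ) 1) → ℝ := fun y => ⨅ c, min (F c + dist y (z c) / δ) 1
  have hmem : ∀ y c, min (F c + dist y (z c) / δ) 1 ∈ Set.Icc (0 : ℝ) 1 := fun y c =>
    ⟨le_min (add_nonneg (hF c).1 (by positivity)) zero_le_one, min_le_right _ _⟩
  have hG : ∀ y, G y ∈ Set.Icc (0 : ℝ) 1 := fun y => iInf_mem_Icc (hmem y)
  have hGle : ∀ y y', G y ≤ G y' + dist y y' / δ := fun y y' => by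
    refine iInf_le_iInf_add (bddBelow_range_of_mem (hmem y)) fun c => ?_
    have h1 : dist y (z c) / δ ≤ dist y y' / δ + dist y' (z c) / δ := by
      rw [← add_div]
      gcongr
      exact dist_triangle _ _ _
    have h2 : 0 ≤ dist y y' / δ := by positivity
    grind
  have hGc : Continuous G := by
    refine (LipschitzWith.of_le_add_mul (Real.toNNReal (1 / δ)) fun y y' => ?_).continuous
    rw [Real.coe_toNNReal _ (by positivity)]
    have := hGle y y'
    rwa [div_eq_inv_mul, ← one_div] at this
  have hGz : ∀ c, |F c - G (z c)| ≤ ε / 2 := by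
    intro c
    have h1 : G (z c) ≤ F c := by
      refine (ciInf_le (bddBelow_range_of_mem (hmem _)) c).trans ?_
      simp
    have h2 : F c - ε / 2 ≤ G (z c) := by
      refine le_ciInf fun c' => le_min ?_ (by linarith [(hF c).2])
      rcases le_or_gt (dist (z c) (z c')) δ with hd | hd
      · have h3 : F c ≤ F c' + ε / 2 := hΔ c' c fun τ hτ => by
          have h4 := (dist_le_pi_dist (z c') (z c) ⟨τ, Finset.mem_insert_of_mem hτ⟩).trans
            ((dist_comm _ _).le.trans hd)
          exact h4
        have h5 : 0 ≤ dist (z c) (z c') / δ := by positivity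
        linarith
      · have h3 : 1 ≤ dist (z c) (z c') / δ := (one_le_div hδ).mpr hd.le
        linarith [(hF c).2, (hF c').1]
    rw [abs_le]
    constructor <;> linarith
  obtain ⟨σ, hσ⟩ := exists_term_abs_sub_le G hGc hG (half_pos hε)
  refine ⟨σ.eval fun τ => .var τ.1, fun c => ?_⟩
  rw [FreeCPL.map_eval (FreeCPL.isHom_eval _)]
  have h1 := hGz c
  have h2 : |G (z c) - σ.eval fun τ => (N c).E (τ.1.eval (e c))| ≤ ε / 2 := hσ (z c)
  exact (abs_sub_le _ _ _).trans ((add_le_add h1 h2).trans (by linarith))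

/-- Quantifier elimination in the main sort. -/
theorem RBFormula.exists_term_abs_sub_le {L : Signature.{u}} {I : Type v} (Φ : RFormula L I)
    {ε : ℝ} (hε : 0 < ε) : ∃ τ : FreeCPL (Formula L I), ∀ N : RStr L, N.IsT0R →
      ∀ a : I → N.Main, |N.tp a Φ - τ.eval (fun φ => N.E (N.br a φ))| ≤ ε := by
  obtain ⟨σ, hσ⟩ := (Conf.determined_value (I := I) Φ).exists_term
    (fun c : Conf L I 0 0 => Φ.value_mem c.N c.a c.b c.X) Conf.zeroTerm hε
  refine ⟨σ.eval fun τ => .var (τ.eval (Sum.elim id Fin.elim0)), fun N hN a => ?_⟩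
  rw [FreeCPL.map_eval (FreeCPL.isHom_eval _)]
  have h1 := hσ ⟨N, hN, a, Fin.elim0, Fin.elim0⟩
  have h2 : ∀ τ : FreeCPL (BFormula L I 0 ⊕ Fin 0),
      N.br a (τ.eval (Sum.elim id Fin.elim0)) =
        τ.eval (Conf.vars ⟨N, hN, a, Fin.elim0, Fin.elim0⟩) := fun τ => by
    rw [RStr.br, FreeCPL.map_eval (BFormula.isHom_bracket N a Fin.elim0)]
    congr 1
    funext x
    rcases x with φ | i
    · rfl
    · exact i.elim0
  simp only [FreeCPL.eval, h2]
  exact h1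

end

end ContLogic

namespace ContLogic

open Filter Topology

noncomputable section

/-! ### Finitely additive means -/

/-- Bounded functions. -/
def BddFun {Ω : Type*} (f : Ω → ℝ) : Prop := ∃ C, ∀ ω, |f ω| ≤ C

namespace BddFun

variable {Ω : Type*} {f g : Ω → ℝ}

theorem of_mem (hf : ∀ ω, f ω ∈ Set.Icc (0 : ℝ) 1) : BddFun f :=
  ⟨1, fun ω => abs_le.mpr ⟨by linarith [(hf ω).1], (hf ω).2⟩⟩

theorem const (c : ℝ) : BddFun fun _ : Ω => c := ⟨|c|, fun _ => le_rfl⟩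

theorem add (hf : BddFun f) (hg : BddFun g) : BddFun fun ω => f ω + g ω := by
  obtain ⟨C, hC⟩ := hf
  obtain ⟨D, hD⟩ := hg
  exact ⟨C + D, fun ω => (abs_add_le _ _).trans (add_le_add (hC ω) (hD ω))⟩

theorem const_mul (c : ℝ) (hf : BddFun f) : BddFun fun ω => c * f ω := by
  obtain ⟨C, hC⟩ := hf
  exact ⟨|c| * C, fun ω => by
    rw [abs_mul]
    exact mul_le_mul_of_nonneg_left (hC ω) (abs_nonneg _)⟩

theorem sub (hf : BddFun f) (hg : BddFun g) : BddFun fun ω => f ω - g ω := by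
  have := hf.add (hg.const_mul (-1))
  simpa [sub_eq_add_neg] using this

theorem comp (hf : BddFun f) {Ω' : Type*} (h : Ω' → Ω) : BddFun fun ω => f (h ω) := by
  obtain ⟨C, hC⟩ := hf
  exact ⟨C, fun ω => hC _⟩

theorem integrable [MeasurableSpace Ω] {μ : Measure Ω} [IsFiniteMeasure μ] (hf : BddFun f)
    (hm : Measurable f) : Integrable f μ := by
  obtain ⟨C, hC⟩ := hf
  exact Integrable.of_bound hm.aestronglyMeasurable C
    (Eventually.of_forall fun ω => by simpa using hC ω)

end BddFun

/-- A finitely additive probability on all subsets of `Ω`, as a mean on bounded functions. -/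
structure Mean (Ω : Type*) where
  E : (Ω → ℝ) → ℝ
  add : ∀ {f g : Ω → ℝ}, BddFun f → BddFun g → E (fun ω => f ω + g ω) = E f + E g
  const_mul : ∀ (c : ℝ) {f : Ω → ℝ}, BddFun f → E (fun ω => c * f ω) = c * E f
  nonneg : ∀ {f : Ω → ℝ}, BddFun f → (∀ ω, 0 ≤ f ω) → 0 ≤ E f
  one : E (fun _ => 1) = 1

namespace Mean

variable {Ω : Type*} (m : Mean Ω) {f g : Ω → ℝ}

theorem sub (hf : BddFun f) (hg : BddFun g) : m.E (fun ω => f ω - g ω) = m.E f - m.E g := by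
  have := m.add hf (hg.const_mul (-1))
  rw [m.const_mul (-1) hg] at this
  simpa [sub_eq_add_neg] using this

theorem mono (hf : BddFun f) (hg : BddFun g) (h : ∀ ω, f ω ≤ g ω) : m.E f ≤ m.E g := by
  have := m.nonneg (hg.sub hf) fun ω => sub_nonneg.mpr (h ω)
  rw [m.sub hg hf] at this
  linarith

theorem const (c : ℝ) : m.E (fun _ => c) = c := by
  have := m.const_mul c (BddFun.const (Ω := Ω) 1)
  rw [m.one] at this
  simpa using this

theorem mem (hf : ∀ ω, f ω ∈ Set.Icc (0 : ℝ) 1) : m.E f ∈ Set.Icc (0 : ℝ) 1 := by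
  refine ⟨m.nonneg (BddFun.of_mem hf) fun ω => (hf ω).1, ?_⟩
  have := m.mono (BddFun.of_mem hf) (BddFun.const 1) fun ω => (hf ω).2
  rwa [m.one] at this

theorem abs_le {C : ℝ} (hf : ∀ ω, |f ω| ≤ C) : |m.E f| ≤ C := by
  have h1 := m.mono ⟨C, hf⟩ (BddFun.const C) fun ω => (_root_.abs_le.mp (hf ω)).2
  have h2 := m.mono (BddFun.const (-C)) ⟨C, hf⟩ fun ω => (_root_.abs_le.mp (hf ω)).1
  rw [m.const] at h1 h2
  exact _root_.abs_le.mpr ⟨h2, h1⟩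

end Mean

/-- Probability measures extend to means on all bounded functions. -/
theorem exists_mean {K : Type*} [MeasurableSpace K] (μ : Measure K) [IsProbabilityMeasure μ] :
    ∃ m : Mean K, ∀ f, Measurable f → BddFun f → m.E f = ∫ k, f k ∂μ := by
  classical
  let B : Submodule ℝ (K → ℝ) :=
    { carrier := {f | BddFun f}
      add_mem' := fun hf hg => hf.add hg
      zero_mem' := BddFun.const 0
      smul_mem' := fun c _ hf => hf.const_mul c }
  let D : Submodule ℝ B :=
    { carrier := {f | Measurable f.1}
      add_mem' := fun hf hg => hf.add hg
      zero_mem' := measurable_const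
      smul_mem' := fun c _ hf => hf.const_mul c }
  let I : B →ₗ.[ℝ] ℝ :=
    ⟨D, { toFun := fun f => ∫ k, f.1.1 k ∂μ
          map_add' := fun f g => integral_add (f.1.2.integrable f.2) (g.1.2.integrable g.2)
          map_smul' := fun c f => integral_const_mul c _ }⟩
  let s : PointedCone ℝ B :=
    { carrier := {g | ∀ k, 0 ≤ g.1 k}
      add_mem' := fun {a b} ha hb k => add_nonneg (ha k) (hb k)
      zero_mem' := fun k => le_rfl
      smul_mem' := fun c g hg k => mul_nonneg c.2 (hg k) }
  -- Integration is a positive functional on the measurable bounded functions; these contain the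
  -- constants, which dominate all bounded functions.
  obtain ⟨g, hgI, hgs⟩ := riesz_extension s I (fun f hf => integral_nonneg hf) fun f => by
    obtain ⟨C, hC⟩ := f.2
    exact ⟨⟨⟨fun _ => C, BddFun.const C⟩, measurable_const⟩, fun k => by
      change 0 ≤ C + f.1 k
      linarith [(_root_.abs_le.mp (hC k)).1]⟩
  have hE : ∀ f (hf : BddFun f), (if h : BddFun f then g ⟨f, h⟩ else 0) = g ⟨f, hf⟩ :=
    fun f hf => dif_pos hf
  have hI : ∀ f (hm : Measurable f) (hf : BddFun f), g ⟨f, hf⟩ = ∫ k, f k ∂μ := fun f hm hf =>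
    hgI ⟨⟨f, hf⟩, hm⟩
  refine ⟨⟨fun f => if h : BddFun f then g ⟨f, h⟩ else 0, fun {f f'} hf hf' => ?_,
    fun c {f} hf => ?_, fun {f} hf h => ?_, ?_⟩, fun f hm hf => ?_⟩
  · rw [hE _ hf, hE _ hf', hE _ (hf.add hf'), ← map_add]
    rfl
  · rw [hE _ hf, hE _ (hf.const_mul c), ← smul_eq_mul, ← map_smul]
    rfl
  · rw [hE _ hf]
    exact hgs _ h
  · rw [hE _ (BddFun.const 1), hI _ measurable_const]
    simp
  · exact (hE _ hf).trans (hI _ hm hf)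

/-- A mean for which functions can be halved by events, and for which random choices can be
made simultaneously with countably many requirements. -/
structure RichMean (Ω : Type*) extends Mean Ω where
  half : ∀ f : Ω → ℝ, (∀ ω, f ω ∈ Set.Icc (0 : ℝ) 1) → ∃ B : Set Ω, E (B.indicator f) = E f / 2
  select : ∀ d : ℕ → ℕ → Ω → ℝ, (∀ i j ω, d i j ω ∈ Set.Icc (0 : ℝ) 1) → ∀ e : ℕ → ℝ,
    (∀ i j, i ≤ j → E (d i j) < e i) → ∃ s : Ω → ℕ, ∀ i, E (fun ω => d i (s ω) ω) ≤ e i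

/-- Greedy choice: the next term is included exactly when the current discrepancy is not positive,
and it moves the discrepancy by at most `1/2` towards the other sign. -/
theorem exists_subset_sum_half {a : ℕ → ℝ} (ha : ∀ k, a k ∈ Set.Icc (0 : ℝ) 1) (n : ℕ) :
    ∃ S ⊆ Finset.range n,
      |∑ k ∈ S, a k - (∑ k ∈ Finset.range n, a k) / 2| ≤ 1 / 2 := by
  classical
  induction n with
  | zero => exact ⟨∅, subset_rfl, by simp⟩
  | succ n ih =>
    obtain ⟨S, hS, h⟩ := ih
    have hn : n ∉ S := fun hn => by simpa using hS hn
    have han := ha n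
    rw [Set.mem_Icc] at han
    rw [abs_le] at h
    rw [Finset.sum_range_succ]
    rcases le_total (∑ k ∈ S, a k - (∑ k ∈ Finset.range n, a k) / 2) 0 with h0 | h0
    · refine ⟨insert n S, ?_, ?_⟩
      · rw [Finset.range_add_one]
        exact Finset.insert_subset_insert _ hS
      · rw [Finset.sum_insert hn, abs_le]
        constructor <;> linarith
    · refine ⟨S, hS.trans (Finset.range_subset_range.mpr n.le_succ), ?_⟩
      rw [abs_le]
      constructor <;> linarith

/-- Every mean lifts to a rich one. -/
theorem Mean.exists_rich {K : Type*} (m : Mean K) :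
    ∃ m' : RichMean (ℕ × ℕ × K), ∀ f, BddFun f → m'.E (fun ω => f ω.2.2) = m.E f := by
  classical
  obtain ⟨U, hU⟩ : ∃ U : Ultrafilter ℕ, (U : Filter ℕ) ≤ atTop :=
    ⟨hyperfilter ℕ, Nat.hyperfilter_le_atTop⟩
  -- At stage `n`, the mean over `n + 1` equally weighted copies of `K`, whose ultralimit is the new
  -- mean. The copies make halving possible; the stage, being visible in `Ω`, lets events and
  -- choices vary with `n` as in an ultraproduct.
  let A : ℕ → (ℕ × ℕ × K → ℝ) → ℝ := fun n f =>
    (∑ k ∈ Finset.range (n + 1), m.E fun q => f (n, k, q)) / (n + 1)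
  have hA : ∀ {f : ℕ × ℕ × K → ℝ} {C : ℝ}, (∀ ω, |f ω| ≤ C) → ∀ n, |A n f| ≤ C := by
    intro f C hf n
    simp only [A]
    rw [abs_div, abs_of_nonneg (show (0 : ℝ) ≤ n + 1 by positivity), div_le_iff₀ (by positivity)]
    refine (Finset.abs_sum_le_sum_abs _ _).trans ?_
    refine (Finset.sum_le_card_nsmul _ _ C fun k _ => m.abs_le fun q => hf _).trans ?_
    rw [Finset.card_range, nsmul_eq_mul, mul_comm]
    push_cast
    exact le_rfl
  have hlim : ∀ {f : ℕ × ℕ × K → ℝ}, BddFun f →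
      Tendsto (fun n => A n f) U (𝓝 (ulim U fun n => A n f)) := fun {f} hf =>
    tendsto_ulim U (hA hf.choose_spec)
  have hAadd : ∀ {f g : ℕ × ℕ × K → ℝ}, BddFun f → BddFun g → ∀ n,
      A n (fun ω => f ω + g ω) = A n f + A n g := by
    intro f g hf hg n
    simp only [A]
    rw [← add_div, ← Finset.sum_add_distrib]
    congr 1
    exact Finset.sum_congr rfl fun k _ => m.add (hf.comp _) (hg.comp _)
  have hAmul : ∀ (c : ℝ) {f : ℕ × ℕ × K → ℝ}, BddFun f → ∀ n,
      A n (fun ω => c * f ω) = c * A n f := by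
    intro c f hf n
    simp only [A]
    rw [← mul_div_assoc, Finset.mul_sum]
    congr 1
    exact Finset.sum_congr rfl fun k _ => m.const_mul c (hf.comp _)
  have hAconst : ∀ {f : K → ℝ}, BddFun f → ∀ n, A n (fun ω => f ω.2.2) = m.E f := by
    intro f hf n
    simp only [A, Finset.sum_const, Finset.card_range, nsmul_eq_mul]
    push_cast
    field_simp
  have hAnn : ∀ {f : ℕ × ℕ × K → ℝ}, BddFun f → (∀ ω, 0 ≤ f ω) → ∀ n, 0 ≤ A n f := by
    intro f hf h n
    exact div_nonneg (Finset.sum_nonneg fun k _ => m.nonneg (hf.comp _) fun q => h _)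
      (by positivity)
  let M : Mean (ℕ × ℕ × K) :=
    { E := fun f => ulim U fun n => A n f
      add := fun {f g} hf hg => ulim_eq U (by
        simp only [hAadd hf hg]
        exact (hlim hf).add (hlim hg))
      const_mul := fun c {f} hf => ulim_eq U (by
        simp only [hAmul c hf]
        exact (hlim hf).const_mul c)
      nonneg := fun {f} hf h => ge_of_tendsto (hlim hf) (Eventually.of_forall (hAnn hf h))
      one := ulim_eq U (by
        simp only [hAconst (BddFun.const 1), m.one]
        exact tendsto_const_nhds) }
  refine ⟨{ M with half := fun f hf => ?_, select := fun d hd e he => ?_ }, fun f hf => ?_⟩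
  · have ha : ∀ n k, m.E (fun q => f (n, k, q)) ∈ Set.Icc (0 : ℝ) 1 := fun n k =>
      m.mem fun q => hf _
    -- At stage `n` some of the `n + 1` copies carry half of the total up to `1/2`; after averaging,
    -- this error tends to `0`.
    choose S hS hSa using fun n => exists_subset_sum_half (ha n) (n + 1)
    refine ⟨{ω | ω.2.1 ∈ S ω.1}, ulim_eq U ?_⟩
    have hind : ∀ n k, m.E (fun q => Set.indicator {ω : ℕ × ℕ × K | ω.2.1 ∈ S ω.1} f (n, k, q))
        = if k ∈ S n then m.E (fun q => f (n, k, q)) else 0 := by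
      intro n k
      by_cases hk : k ∈ S n
      · simp [Set.indicator, hk]
      · simp [Set.indicator, hk, m.const]
    have h1 : ∀ n, |A n (Set.indicator {ω : ℕ × ℕ × K | ω.2.1 ∈ S ω.1} f) - A n f / 2|
        ≤ 1 / ((n : ℝ) + 1) := by
      intro n
      have hn : (0 : ℝ) < n + 1 := by positivity
      simp only [A, hind]
      rw [Finset.sum_ite_mem, Finset.inter_eq_right.mpr (hS n), div_right_comm, ← sub_div, abs_div,
        abs_of_pos hn]
      gcongr
      exact (hSa n).trans (by norm_num)
    have h2 : Tendsto (fun n => A n (Set.indicator {ω : ℕ × ℕ × K | ω.2.1 ∈ S ω.1} f) - A n f / 2)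
        U (𝓝 0) := by
      refine squeeze_zero_norm (fun n => h1 n) ?_
      exact tendsto_one_div_add_atTop_nhds_zero_nat.mono_left hU
    have h3 := h2.add ((hlim (BddFun.of_mem hf)).div_const 2)
    simpa using h3
  · have hb : ∀ i j, BddFun (d i j) := fun i j => BddFun.of_mem (hd i j)
    let P : ℕ → ℕ → Prop := fun n j => ∀ i ≤ j, A n (d i j) ≤ e i
    -- Diagonal choice: the largest `j ≤ n` for which the first requirements `i ≤ j` hold at stage
    -- `n`. For fixed `i`, almost every stage satisfies `P n i`, so the choice is at least `i` and
    -- meets requirement `i`.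
    obtain ⟨s, hs⟩ : ∃ s : ℕ → ℕ, ∀ n i, i ≤ n → P n i → i ≤ s n ∧ P n (s n) :=
      ⟨fun n => Nat.findGreatest (P n) n, fun n i hi hP =>
        ⟨Nat.le_findGreatest hi hP, Nat.findGreatest_spec (P := P n) hi hP⟩⟩
    refine ⟨fun ω => s ω.1, fun i => ?_⟩
    have hev : ∀ᶠ n in (U : Filter ℕ), P n i := by
      have : ∀ i' ∈ Finset.range (i + 1), ∀ᶠ n in (U : Filter ℕ), A n (d i' i) ≤ e i' :=
        fun i' hi' => ((hlim (hb i' i)).eventually_lt_const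
          (he i' i (Nat.lt_succ_iff.mp (Finset.mem_range.mp hi')))).mono fun n hn => hn.le
      filter_upwards [(Finset.eventually_all _).mpr this] with n hn i' hi'
      exact hn i' (Finset.mem_range.mpr (Nat.lt_succ_of_le hi'))
    have hbs : BddFun fun ω : ℕ × ℕ × K => d i (s ω.1) ω := BddFun.of_mem fun ω => hd _ _ ω
    have h1 : ∀ᶠ n in (U : Filter ℕ), A n (fun ω => d i (s ω.1) ω) ≤ e i := by
      filter_upwards [hev, hU (eventually_ge_atTop i)] with n hn hin
      obtain ⟨h1, h2⟩ := hs n i hin hn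
      exact h2 i h1
    have h2 := hlim hbs
    exact le_of_tendsto h2 h1
  · refine ulim_eq U ?_
    simp only [hAconst hf]
    exact tendsto_const_nhds

end

end ContLogic

namespace ContLogic

open Filter Topology

noncomputable section

/-! ### Spaces of random elements -/

section Fam

theorem dist_mem_of_le_one {Ω : Type u} {M : Ω → Type v} [∀ ω, MetricSpace (M ω)]
    (hM : ∀ ω (x y : M ω), dist x y ≤ 1) (x y : ∀ ω, M ω) (ω : Ω) :
    dist (x ω) (y ω) ∈ Set.Icc (0 : ℝ) 1 := ⟨dist_nonneg, hM ω _ _⟩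

/-- Families of points in spaces of diameter at most `1`, with the distance in mean. -/
def Fam {Ω : Type u} (_ : RichMean Ω) (M : Ω → Type v) [∀ ω, MetricSpace (M ω)]
    (_ : ∀ ω (x y : M ω), dist x y ≤ 1) : Type (max u v) := ∀ ω, M ω

variable {Ω : Type u} (m : RichMean Ω) {M : Ω → Type v} [∀ ω, MetricSpace (M ω)]
  (hM : ∀ ω (x y : M ω), dist x y ≤ 1)

instance : PseudoMetricSpace (Fam m M hM) where
  dist x y := m.E fun ω => dist (x ω) (y ω)
  dist_self x := by simpa using m.const 0
  dist_comm x y := by simp only [dist_comm]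
  dist_triangle x y z := by
    have h := fun x y : ∀ ω, M ω => BddFun.of_mem (dist_mem_of_le_one hM x y)
    rw [← m.add (h x y) (h y z)]
    exact m.mono (h x z) ((h x y).add (h y z)) fun ω => dist_triangle _ _ _

/-- A finitely additive mean gives no convergence theorem. Instead, `select` picks an index for each
`ω` so that the resulting family is within `(1/2) ^ n` of the term `n`, for all `n` at once. -/
instance : CompleteSpace (Fam m M hM) := by
  refine Metric.complete_of_convergent_controlled_sequences (fun n => (1 / 2) ^ n)
    (fun n => by positivity) fun x hx => ?_
  obtain ⟨s, hs⟩ := m.select (fun i j ω => dist (x i ω) (x j ω))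
    (fun i j => dist_mem_of_le_one hM _ _) (fun n => (1 / 2) ^ n)
    fun i j hij => hx i i j le_rfl hij
  refine ⟨fun ω => x (s ω) ω, tendsto_iff_dist_tendsto_zero.mpr ?_⟩
  exact squeeze_zero (fun n => dist_nonneg) hs
    (tendsto_pow_atTop_nhds_zero_of_lt_one (by norm_num) (by norm_num))

variable (M) in
/-- The complete metric space of random elements. -/
abbrev RandomElement : Type (max u v) := SeparationQuotient (Fam m M hM)

namespace RandomElement

/-- The random element given by a family. -/
def mk (x : ∀ ω, M ω) : RandomElement m M hM :=
  SeparationQuotient.mk (X := Fam m M hM) x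

theorem mk_surjective (X : RandomElement m M hM) : ∃ x, mk m hM x = X :=
  SeparationQuotient.surjective_mk (X := Fam m M hM) X

variable {m hM}

/-- A representative. -/
def rep (X : RandomElement m M hM) : ∀ ω, M ω := (mk_surjective m hM X).choose

@[simp]
theorem mk_rep (X : RandomElement m M hM) : mk m hM X.rep = X := (mk_surjective m hM X).choose_spec

theorem dist_mk (x y : ∀ ω, M ω) : dist (mk m hM x) (mk m hM y) = m.E fun ω => dist (x ω) (y ω) :=
  SeparationQuotient.dist_mk (α := Fam m M hM) x y

theorem dist_le_one (X Y : RandomElement m M hM) : dist X Y ≤ 1 := by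
  rw [← mk_rep X, ← mk_rep Y, dist_mk]
  exact (m.mem (dist_mem_of_le_one hM _ _)).2

/-- A uniformly continuous operation, coordinate by coordinate, is compatible with equality of
random elements. -/
theorem mk_comp_rep {M' : Ω → Type w} [∀ ω, MetricSpace (M' ω)]
    {hM' : ∀ ω (x y : M' ω), dist x y ≤ 1} {n : ℕ} (g : ∀ ω, (Fin n → M ω) → M' ω)
    (hg : ∀ ε > 0, ∀ i, ∃ δ > 0, ∀ (x : Fin n → ∀ ω, M ω) (y : ∀ ω, M ω),
      m.E (fun ω => dist (x i ω) (y ω)) < δ →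
        m.E (fun ω => dist (g ω fun j => x j ω) (g ω (Function.update (fun j => x j ω) i (y ω)))) ≤ ε)
    (x : Fin n → ∀ ω, M ω) :
    mk m hM' (fun ω => g ω fun j => (mk m hM (x j)).rep ω) = mk m hM' fun ω => g ω fun j => x j ω := by
  let G : (Fin n → Fam m M hM) → Fam m M' hM' := fun x ω => g ω fun j => x j ω
  have hG : UniformContinuous G := by
    refine uniformContinuous_of_coordinates _ fun ε hε i => ?_
    obtain ⟨δ, hδ, h⟩ := hg ε hε i
    refine ⟨δ, hδ, fun x y hxy => ?_⟩
    have h1 := h x y hxy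
    have h2 : ∀ ω, (fun j => (Function.update x i y : Fin n → Fam m M hM) j ω)
        = Function.update (fun j => x j ω) i (y ω) := by
      intro ω
      funext j
      by_cases hj : j = i
      · subst hj
        simp
      · simp [hj]
    change m.E (fun ω => dist (g ω fun j => x j ω) (g ω fun j => Function.update x i y j ω)) ≤ ε
    simpa only [h2] using h1
  let r : Fin n → Fam m M hM := fun j => (mk m hM (x j)).rep
  let x' : Fin n → Fam m M hM := x
  have hins : Inseparable r x' :=
    inseparable_pi.mpr fun j => SeparationQuotient.mk_eq_mk.mp
      (show SeparationQuotient.mk (X := Fam m M hM) (mk m hM (x j)).rep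
        = SeparationQuotient.mk (X := Fam m M hM) (x j) from mk_rep (mk m hM (x j)))
  have := hins.map hG.continuous
  exact (SeparationQuotient.mk_eq_mk (X := Fam m M' hM')).mpr this

end RandomElement

end Fam

/-- A Markov-type estimate, and the reason for the modulus `(ε/2) · δ(ε/2)`: pointwise `b ≤ ε/2 + a
/ δ(ε/2)`, since `b ≤ 1` where `a` is large. -/
theorem Mean.le_of_modulus {Ω : Type*} (m : Mean Ω) (δ : Modulus) {a b : Ω → ℝ}
    (ha : ∀ ω, a ω ∈ Set.Icc (0 : ℝ) 1) (hb : ∀ ω, b ω ∈ Set.Icc (0 : ℝ) 1)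
    (h : ∀ (ε : Set.Ioc (0 : ℝ) 1) ω, a ω < δ ε → b ω ≤ ε) (ε : Set.Ioc (0 : ℝ) 1)
    (hE : m.E a < δ.rand ε) : m.E b ≤ ε := by
  set ε' : Set.Ioc (0 : ℝ) 1 :=
    ⟨ε / 2, half_pos ε.2.1, (half_le_self ε.2.1.le).trans ε.2.2⟩ with hε'
  have hE' : m.E a < ε / 2 * δ ε' := hE
  have hδ := (δ ε').2.1
  have h1 : m.E b ≤ m.E fun ω => ε / 2 + (1 / δ ε') * a ω := by
    refine m.mono (BddFun.of_mem hb)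
      ((BddFun.const _).add ((BddFun.of_mem ha).const_mul _)) fun ω => ?_
    have ha0 : 0 ≤ 1 / (δ ε' : ℝ) * a ω := mul_nonneg (by positivity) (ha ω).1
    rcases lt_or_ge (a ω) (δ ε') with hlt | hge
    · have : b ω ≤ ε / 2 := h ε' ω hlt
      linarith
    · have : 1 ≤ 1 / (δ ε' : ℝ) * a ω := by
        rw [one_div, ← div_eq_inv_mul]
        exact (one_le_div hδ).mpr hge
      linarith [(hb ω).2, ε.2.1]
  rw [m.add (BddFun.const _) ((BddFun.of_mem ha).const_mul _), m.const,
    m.const_mul _ (BddFun.of_mem ha)] at h1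
  have h2 : 1 / (δ ε' : ℝ) * m.E a ≤ ε / 2 := by
    rw [one_div, ← div_eq_inv_mul, div_le_iff₀ hδ]
    exact hE'.le
  linarith

/-! ### The model given by a mean and a family of structures -/

instance : CPL (Set.Icc (0 : ℝ) 1) where
  neg x := ⟨CPL.neg (x : ℝ), CPL.neg_mem x.2⟩
  half x := ⟨CPL.half (x : ℝ), CPL.half_mem x.2⟩
  tsub x y := ⟨CPL.tsub (x : ℝ) (y : ℝ), CPL.tsub_mem x.2 y.2⟩

instance {A S : Type*} [CPL S] : CPL (A → S) where
  neg x := fun a => CPL.neg (x a)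
  half x := fun a => CPL.half (x a)
  tsub x y := fun a => CPL.tsub (x a) (y a)

theorem CPL.isHom_coe_apply {A : Type*} (a : A) :
    CPL.IsHom fun x : A → Set.Icc (0 : ℝ) 1 => (x a : ℝ) :=
  ⟨fun _ => rfl, fun _ => rfl, fun _ _ => rfl⟩

theorem dist_Icc_le_one (x y : Set.Icc (0 : ℝ) 1) : dist x y ≤ 1 := by
  rw [Subtype.dist_eq, Real.dist_eq, abs_le]
  constructor <;> linarith [x.2.1, x.2.2, y.2.1, y.2.2]

/-- Random variables. -/
abbrev RandomVar {Ω : Type u} (m : RichMean Ω) : Type u :=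
  RandomElement m (fun _ => Set.Icc (0 : ℝ) 1) fun _ => dist_Icc_le_one

namespace RandomVar

variable {Ω : Type u} (m : RichMean Ω)

/-- The random variable given by a function. -/
abbrev of (x : Ω → Set.Icc (0 : ℝ) 1) : RandomVar m := RandomElement.mk m _ x

instance : CPL (RandomVar m) where
  neg X := of m (CPL.neg X.rep)
  half X := of m (CPL.half X.rep)
  tsub X Y := of m (CPL.tsub X.rep Y.rep)

variable {m}

theorem dist_of (x y : Ω → Set.Icc (0 : ℝ) 1) :
    dist (of m x) (of m y) = m.E fun ω => |(x ω : ℝ) - y ω| := RandomElement.dist_mk x y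

theorem dist_of_le {x y x' y' : Ω → Set.Icc (0 : ℝ) 1}
    (h : ∀ ω, |(x ω : ℝ) - y ω| ≤ |(x' ω : ℝ) - y' ω|) :
    dist (of m x) (of m y) ≤ dist (of m x') (of m y') := by
  rw [dist_of, dist_of]
  have hb := fun x y : Ω → Set.Icc (0 : ℝ) 1 =>
    BddFun.of_mem (dist_mem_of_le_one (fun _ => dist_Icc_le_one) x y)
  exact m.mono (hb _ _) (hb _ _) h

theorem dist_neg_le (X Y : RandomVar m) : dist (CPL.neg X) (CPL.neg Y) ≤ dist X Y := by
  conv_rhs => rw [← X.mk_rep, ← Y.mk_rep]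
  refine dist_of_le fun ω => le_of_eq ?_
  change |(1 - (X.rep ω : ℝ)) - (1 - Y.rep ω)| = _
  rw [sub_sub_sub_cancel_left, abs_sub_comm]

theorem dist_half_le (X Y : RandomVar m) : dist (CPL.half X) (CPL.half Y) ≤ dist X Y := by
  conv_rhs => rw [← X.mk_rep, ← Y.mk_rep]
  refine dist_of_le fun ω => ?_
  change |(X.rep ω : ℝ) / 2 - Y.rep ω / 2| ≤ _
  rw [← sub_div, abs_div, abs_of_pos (two_pos : (0 : ℝ) < 2)]
  linarith [abs_nonneg ((X.rep ω : ℝ) - Y.rep ω)]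

theorem dist_tsub_left_le (X Y Z : RandomVar m) :
    dist (CPL.tsub X Z) (CPL.tsub Y Z) ≤ dist X Y := by
  conv_rhs => rw [← X.mk_rep, ← Y.mk_rep]
  refine dist_of_le fun ω => ?_
  change |max ((X.rep ω : ℝ) - Z.rep ω) 0 - max ((Y.rep ω : ℝ) - Z.rep ω) 0| ≤ _
  refine (abs_max_sub_max_le_abs _ _ _).trans ?_
  rw [sub_sub_sub_cancel_right]

theorem dist_tsub_right_le (X Y Z : RandomVar m) :
    dist (CPL.tsub Z X) (CPL.tsub Z Y) ≤ dist X Y := by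
  conv_rhs => rw [← X.mk_rep, ← Y.mk_rep]
  refine dist_of_le fun ω => ?_
  change |max ((Z.rep ω : ℝ) - X.rep ω) 0 - max ((Z.rep ω : ℝ) - Y.rep ω) 0| ≤ _
  refine (abs_max_sub_max_le_abs _ _ _).trans ?_
  rw [sub_sub_sub_cancel_left, abs_sub_comm]

/-- The operations are defined through chosen representatives. Contractivity, in each argument,
makes the choice irrelevant up to mean distance zero. -/
theorem isHom_of : CPL.IsHom (of m) := by
  have h0 : ∀ x : Ω → Set.Icc (0 : ℝ) 1, m.E (fun ω => |((of m x).rep ω : ℝ) - x ω|) = 0 :=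
    fun x => (dist_of _ _).symm.trans (by
      rw [show of m (of m x).rep = of m x from RandomElement.mk_rep _, dist_self])
  have hb : ∀ x y : Ω → Set.Icc (0 : ℝ) 1, BddFun fun ω => |(x ω : ℝ) - y ω| := fun x y =>
    BddFun.of_mem (dist_mem_of_le_one (fun _ => dist_Icc_le_one) x y)
  refine ⟨fun x => (dist_le_zero.mp ?_).symm, fun x => (dist_le_zero.mp ?_).symm,
    fun x y => (dist_le_zero.mp ?_).symm⟩
  · refine (dist_of_le (x' := (of m x).rep) (y' := x) fun ω => ?_).trans
      ((dist_of _ _).trans (h0 x)).le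
    change |(1 - ((of m x).rep ω : ℝ)) - (1 - x ω)| ≤ _
    rw [sub_sub_sub_cancel_left, abs_sub_comm]
  · refine (dist_of_le (x' := (of m x).rep) (y' := x) fun ω => ?_).trans
      ((dist_of _ _).trans (h0 x)).le
    change |((of m x).rep ω : ℝ) / 2 - x ω / 2| ≤ _
    rw [← sub_div, abs_div, abs_of_pos (two_pos : (0 : ℝ) < 2)]
    linarith [abs_nonneg (((of m x).rep ω : ℝ) - x ω)]
  · refine (dist_of _ _).le.trans ?_
    have : m.E (fun ω => |((of m x).rep ω : ℝ) - x ω| + |((of m y).rep ω : ℝ) - y ω|) = 0 := by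
      rw [m.add (hb _ _) (hb _ _), h0, h0, add_zero]
    refine le_trans ?_ this.le
    refine m.mono (hb _ _) ((hb _ _).add (hb _ _)) fun ω => ?_
    change |max (((of m x).rep ω : ℝ) - (of m y).rep ω) 0 - max ((x ω : ℝ) - y ω) 0| ≤ _
    refine (abs_max_sub_max_le_abs _ _ _).trans ?_
    rw [sub_sub_sub_comm]
    exact abs_sub _ _

end RandomVar

section Model

variable {L : Signature.{u}} {Ω : Type u} (m : RichMean Ω) (M : Ω → Str L)

/-- Random elements of a family of structures. -/
abbrev RandomPoint : Type u :=
  RandomElement m (fun ω => (M ω).Carrier) fun ω => (M ω).dist_le_one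

/-- The random element given by a family. -/
abbrev RandomPoint.of (x : ∀ ω, (M ω).Carrier) : RandomPoint m M := RandomElement.mk m _ x

theorem dist_func_le {n : ℕ} (f : L.Func n) (i : Fin n) (ε : Set.Ioc (0 : ℝ) 1)
    (x : Fin n → ∀ ω, (M ω).Carrier) (y : ∀ ω, (M ω).Carrier)
    (h : m.E (fun ω => dist (x i ω) (y ω)) < (L.funMod f i).rand ε) :
    m.E (fun ω => dist ((M ω).func f fun j => x j ω)
      ((M ω).func f (Function.update (fun j => x j ω) i (y ω)))) ≤ ε :=
  m.le_of_modulus _ (fun ω => ⟨dist_nonneg, (M ω).dist_le_one _ _⟩)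
    (fun ω => ⟨dist_nonneg, (M ω).dist_le_one _ _⟩)
    (fun ε ω hω => (M ω).func_unif f i ε (fun j => x j ω) (y ω) hω) ε h

/-- The value of a predicate, in the unit interval. -/
def Str.predIcc (M : Str L) {n : ℕ} (P : L.Pred n) (x : Fin n → M.Carrier) : Set.Icc (0 : ℝ) 1 :=
  ⟨M.pred P x, M.pred_mem P x⟩

/-- The distance, in the unit interval. -/
def Str.distIcc (M : Str L) (x y : M.Carrier) : Set.Icc (0 : ℝ) 1 :=
  ⟨dist x y, dist_nonneg, M.dist_le_one x y⟩

theorem dist_pred_le {n : ℕ} (P : L.Pred n) (i : Fin n) (ε : Set.Ioc (0 : ℝ) 1)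
    (x : Fin n → ∀ ω, (M ω).Carrier) (y : ∀ ω, (M ω).Carrier)
    (h : m.E (fun ω => dist (x i ω) (y ω)) < (L.predMod P i).rand ε) :
    m.E (fun ω => dist ((M ω).predIcc P fun j => x j ω)
      ((M ω).predIcc P (Function.update (fun j => x j ω) i (y ω)))) ≤ ε :=
  m.le_of_modulus _ (fun ω => ⟨dist_nonneg, (M ω).dist_le_one _ _⟩)
    (fun _ => ⟨dist_nonneg, dist_Icc_le_one _ _⟩)
    (fun ε ω hω => (M ω).pred_unif P i ε (fun j => x j ω) (y ω) hω) ε h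

theorem rep_update {n : ℕ} (x : Fin n → RandomPoint m M) (i : Fin n) (y : RandomPoint m M) (ω : Ω) :
    (fun j => (Function.update x i y j).rep ω)
      = Function.update (fun j => (x j).rep ω) i (y.rep ω) := by
  funext j
  by_cases hj : j = i
  · subst hj
    simp
  · simp [hj]

theorem dist_rep (x y : RandomPoint m M) : m.E (fun ω => dist (x.rep ω) (y.rep ω)) = dist x y := by
  conv_rhs => rw [← x.mk_rep, ← y.mk_rep]
  exact (RandomElement.dist_mk _ _).symm

theorem dist_distIcc_le (x y z : RandomPoint m M) :
    dist (RandomVar.of m fun ω => (M ω).distIcc (x.rep ω) (z.rep ω))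
      (RandomVar.of m fun ω => (M ω).distIcc (y.rep ω) (z.rep ω)) ≤ dist x y := by
  rw [← dist_rep, RandomVar.dist_of]
  refine m.mono (BddFun.of_mem fun _ => ⟨abs_nonneg _, dist_Icc_le_one _ _⟩)
    (BddFun.of_mem fun ω => ⟨dist_nonneg, (M ω).dist_le_one _ _⟩) fun ω => ?_
  exact abs_dist_sub_le _ _ _

/-- The randomised structure of random elements of a family of structures. -/
def randomisation : RStr L where
  Main := RandomPoint m M
  Aux := RandomVar m
  nonemptyMain := ⟨RandomPoint.of m M fun _ => Classical.arbitrary _⟩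
  zero := RandomVar.of m fun _ => 0
  distMain_le_one := RandomElement.dist_le_one
  distAux_le_one := RandomElement.dist_le_one
  func f x := RandomPoint.of m M fun ω => (M ω).func f fun j => (x j).rep ω
  brDist x y := RandomVar.of m fun ω => (M ω).distIcc (x.rep ω) (y.rep ω)
  brPred P x := RandomVar.of m fun ω => (M ω).predIcc P fun j => (x j).rep ω
  func_unif f i ε x y h := by
    rw [RandomElement.dist_mk]
    simp only [rep_update]
    exact dist_func_le m M f i ε (fun j => (x j).rep) y.rep (by rwa [dist_rep])
  brPred_unif P i ε x y h := by
    rw [RandomElement.dist_mk]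
    simp only [rep_update]
    exact dist_pred_le m M P i ε (fun j => (x j).rep) y.rep (by rwa [dist_rep])
  brDist_unif_left x y z := dist_distIcc_le m M x y z
  brDist_unif_right x y z := by
    have h : ∀ ω (x y : (M ω).Carrier), (M ω).distIcc x y = (M ω).distIcc y x :=
      fun ω x y => Subtype.ext (dist_comm _ _)
    have := dist_distIcc_le m M x y z
    simpa only [h _ _ (z.rep _)] using this
  neg_unif := RandomVar.dist_neg_le
  half_unif := RandomVar.dist_half_le
  tsub_unif_left := RandomVar.dist_tsub_left_le
  tsub_unif_right := RandomVar.dist_tsub_right_le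

namespace randomisation

/-- The random variable given by a function. -/
def rv (x : Ω → Set.Icc (0 : ℝ) 1) : (randomisation m M).Aux := RandomVar.of m x

/-- The random element given by a family. -/
def elt (x : ∀ ω, (M ω).Carrier) : (randomisation m M).Main := RandomPoint.of m M x

variable {m M}

theorem rv_surjective (X : (randomisation m M).Aux) : ∃ x, rv m M x = X :=
  RandomElement.mk_surjective _ _ X

theorem elt_surjective (X : (randomisation m M).Main) : ∃ x, elt m M x = X :=
  RandomElement.mk_surjective _ _ X

theorem isHom_rv : CPL.IsHom (rv m M) :=
  ⟨(RandomVar.isHom_of (m := m)).neg, (RandomVar.isHom_of (m := m)).half,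
    (RandomVar.isHom_of (m := m)).tsub⟩

theorem zero_eq : (randomisation m M).zero = rv m M fun _ => 0 := rfl

theorem dist_rv (x y : Ω → Set.Icc (0 : ℝ) 1) :
    dist (rv m M x) (rv m M y) = m.E fun ω => |(x ω : ℝ) - y ω| := RandomVar.dist_of x y

theorem E_rv (x : Ω → Set.Icc (0 : ℝ) 1) : (randomisation m M).E (rv m M x) = m.E fun ω => x ω := by
  rw [RStr.E, zero_eq, dist_rv]
  congr 1
  funext ω
  rw [show ((0 : Set.Icc (0 : ℝ) 1) : ℝ) = 0 from rfl, sub_zero, abs_of_nonneg (x ω).2.1]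

theorem rv_eq_zero {x : Ω → Set.Icc (0 : ℝ) 1} (h : m.E (fun ω => x ω) = 0) :
    rv m M x = (randomisation m M).zero := by
  rw [← dist_eq_zero]
  exact (E_rv x).trans h

theorem rv_eq_zero_of_forall {x : Ω → Set.Icc (0 : ℝ) 1} (h : ∀ ω, (x ω : ℝ) = 0) :
    rv m M x = (randomisation m M).zero :=
  rv_eq_zero (by simp only [h, m.const])

theorem func_elt {n : ℕ} (f : L.Func n) (x : Fin n → ∀ ω, (M ω).Carrier) :
    (randomisation m M).func f (fun j => elt m M (x j))
      = elt m M fun ω => (M ω).func f fun j => x j ω :=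
  RandomElement.mk_comp_rep (fun ω => (M ω).func f) (fun ε hε i => by
    obtain ⟨ε', h⟩ := exists_modulus_arg hε
    exact ⟨_, ((L.funMod f i).rand ε').2.1, fun x y hxy =>
      (dist_func_le m M f i ε' x y hxy).trans h⟩) x

theorem brPred_elt {n : ℕ} (P : L.Pred n) (x : Fin n → ∀ ω, (M ω).Carrier) :
    (randomisation m M).brPred P (fun j => elt m M (x j))
      = rv m M fun ω => (M ω).predIcc P fun j => x j ω :=
  RandomElement.mk_comp_rep (fun ω => (M ω).predIcc P) (fun ε hε i => by
    obtain ⟨ε', h⟩ := exists_modulus_arg hε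
    exact ⟨_, ((L.predMod P i).rand ε').2.1, fun x y hxy =>
      (dist_pred_le m M P i ε' x y hxy).trans h⟩) x

theorem brDist_elt (x y : ∀ ω, (M ω).Carrier) :
    (randomisation m M).brDist (elt m M x) (elt m M y)
      = rv m M fun ω => (M ω).distIcc (x ω) (y ω) := by
  have h1 := (randomisation m M).brDist_unif_left
  have h2 : ∀ x : ∀ ω, (M ω).Carrier, m.E (fun ω => dist ((elt m M x).rep ω) (x ω)) = 0 := fun x =>
    (RandomElement.dist_mk (hM := fun ω => (M ω).dist_le_one) _ _).symm.trans (by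
      rw [show RandomElement.mk m _ (elt m M x).rep = RandomElement.mk m _ x from
        RandomElement.mk_rep _, dist_self])
  have hb : ∀ x y : ∀ ω, (M ω).Carrier, BddFun fun ω => dist (x ω) (y ω) := fun x y =>
    BddFun.of_mem fun ω => ⟨dist_nonneg, (M ω).dist_le_one _ _⟩
  rw [← dist_le_zero]
  refine (dist_rv _ _).le.trans ?_
  have h3 : m.E (fun ω => dist ((elt m M x).rep ω) (x ω) + dist ((elt m M y).rep ω) (y ω)) = 0 := by
    rw [m.add (hb _ _) (hb _ _), h2, h2, add_zero]
  refine le_trans ?_ h3.le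
  refine m.mono (BddFun.of_mem fun _ => ⟨abs_nonneg _, dist_Icc_le_one _ _⟩)
    ((hb _ _).add (hb _ _)) fun ω => ?_
  exact (dist_dist_dist_le _ _ _ _)

theorem isRV : (randomisation m M).IsRV where
  rv1 X Y := by
    obtain ⟨x, rfl⟩ := rv_surjective X
    obtain ⟨y, rfl⟩ := rv_surjective Y
    rw [← isHom_rv.tsub, ← isHom_rv.inf, E_rv, E_rv, E_rv,
      ← m.add (BddFun.of_mem fun ω => Subtype.property _) (BddFun.of_mem fun ω => Subtype.property _)]
    congr 1
    funext ω
    rw [(CPL.isHom_coe_apply ω).inf, (CPL.isHom_coe_apply ω).tsub,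
      CPL.inf_real (y ω).2.1 (x ω).2.1, CPL.tsub_real]
    grind
  rv2 := by
    rw [zero_eq, ← isHom_rv.neg, E_rv]
    refine Eq.trans ?_ m.one
    congr 1
    funext ω
    change 1 - (0 : ℝ) = 1
    norm_num
  rv3 X Y := by
    obtain ⟨x, rfl⟩ := rv_surjective X
    obtain ⟨y, rfl⟩ := rv_surjective Y
    rw [← isHom_rv.tsub, ← isHom_rv.tsub, E_rv, E_rv, dist_rv,
      ← m.add (BddFun.of_mem fun ω => Subtype.property _) (BddFun.of_mem fun ω => Subtype.property _)]
    congr 1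
    funext ω
    rw [(CPL.isHom_coe_apply ω).tsub, (CPL.isHom_coe_apply ω).tsub, CPL.tsub_real, CPL.tsub_real]
    grind
  rv4 τ hτ X := by
    choose x hx using fun n => rv_surjective (X n)
    obtain rfl : (fun n => rv m M (x n)) = X := funext hx
    rw [← FreeCPL.map_eval isHom_rv x τ]
    refine rv_eq_zero_of_forall fun ω => ?_
    rw [FreeCPL.map_eval (CPL.isHom_coe_apply ω)]
    exact hτ _ fun n => (x n ω).2

theorem controls {δ : Modulus} {d x : Ω → Set.Icc (0 : ℝ) 1}
    (h : ∀ (ε : Set.Ioc (0 : ℝ) 1) ω, (d ω : ℝ) < δ ε → (x ω : ℝ) ≤ ε) :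
    (randomisation m M).Controls δ (rv m M d) (rv m M x) := by
  intro ε k n j l hk hj
  rw [zero_eq, ← isHom_rv.dyadic, ← isHom_rv.dyadic, ← isHom_rv.tsub, ← isHom_rv.tsub,
    ← isHom_rv.inf, ← zero_eq]
  refine rv_eq_zero_of_forall fun ω => ?_
  have h0 : ((0 : Set.Icc (0 : ℝ) 1) : ℝ) = 0 := rfl
  rw [(CPL.isHom_coe_apply ω).inf, (CPL.isHom_coe_apply ω).tsub, (CPL.isHom_coe_apply ω).tsub,
    (CPL.isHom_coe_apply ω).dyadic, (CPL.isHom_coe_apply ω).dyadic, h0, CPL.dyadic_real,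
    CPL.dyadic_real, CPL.tsub_real, CPL.tsub_real,
    CPL.inf_real (le_max_right _ _) (le_max_right _ _)]
  have hx := (x ω).2.2
  rcases lt_or_ge (d ω : ℝ) (δ ε) with hlt | hge
  · have := h ε ω hlt
    grind
  · grind

/-- The halving event of the rich mean is a witness that attains the infimum in the axiom exactly.
-/
theorem isARV : (randomisation m M).IsARV where
  toIsRV := isRV
  arv X := by
    obtain ⟨x, rfl⟩ := rv_surjective X
    obtain ⟨B, hB⟩ := m.half (fun ω => x ω) fun ω => (x ω).2
    let y : Ω → Set.Icc (0 : ℝ) 1 := B.indicator 1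
    have hy : ∀ ω, (y ω : ℝ) = B.indicator 1 ω := fun ω => by
      by_cases hω : ω ∈ B <;> simp [y, hω]
    have : Nonempty (randomisation m M).Aux := ⟨(randomisation m M).zero⟩
    refine le_antisymm ((ciInf_le ⟨0, ?_⟩ (rv m M y)).trans ?_)
      (le_ciInf fun Y => le_max_of_le_left (RStr.IsRV.E_nonneg _))
    · rintro _ ⟨Y, rfl⟩
      exact le_max_of_le_left (RStr.IsRV.E_nonneg _)
    · rw [← isHom_rv.neg, ← isHom_rv.inf, ← isHom_rv.inf, E_rv, E_rv, E_rv]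
      have e1 : ∀ ω, ((CPL.inf y (CPL.neg y) ω : Set.Icc (0 : ℝ) 1) : ℝ) = 0 := fun ω => by
        rw [(CPL.isHom_coe_apply ω).inf, (CPL.isHom_coe_apply ω).neg,
          CPL.inf_real (y ω).2.1 (CPL.neg_mem (y ω).2).1, hy, CPL.neg_real]
        by_cases hω : ω ∈ B <;> simp [hω]
      have e2 : ∀ ω, ((CPL.inf y x ω : Set.Icc (0 : ℝ) 1) : ℝ) = B.indicator (fun ω => (x ω : ℝ)) ω :=
        fun ω => by
          rw [(CPL.isHom_coe_apply ω).inf, CPL.inf_real (y ω).2.1 (x ω).2.1, hy]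
          by_cases hω : ω ∈ B
          · simpa [hω] using (x ω).2.2
          · simpa [hω] using (x ω).2.1
      simp only [e1, e2, m.const]
      have hB' : m.E (fun ω => B.indicator (fun ω => (x ω : ℝ)) ω) = m.E (fun ω => x ω) / 2 := hB
      rw [hB', sub_self, abs_zero, max_self]

theorem brDist_func_update {n : ℕ} (x : Fin n → ∀ ω, (M ω).Carrier) (i : Fin n)
    (y : ∀ ω, (M ω).Carrier) : Function.update (fun j => elt m M (x j)) i (elt m M y)
      = fun j => elt m M fun ω => Function.update (fun j => x j ω) i (y ω) j := by
  funext j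
  by_cases hj : j = i
  · subst hj
    simp
  · simp [hj]

theorem isT0R : (randomisation m M).IsT0R where
  toIsARV := isARV
  r1_func f i X Y := by
    choose x hx using fun j => elt_surjective (X j)
    obtain ⟨y, rfl⟩ := elt_surjective Y
    obtain rfl : (fun j => elt m M (x j)) = X := funext hx
    rw [brDist_func_update, func_elt, func_elt, brDist_elt, brDist_elt]
    exact controls fun ε ω hω => (M ω).func_unif f i ε (fun j => x j ω) (y ω) hω
  r1_pred P i X Y := by
    choose x hx using fun j => elt_surjective (X j)
    obtain ⟨y, rfl⟩ := elt_surjective Y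
    obtain rfl : (fun j => elt m M (x j)) = X := funext hx
    rw [brDist_func_update, brPred_elt, brPred_elt, brDist_elt, ← isHom_rv.tsub]
    refine controls fun ε ω hω => ?_
    rw [(CPL.isHom_coe_apply ω).tsub, CPL.tsub_real]
    exact max_le ((le_abs_self _).trans
      ((M ω).pred_unif P i ε (fun j => x j ω) (y ω) hω)) ε.2.1.le
  r1_dist_left X Y Z := by
    obtain ⟨x, rfl⟩ := elt_surjective X
    obtain ⟨y, rfl⟩ := elt_surjective Y
    obtain ⟨z, rfl⟩ := elt_surjective Z
    rw [brDist_elt, brDist_elt, brDist_elt, ← isHom_rv.tsub]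
    refine controls fun ε ω hω => ?_
    rw [(CPL.isHom_coe_apply ω).tsub, CPL.tsub_real]
    have h1 : dist (x ω) (y ω) < ε := hω
    have h2 := dist_triangle (x ω) (y ω) (z ω)
    refine max_le ?_ ε.2.1.le
    change dist (x ω) (z ω) - dist (y ω) (z ω) ≤ ε
    linarith
  r1_dist_right X Y Z := by
    obtain ⟨x, rfl⟩ := elt_surjective X
    obtain ⟨y, rfl⟩ := elt_surjective Y
    obtain ⟨z, rfl⟩ := elt_surjective Z
    rw [brDist_elt, brDist_elt, brDist_elt, ← isHom_rv.tsub]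
    refine controls fun ε ω hω => ?_
    rw [(CPL.isHom_coe_apply ω).tsub, CPL.tsub_real]
    have h1 : dist (x ω) (y ω) < ε := hω
    have h2 := dist_triangle_right (z ω) (x ω) (y ω)
    refine max_le ?_ ε.2.1.le
    change dist (z ω) (x ω) - dist (z ω) (y ω) ≤ ε
    linarith [dist_triangle (z ω) (y ω) (x ω), dist_comm (x ω) (y ω)]
  r2 X Y := by
    obtain ⟨x, rfl⟩ := elt_surjective X
    obtain ⟨y, rfl⟩ := elt_surjective Y
    rw [brDist_elt, E_rv]
    exact RandomElement.dist_mk _ _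
  r3 X Y U hU := by
    classical
    obtain ⟨x, rfl⟩ := elt_surjective X
    obtain ⟨y, rfl⟩ := elt_surjective Y
    obtain ⟨u, rfl⟩ := rv_surjective U
    -- With `z` equal to `x` where `u > 1/2` and to `y` elsewhere, the random variable in R3 is
    -- pointwise at most `min u (1 - u)`, which has mean `0`.
    let z : ∀ ω, (M ω).Carrier := fun ω => if (1 / 2 : ℝ) < u ω then x ω else y ω
    have hne := (randomisation m M).nonemptyMain
    refine le_antisymm ((ciInf_le ⟨0, ?_⟩ (elt m M z)).trans ?_)
      (le_ciInf fun Y => RStr.IsRV.E_nonneg _)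
    · rintro _ ⟨Y, rfl⟩
      exact RStr.IsRV.E_nonneg _
    · rw [← hU, brDist_elt, brDist_elt, ← isHom_rv.neg, ← isHom_rv.inf, ← isHom_rv.inf,
        ← isHom_rv.inf, ← isHom_rv.sup, E_rv, E_rv]
      refine m.mono (BddFun.of_mem fun ω => Subtype.property _)
        (BddFun.of_mem fun ω => Subtype.property _) fun ω => ?_
      have hd : ∀ a b : (M ω).Carrier, ((M ω).distIcc a b : ℝ) = dist a b := fun a b => rfl
      have h01 := (CPL.neg_mem (u ω).2)
      have hdx := ((M ω).distIcc (x ω) (z ω)).2.1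
      have hdy := ((M ω).distIcc (y ω) (z ω)).2.1
      rw [(CPL.isHom_coe_apply ω).sup, (CPL.isHom_coe_apply ω).inf, (CPL.isHom_coe_apply ω).inf,
        (CPL.isHom_coe_apply ω).inf, (CPL.isHom_coe_apply ω).neg,
        CPL.inf_real (u ω).2.1 h01.1, CPL.inf_real hdx (u ω).2.1, CPL.inf_real hdy h01.1,
        CPL.sup_real (min_le_of_right_le (u ω).2.2) (min_le_of_right_le h01.2),
        hd, hd, CPL.neg_real]
      have hu0 := (u ω).2.1
      have hu1 := (u ω).2.2
      by_cases hω : (1 / 2 : ℝ) < u ω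
      · have hz : z ω = x ω := if_pos hω
        rw [hz, dist_self]
        grind
      · have hz : z ω = y ω := if_neg hω
        rw [hz, dist_self]
        grind

theorem eval_elt {α : Type w} (t : Term L α) (v : α → ∀ ω, (M ω).Carrier) :
    t.eval (randomisation m M).func (fun i => elt m M (v i))
      = elt m M fun ω => t.eval (M ω).func fun i => v i ω := by
  induction t with
  | var x => rfl
  | func f ts ih =>
    simp only [Term.eval, ih]
    rw [func_elt]

/-- The value of a formula, in the unit interval. -/
def valueIcc {I : Type v} {n : ℕ} (φ : BFormula L I n) (a : I → ∀ ω, (M ω).Carrier)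
    (b : Fin n → ∀ ω, (M ω).Carrier) (ω : Ω) : Set.Icc (0 : ℝ) 1 :=
  ⟨φ.value (M ω) (fun i => a i ω) fun j => b j ω, φ.value_mem _ _ _⟩

theorem snoc_apply {n : ℕ} (b : Fin n → ∀ ω, (M ω).Carrier) (c : ∀ ω, (M ω).Carrier) (ω : Ω) :
    (fun j => (Fin.snoc b c : Fin (n + 1) → ∀ ω, (M ω).Carrier) j ω)
      = (Fin.snoc (fun j => b j ω) (c ω) : Fin (n + 1) → (M ω).Carrier) :=
  Rep.comp_snoc (fun x : ∀ ω, (M ω).Carrier => x ω) b c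

theorem auxLE_rv {x y : Ω → Set.Icc (0 : ℝ) 1} :
    (randomisation m M).AuxLE (rv m M x) (rv m M y) ↔
      m.E (fun ω => max ((x ω : ℝ) - y ω) 0) = 0 := by
  rw [RStr.AuxLE, ← isHom_rv.tsub, ← dist_eq_zero]
  exact iff_of_eq (congrArg (· = 0) (E_rv _))

/-- The random variables `⟦φ⟧` are computed pointwise. -/
theorem bracket_elt {I : Type v} (a : I → ∀ ω, (M ω).Carrier) {n : ℕ} (φ : BFormula L I n)
    (b : Fin n → ∀ ω, (M ω).Carrier) :
    φ.bracket (randomisation m M) (fun i => elt m M (a i)) (fun j => elt m M (b j))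
      = rv m M (valueIcc φ a b) := by
  have hvar : ∀ {n : ℕ} (b : Fin n → ∀ ω, (M ω).Carrier),
      (Sum.elim (fun i => elt m M (a i)) fun j => elt m M (b j))
        = fun k => elt m M (Sum.elim a b k) := by
    intro n b
    funext k
    rcases k with i | j <;> rfl
  have hvar' : ∀ {n : ℕ} (b : Fin n → ∀ ω, (M ω).Carrier) (ω : Ω),
      (fun k => Sum.elim a b k ω) = Sum.elim (fun i => a i ω) fun j => b j ω := by
    intro n b ω
    funext k
    rcases k with i | j <;> rfl
  have hinf : ∀ {n : ℕ} (φ : BFormula L I (n + 1)) (b : Fin n → ∀ ω, (M ω).Carrier),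
      (∀ b, φ.bracket (randomisation m M) (fun i => elt m M (a i)) (fun j => elt m M (b j))
        = rv m M (valueIcc φ a b)) →
      φ.inf.bracket (randomisation m M) (fun i => elt m M (a i)) (fun j => elt m M (b j))
        = rv m M (valueIcc φ.inf a b) := by
    intro n φ b ih
    have hc : ∀ c, φ.bracket (randomisation m M) (fun i => elt m M (a i))
        (Fin.snoc (fun j => elt m M (b j)) (elt m M c)) = rv m M (valueIcc φ a (Fin.snoc b c)) := by
      intro c
      rw [← ih]
      congr 1
      exact (Rep.comp_snoc (elt m M) b c).symm
    have hval : ∀ c ω, (valueIcc φ a (Fin.snoc b c) ω : ℝ)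
        = φ.value (M ω) (fun i => a i ω) (Fin.snoc (fun j => b j ω) (c ω)) := by
      intro c ω
      rw [← snoc_apply]
      rfl
    have hbd : ∀ ω, BddBelow (Set.range fun c =>
        φ.value (M ω) (fun i => a i ω) (Fin.snoc (fun j => b j ω) c)) := fun ω =>
      bddBelow_range_of_mem fun c => φ.value_mem _ _ _
    refine Rep.auxInf_eq isRV ?_ fun Z hZ => ?_
    · rintro _ ⟨C, rfl⟩
      obtain ⟨c, rfl⟩ := elt_surjective C
      dsimp only
      rw [hc, auxLE_rv]
      refine Eq.trans ?_ (m.const 0)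
      congr 1
      funext ω
      refine max_eq_right (sub_nonpos.mpr ?_)
      rw [hval]
      exact ciInf_le (hbd ω) (c ω)
    · obtain ⟨z, rfl⟩ := rv_surjective Z
      rw [auxLE_rv]
      have hb1 : ∀ x y : Ω → Set.Icc (0 : ℝ) 1, BddFun fun ω => max ((x ω : ℝ) - y ω) 0 :=
        fun x y => BddFun.of_mem fun ω => CPL.tsub_mem (x ω).2 (y ω).2
      refine le_antisymm (le_of_forall_pos_le_add fun ε hε => ?_)
        (m.nonneg (hb1 _ _) fun ω => le_max_right _ _)
      -- Near-minimisers are chosen independently in each fibre. Every family is a random element,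
      -- so no measurable selection is involved.
      have hex : ∀ ω, ∃ c : (M ω).Carrier,
          φ.value (M ω) (fun i => a i ω) (Fin.snoc (fun j => b j ω) c)
            < valueIcc φ.inf a b ω + ε := fun ω =>
        exists_lt_of_ciInf_lt (lt_add_of_pos_right _ hε)
      choose c hcε using hex
      have h1 := hZ _ ⟨elt m M c, rfl⟩
      dsimp only at h1
      rw [hc, auxLE_rv] at h1
      have h3 := m.add (hb1 z (valueIcc φ a (Fin.snoc b c))) (BddFun.const ε)
      rw [h1, m.const] at h3
      refine le_trans ?_ h3.le
      refine m.mono (hb1 _ _) ((hb1 _ _).add (BddFun.const ε)) fun ω => ?_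
      have h2 := hcε ω
      rw [← hval] at h2
      grind
  induction φ with
  | dist s t =>
    simp only [BFormula.bracket, hvar, eval_elt, brDist_elt, hvar']
    rfl
  | pred P ts =>
    simp only [BFormula.bracket, hvar, eval_elt, hvar']
    rw [brPred_elt]
    rfl
  | neg φ ih =>
    simp only [BFormula.bracket, ih, ← isHom_rv.neg]
    rfl
  | half φ ih =>
    simp only [BFormula.bracket, ih, ← isHom_rv.half]
    rfl
  | tsub φ ψ ih ih' =>
    simp only [BFormula.bracket, ih, ih', ← isHom_rv.tsub]
    rfl
  | inf φ ih => exact hinf φ b ih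
  | sup φ ih =>
    obtain ⟨R⟩ := (isRV (m := m) (M := M)).nonempty_rep
    rw [Rep.bracket_sup isT0R R]
    have h1 := hinf φ.neg b fun b => by
      simp only [BFormula.bracket, ih, ← isHom_rv.neg]
      rfl
    have h2 : φ.neg.inf.neg.bracket (randomisation m M) (fun i => elt m M (a i))
        (fun j => elt m M (b j)) = CPL.neg (φ.neg.inf.bracket (randomisation m M)
          (fun i => elt m M (a i)) (fun j => elt m M (b j))) := rfl
    rw [h2, h1, ← isHom_rv.neg]
    congr 1
    funext ω
    exact Subtype.ext (φ.value_sup (M ω) _ _).symm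

theorem br_elt {I : Type v} (a : I → ∀ ω, (M ω).Carrier) (φ : Formula L I) :
    (randomisation m M).E ((randomisation m M).br (fun i => elt m M (a i)) φ)
      = m.E fun ω => (M ω).tp (fun i => a i ω) φ := by
  have h := bracket_elt (m := m) a φ Fin.elim0
  have e : (fun j : Fin 0 => elt m M (Fin.elim0 (α := ∀ ω, (M ω).Carrier) j))
      = Fin.elim0 (α := (randomisation m M).Main) := funext fun j => j.elim0
  rw [e] at h
  rw [RStr.br, h, E_rv]
  congr 1
  funext ω
  change φ.value (M ω) _ _ = φ.value (M ω) _ _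
  congr 1
  exact funext fun j => j.elim0

theorem modelsR {T : Set (Sentence L)} (hM : ∀ ω, (M ω).Models T) :
    (randomisation m M).ModelsR T := by
  refine ⟨isT0R, fun φ hφ => ?_⟩
  rw [← dist_eq_zero]
  let a : PEmpty.{u + 1} → ∀ ω, (M ω).Carrier := fun i => i.elim
  have h := br_elt (m := m) (M := M) a φ
  have e : (fun i => elt m M (a i)) = fun i => i.elim := funext fun i => i.elim
  rw [e] at h
  refine h.trans (Eq.trans ?_ (m.const 0))
  congr 1
  funext ω
  rw [← hM ω φ hφ, Str.sval]
  congr 1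
  exact funext fun i => i.elim

end randomisation

end Model

/-- Every regular measure on the type space is given by a type of the randomised theory. -/
theorem exists_modelsR_of_measure {L : Signature.{u}} (T : Set (Sentence L)) (I : Type u)
    (μ : RegProb (TypeSpace T I)) : ∃ (N : RStr L) (a : I → N.Main), N.ModelsR T ∧
      ∀ φ : Formula L I, N.E (N.br a φ) = ∫ q, q.1 φ ∂μ.meas := by
  have : IsProbabilityMeasure μ.meas := μ.1.2
  obtain ⟨m₀, hm₀⟩ := exists_mean μ.meas
  obtain ⟨m, hm⟩ := m₀.exists_rich
  -- The sample space consists of copies of the type space, and the fibre over a type is a chosen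
  -- model realising it.
  choose M hMT a ha using fun q : TypeSpace T I => q.2
  refine ⟨randomisation m fun ω => M ω.2.2,
    fun i => randomisation.elt m _ fun ω => a ω.2.2 i,
    randomisation.modelsR fun ω => hMT _, fun φ => ?_⟩
  have hb : BddFun fun q : TypeSpace T I => q.1 φ := BddFun.of_mem fun q => q.apply_mem φ
  rw [randomisation.br_elt, ← hm₀ _ (TypeSpace.continuous_apply φ).measurable hb, ← hm _ hb]
  congr 1
  funext ω
  exact (congrFun (ha ω.2.2) φ).symm

end

end ContLogic

namespace ContLogic

open Filter Topology

noncomputable section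

/-! ### Theories determine the values of sentences -/

/-- A truth assignment is determined by the set of elements of value `0`. -/
theorem CPL.IsHom.eq_of_zero_imp_zero {S : Type*} [CPL S] {h h' : S → ℝ} (hh : CPL.IsHom h)
    (hh' : CPL.IsHom h') (hm : ∀ x, h x ∈ Set.Icc (0 : ℝ) 1) (hm' : ∀ x, h' x ∈ Set.Icc (0 : ℝ) 1)
    {z : S} (hz : h z = 0) (hz' : h' z = 0) (H : ∀ x, h x = 0 → h' x = 0) : h = h' := by
  have key : ∀ x, h' x ≤ h x := by
    intro x
    by_contra! hx
    obtain ⟨y, hy, hy'⟩ := exists_between hx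
    obtain ⟨k, n, hk, hk'⟩ := exists_dyadic_between (hm x).1 hy
    have hk1 : (k : ℝ) / 2 ^ n ≤ 1 := by linarith [(hm' x).2]
    -- The bound `h x ≤ k / 2 ^ n` is the vanishing of a truncated difference, so a dyadic number
    -- separating the two values gives a contradiction.
    have h1 := H (CPL.tsub x (CPL.dyadic z k n)) (by
      rw [hh.tsub, hh.dyadic, hz, CPL.dyadic_real, CPL.tsub_real, min_eq_left hk1]
      exact max_eq_right (by linarith))
    rw [hh'.tsub, hh'.dyadic, hz', CPL.dyadic_real, CPL.tsub_real, min_eq_left hk1] at h1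
    linarith [le_max_left (h' x - (k : ℝ) / 2 ^ n) 0]
  funext x
  refine le_antisymm ?_ (key x)
  have := key (CPL.neg x)
  rw [hh.neg, hh'.neg, CPL.neg_real, CPL.neg_real] at this
  linarith

namespace Str

variable {L : Signature.{u}}

theorem sval_eq_of_theory_eq {M M' : Str L} (h : M.theory = M'.theory) : M.sval = M'.sval :=
  (BFormula.isHom_value M PEmpty.elim Fin.elim0).eq_of_zero_imp_zero
    (BFormula.isHom_value M' PEmpty.elim Fin.elim0) (fun φ => φ.value_mem M _ _)
    (fun φ => φ.value_mem M' _ _) (BFormula.value_zero M _ _) (BFormula.value_zero M' _ _)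
    fun φ hφ => (Set.ext_iff.mp h φ).mp hφ

end Str

namespace RStr

variable {L : Signature.{u}}

theorem sval_eq_of_theory_eq {N N' : RStr L} (h : N.theory = N'.theory) : N.sval = N'.sval :=
  (RBFormula.isHom_value N PEmpty.elim Fin.elim0 Fin.elim0).eq_of_zero_imp_zero
    (RBFormula.isHom_value N' PEmpty.elim Fin.elim0 Fin.elim0) (fun φ => φ.value_mem N _ _ _)
    (fun φ => φ.value_mem N' _ _ _) (z := .distAux .zero .zero) (dist_self N.zero)
    (dist_self N'.zero) fun φ hφ => (Set.ext_iff.mp h φ).mp hφ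

end RStr

/-! ### Image measures -/

/-- The image of a regular probability measure under a continuous map. -/
def RegProb.map {X Y : Type*} [TopologicalSpace X] [MeasurableSpace X] [BorelSpace X]
    [TopologicalSpace Y] [MeasurableSpace Y] [BorelSpace Y] [T2Space Y] (μ : RegProb X)
    {f : X → Y} (hf : Continuous f) : RegProb Y :=
  ⟨μ.1.map hf.measurable.aemeasurable, by
    have : (μ.1 : Measure X).Regular := μ.2
    have : ((μ.1 : Measure X).map f).InnerRegularCompactLTTop :=
      Measure.InnerRegularCompactLTTop.map_of_continuous hf
    change ((μ.1 : Measure X).map f).Regular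
    have : IsProbabilityMeasure ((μ.1 : Measure X).map f) :=
      Measure.isProbabilityMeasure_map hf.measurable.aemeasurable
    infer_instance⟩

theorem RegProb.meas_map {X Y : Type*} [TopologicalSpace X] [MeasurableSpace X] [BorelSpace X]
    [TopologicalSpace Y] [MeasurableSpace Y] [BorelSpace Y] [T2Space Y] (μ : RegProb X)
    {f : X → Y} (hf : Continuous f) : (μ.map hf).meas = μ.meas.map f := rfl

theorem RegProb.ext {X : Type*} [TopologicalSpace X] [MeasurableSpace X] [BorelSpace X]
    {μ ν : RegProb X} (h : μ.meas = ν.meas) : μ = ν :=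
  Subtype.ext (Subtype.ext h)

/-- Homeomorphic spaces have the same regular probability measures. -/
def RegProb.congr {X Y : Type*} [TopologicalSpace X] [MeasurableSpace X] [BorelSpace X]
    [TopologicalSpace Y] [MeasurableSpace Y] [BorelSpace Y] [T2Space X] [T2Space Y]
    (e : X ≃ₜ Y) : RegProb X ≃ RegProb Y where
  toFun μ := μ.map e.continuous
  invFun μ := μ.map e.symm.continuous
  left_inv μ := RegProb.ext (by
    rw [meas_map, meas_map, Measure.map_map e.symm.continuous.measurable e.continuous.measurable,
      e.symm_comp_self, Measure.map_id])
  right_inv μ := RegProb.ext (by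
    rw [meas_map, meas_map, Measure.map_map e.continuous.measurable e.symm.continuous.measurable,
      e.self_comp_symm, Measure.map_id])

instance {X : Type*} [TopologicalSpace X] [MeasurableSpace X] [BorelSpace X] (μ : RegProb X) :
    IsProbabilityMeasure μ.meas := μ.1.2

/-! ### The measure of a type -/

section Nu

variable {L : Signature.{u}} {T : Set (Sentence L)} {I J : Type u}

theorem represents_iff {μ : RegProb (TypeSpace T I)} {p : RTypeSpace T I} :
    Represents μ p ↔ ∀ φ : Formula L I, p.1 φ.expectation = ∫ q, q.1 φ ∂μ.meas := by
  constructor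
  · intro h φ
    obtain ⟨N, hN, a, ha⟩ := p.2
    rw [← h N hN a ha φ, ha, BFormula.value_expectation hN.1]
  · intro h N hN a ha φ
    rw [← h φ, ha, BFormula.value_expectation hN.1]

/-- The measure is the law of the random type `q` of the tuple in the fibres. It is obtained from
the positive functional of expectations, so Borel measurability of `q` is not needed, and regularity
is automatic. -/
theorem exists_represents (p : RTypeSpace T I) : ∃ μ : RegProb (TypeSpace T I),
    Represents μ p := by
  obtain ⟨N, hN, a, ha⟩ := p.2
  obtain ⟨R⟩ := hN.1.nonempty_rep
  let q : R.Ω → TypeSpace T I := fun ω =>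
    ⟨_, R.fib hN.1 ω, R.fib_models hN.1 hN.2 ω, R.pt hN.1 ω ∘ a, rfl⟩
  have hq : ∀ φ ω, (q ω).1 φ = R.r (N.br a φ) ω := fun φ ω => (R.r_br hN.1 a φ ω).symm
  have hE : ∀ φ : Formula L I, N.E (N.br a φ) = ∫ ω, (q ω).1 φ ∂(R.μ) := fun φ => by
    simp only [hq, R.E_eq]
  obtain ⟨μ, hμ, h⟩ := exists_regular_probability (TypeSpace.ev (T := T) (I := I))
    (fun φ => N.E (N.br a φ)) (fun c hc => by
      have : (c.sum fun φ t => t * N.E (N.br a φ))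
          = ∫ ω, c.sum (fun φ t => t * (q ω).1 φ) ∂(R.μ) := by
        simp only [Finsupp.sum]
        rw [integral_finsetSum _ fun φ _ => ?_]
        · simp only [integral_const_mul, hE]
        · simp only [hq]
          exact (R.integrable _).const_mul _
      rw [this]
      exact integral_nonneg fun ω => hc (q ω))
    (BFormula.neg BFormula.zero) (fun k => by
      obtain ⟨M, -, b, hb⟩ := k.2
      change k.1 _ = 1
      rw [hb]
      change 1 - BFormula.zero.value M b _ = 1
      rw [BFormula.value_zero, sub_zero]) (by
      rw [hE]
      have : ∀ ω, (q ω).1 (BFormula.neg BFormula.zero) = 1 := fun ω => by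
        change 1 - BFormula.zero.value _ _ _ = 1
        rw [BFormula.value_zero, sub_zero]
      simp [this])
  refine ⟨⟨μ, hμ⟩, represents_iff.mpr fun φ => ?_⟩
  rw [ha, BFormula.value_expectation hN.1]
  exact (h φ).symm

/-- The measure `ν_p`. -/
def typeMeasure (p : RTypeSpace T I) : RegProb (TypeSpace T I) := (exists_represents p).choose

theorem apply_expectation (p : RTypeSpace T I) (φ : Formula L I) :
    p.1 φ.expectation = ∫ q, q.1 φ ∂(typeMeasure p).meas :=
  represents_iff.mp (exists_represents p).choose_spec φ

theorem represents_iff_eq {μ : RegProb (TypeSpace T I)} {p : RTypeSpace T I} :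
    Represents μ p ↔ μ = typeMeasure p := by
  constructor
  · intro h
    exact TypeSpace.regProb_ext fun φ => by
      rw [← represents_iff.mp h φ, apply_expectation]
  · rintro rfl
    exact (exists_represents p).choose_spec

/-- Quantifier elimination, on types. -/
theorem exists_term_typeMeasure (Φ : RFormula L I) {ε : ℝ} (hε : 0 < ε) :
    ∃ τ : FreeCPL (Formula L I), ∀ p : RTypeSpace T I,
      |p.1 Φ - τ.eval fun φ => ∫ q, q.1 φ ∂(typeMeasure p).meas| ≤ ε := by
  obtain ⟨τ, hτ⟩ := RBFormula.exists_term_abs_sub_le Φ hε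
  refine ⟨τ, fun p => ?_⟩
  obtain ⟨N, hN, a, ha⟩ := p.2
  have e : (fun φ : Formula L I => ∫ q, q.1 φ ∂(typeMeasure p).meas)
      = fun φ => N.E (N.br a φ) := funext fun φ => by
    rw [← apply_expectation, ha, BFormula.value_expectation hN.1]
  rw [e, ha]
  exact hτ N hN.1 a

/-- By quantifier elimination, every value of the type is approximated by a combination of integrals
of formulae. -/
theorem typeMeasure_injective :
    Function.Injective (typeMeasure : RTypeSpace T I → RegProb (TypeSpace T I)) := by
  intro p p' h
  refine Subtype.ext (funext fun Φ => ?_)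
  refine sub_eq_zero.mp (abs_eq_zero.mp (le_antisymm (le_of_forall_pos_le_add fun ε hε => ?_)
    (abs_nonneg _)))
  obtain ⟨τ, hτ⟩ := exists_term_typeMeasure (T := T) Φ (half_pos hε)
  have h1 := hτ p
  have h2 := hτ p'
  rw [h] at h1
  rw [abs_le] at h1 h2 ⊢
  constructor <;> linarith

theorem typeMeasure_surjective :
    Function.Surjective (typeMeasure : RTypeSpace T I → RegProb (TypeSpace T I)) := by
  intro μ
  obtain ⟨N, a, hN, h⟩ := exists_modelsR_of_measure T I μ
  refine ⟨⟨N.tp a, N, hN, a, rfl⟩, (represents_iff_eq.mp (represents_iff.mpr fun φ => ?_)).symm⟩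
  rw [← h φ]
  exact BFormula.value_expectation hN.1 a φ

theorem RTypeSpace.continuous_apply (Φ : RFormula L I) :
    Continuous fun p : RTypeSpace T I => p.1 Φ :=
  (_root_.continuous_apply Φ).comp continuous_induced_dom

theorem RegProb.continuous_integral {X : Type*} [TopologicalSpace X] [MeasurableSpace X]
    [BorelSpace X] [CompactSpace X] (F : C(X, ℝ)) :
    Continuous fun μ : RegProb X => ∫ x, F x ∂μ.meas :=
  (ProbabilityMeasure.continuous_integral_continuousMap F).comp continuous_induced_dom

/-- An integral of a continuous function is a uniform limit of affine functions of the `E⟦φ⟧`, which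
are continuous on the type space because they are values of formulae. -/
theorem continuous_typeMeasure :
    Continuous (typeMeasure : RTypeSpace T I → RegProb (TypeSpace T I)) := by
  refine continuous_induced_rng.mpr
    (ProbabilityMeasure.continuous_iff_forall_continuousMap_continuous_integral.mpr fun F => ?_)
  refine continuous_of_uniform_approx_of_continuous fun s hs => ?_
  obtain ⟨ε, hε, hs⟩ := Metric.mem_uniformity_dist.mp hs
  obtain ⟨φ, c, d, h⟩ := TypeSpace.exists_formula_abs_sub_le F (half_pos hε)
  refine ⟨fun p => c * p.1 φ.expectation + d,
    (continuous_const.mul (RTypeSpace.continuous_apply _)).add continuous_const, fun p => hs ?_⟩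
  change dist (∫ q, F q ∂(typeMeasure p).meas) (c * p.1 φ.expectation + d) < ε
  rw [apply_expectation, Real.dist_eq]
  exact (TypeSpace.abs_integral_sub_le (μ := (typeMeasure p).meas) h).trans_lt (half_lt_self hε)

variable (T I) in
/-- The homeomorphism `p ↦ ν_p`. -/
def typeMeasureHomeo : RTypeSpace T I ≃ₜ RegProb (TypeSpace T I) where
  toEquiv := Equiv.ofBijective typeMeasure ⟨typeMeasure_injective, typeMeasure_surjective⟩
  continuous_toFun := continuous_typeMeasure
  continuous_invFun := by
    refine continuous_induced_rng.mpr (continuous_pi fun Φ => ?_)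
    refine continuous_of_uniform_approx_of_continuous fun s hs => ?_
    obtain ⟨ε, hε, hs⟩ := Metric.mem_uniformity_dist.mp hs
    -- By quantifier elimination, each coordinate of the inverse is a uniform limit of connectives
    -- applied to integrals of formulae, which are continuous in the measure.
    obtain ⟨τ, hτ⟩ := exists_term_typeMeasure (T := T) Φ (half_pos hε)
    refine ⟨fun μ => τ.eval fun φ => ∫ q, q.1 φ ∂μ.meas,
      FreeCPL.continuous_eval (fun φ => RegProb.continuous_integral (TypeSpace.ev φ)) τ,
      fun μ => hs ?_⟩
    obtain ⟨p, rfl⟩ := typeMeasure_surjective μ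
    have : (Equiv.ofBijective typeMeasure
        ⟨typeMeasure_injective, typeMeasure_surjective⟩).symm (typeMeasure p) = p :=
      Equiv.ofBijective_symm_apply_apply _ _ p
    refine lt_of_le_of_lt ?_ (half_lt_self hε)
    change dist (((Equiv.ofBijective typeMeasure
      ⟨typeMeasure_injective, typeMeasure_surjective⟩).symm (typeMeasure p)).1 Φ) _ ≤ _
    rw [this, Real.dist_eq]
    exact hτ p

theorem TypeSpace.continuous_map (g : I → J) : Continuous (TypeSpace.map T g) :=
  continuous_induced_rng.mpr (continuous_pi fun φ => TypeSpace.continuous_apply (φ.relabel g))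

theorem br_relabel {N : RStr L} (h : N.IsT0R) (g : I → J) (a : J → N.Main) (φ : Formula L I) :
    N.br a (φ.relabel g) = N.br (a ∘ g) φ := by
  obtain ⟨R⟩ := h.nonempty_rep
  refine R.ext h.toIsRV fun ω => ?_
  rw [R.r_br h, R.r_br h]
  exact φ.value_relabel _ g _ _

theorem typeMeasure_map (g : I → J) (p : RTypeSpace T J) :
    (typeMeasure (RTypeSpace.map T g p)).meas = (typeMeasure p).meas.map (TypeSpace.map T g) := by
  rw [← RegProb.meas_map _ (TypeSpace.continuous_map g)]
  congr 1
  refine (represents_iff_eq.mp (represents_iff.mpr fun φ => ?_)).symm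
  rw [RegProb.meas_map, integral_map (TypeSpace.continuous_map g).measurable.aemeasurable
    (TypeSpace.continuous_apply φ).measurable.aestronglyMeasurable]
  change _ = ∫ q, q.1 (φ.relabel g) ∂(typeMeasure p).meas
  rw [← apply_expectation]
  obtain ⟨N, hN, a, ha⟩ := p.2
  change p.1 (φ.expectation.relabel g) = _
  rw [ha, BFormula.value_expectation hN.1, br_relabel hN.1, ← BFormula.value_expectation hN.1]
  exact RBFormula.value_relabel N g a _ _ _

end Nu

/-! ### Completions -/

section Completions

variable {L : Signature.{u}} {T : Set (Sentence L)}

namespace Completion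

theorem sval_eq (C : Completion T) {M : Str L} (h : C.1 = M.theory) : C.sval = M.sval :=
  Str.sval_eq_of_theory_eq (C.2.choose_spec.2.symm.trans h)

theorem mem_iff (C : Completion T) (φ : Sentence L) : φ ∈ C.1 ↔ C.sval φ = 0 :=
  Set.ext_iff.mp C.2.choose_spec.2 φ

theorem isHom_sval (C : Completion T) : CPL.IsHom C.sval := BFormula.isHom_value _ _ _

theorem sval_mem (C : Completion T) (φ : Sentence L) : C.sval φ ∈ Set.Icc (0 : ℝ) 1 :=
  φ.value_mem _ _ _

theorem sval_zero (C : Completion T) : C.sval BFormula.zero = 0 := BFormula.value_zero _ _ _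

theorem isOpen_notMem (φ : Sentence L) : IsOpen {C : Completion T | φ ∉ C.1} :=
  TopologicalSpace.isOpen_generateFrom_of_mem ⟨φ, rfl⟩

/-- A dyadic number strictly between two values turns both strict inequalities into non-membership
of a sentence, that is, into basic open sets. -/
instance : T2Space (Completion T) := by
  have sep : ∀ (C C' : Completion T) (φ : Sentence L), C.sval φ < C'.sval φ →
      ∃ U V : Set (Completion T), IsOpen U ∧ IsOpen V ∧ C ∈ U ∧ C' ∈ V ∧ Disjoint U V := by
    intro C C' φ h
    obtain ⟨y, hy, hy'⟩ := exists_between h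
    obtain ⟨k, n, hk, hk'⟩ := exists_dyadic_between (C.sval_mem φ).1 hy
    have hk1 : (k : ℝ) / 2 ^ n ≤ 1 := by linarith [(C'.sval_mem φ).2]
    have hd : ∀ D : Completion T, D.sval (CPL.dyadic BFormula.zero k n) = (k : ℝ) / 2 ^ n :=
      fun D => by rw [D.isHom_sval.dyadic, D.sval_zero, CPL.dyadic_real, min_eq_left hk1]
    have h1 : ∀ D : Completion T,
        CPL.tsub (CPL.dyadic BFormula.zero k n) φ ∉ D.1 ↔ D.sval φ < (k : ℝ) / 2 ^ n := by
      intro D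
      rw [D.mem_iff, D.isHom_sval.tsub, hd, CPL.tsub_real, max_eq_right_iff, sub_nonpos, not_le]
    have h2 : ∀ D : Completion T,
        CPL.tsub φ (CPL.dyadic BFormula.zero k n) ∉ D.1 ↔ (k : ℝ) / 2 ^ n < D.sval φ := by
      intro D
      rw [D.mem_iff, D.isHom_sval.tsub, hd, CPL.tsub_real, max_eq_right_iff, sub_nonpos, not_le]
    refine ⟨_, _, isOpen_notMem _, isOpen_notMem _, (h1 C).mpr hk,
      (h2 C').mpr (hk'.trans_lt hy'), Set.disjoint_left.mpr fun D hD hD' => ?_⟩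
    exact lt_asymm ((h1 D).mp hD) ((h2 D).mp hD')
  refine ⟨fun C C' hC => ?_⟩
  obtain ⟨φ, hφ⟩ : ∃ φ, C.sval φ ≠ C'.sval φ := by
    by_contra! h
    exact hC (Subtype.ext (Set.ext fun φ => by rw [C.mem_iff, C'.mem_iff, h]))
  rcases lt_or_gt_of_ne hφ with h | h
  · exact sep C C' φ h
  · obtain ⟨U, V, hU, hV, h1, h2, h3⟩ := sep C' C φ h
    exact ⟨V, U, hV, hU, h2, h1, h3.symm⟩

end Completion

variable (T) in
/-- Complete types in no variables correspond to completions. -/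
def completionEquiv : TypeSpace T PEmpty.{u + 1} ≃ Completion T where
  toFun q := ⟨{φ | q.1 φ = 0}, by
    obtain ⟨M, hM, a, ha⟩ := q.2
    refine ⟨M, hM, ?_⟩
    rw [ha, Subsingleton.elim a PEmpty.elim]
    rfl⟩
  invFun C := ⟨C.sval, C.2.choose, C.2.choose_spec.1, PEmpty.elim, rfl⟩
  left_inv q := by
    obtain ⟨M, hM, a, ha⟩ := q.2
    refine Subtype.ext (Completion.sval_eq _ (M := M) ?_ |>.trans ?_)
    · change {φ | q.1 φ = 0} = _
      rw [ha, Subsingleton.elim a PEmpty.elim]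
      rfl
    · rw [ha, Subsingleton.elim a PEmpty.elim]
      rfl
  right_inv C := Subtype.ext (Set.ext fun φ => (C.mem_iff φ).symm)

theorem sval_completionEquiv (q : TypeSpace T PEmpty.{u + 1}) (φ : Sentence L) :
    (completionEquiv T q).sval φ = q.1 φ :=
  congrFun (Subtype.ext_iff.mp ((completionEquiv T).symm_apply_apply q)) φ

variable (T) in
/-- The homeomorphism between the complete types in no variables and the completions. -/
def completionHomeo : TypeSpace T PEmpty.{u + 1} ≃ₜ Completion T :=
  Continuous.homeoOfEquivCompactToT2 (f := completionEquiv T) (continuous_generateFrom_iff.mpr (by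
    rintro _ ⟨φ, rfl⟩
    exact isOpen_ne.preimage (TypeSpace.continuous_apply φ)))

theorem RCompletion.sval_choose_eq (C : RCompletion T) {N : RStr L} (h : C.1 = N.theory) :
    C.2.choose.sval = N.sval :=
  RStr.sval_eq_of_theory_eq (C.2.choose_spec.2.symm.trans h)

variable (T) in
/-- Complete types of the randomised theory in no variables correspond to its completions. -/
def rCompletionEquiv : RTypeSpace T PEmpty.{u + 1} ≃ RCompletion T where
  toFun p := ⟨{φ | p.1 φ = 0}, by
    obtain ⟨N, hN, a, ha⟩ := p.2
    refine ⟨N, hN, ?_⟩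
    rw [ha, Subsingleton.elim a PEmpty.elim]
    rfl⟩
  invFun C := ⟨C.2.choose.sval, C.2.choose, C.2.choose_spec.1, PEmpty.elim, rfl⟩
  left_inv p := by
    obtain ⟨N, hN, a, ha⟩ := p.2
    refine Subtype.ext (RCompletion.sval_choose_eq _ (N := N) ?_ |>.trans ?_)
    · change {φ | p.1 φ = 0} = _
      rw [ha, Subsingleton.elim a PEmpty.elim]
      rfl
    · rw [ha, Subsingleton.elim a PEmpty.elim]
      rfl
  right_inv C := Subtype.ext C.2.choose_spec.2.symm

variable (T) in
/-- The completions of `T^R` correspond to the regular measures on the space of completions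
of `T`. -/
def completionMeasure : RCompletion T ≃ RegProb (Completion T) :=
  (rCompletionEquiv T).symm.trans
    ((typeMeasureHomeo T PEmpty.{u + 1}).toEquiv.trans (RegProb.congr (completionHomeo T)))

theorem integral_completionMeasure {N : RStr L} (hN : N.ModelsR T) (φ : Sentence L) :
    N.E (N.br PEmpty.elim φ)
      = ∫ C, C.sval φ ∂(completionMeasure T ⟨N.theory, N, hN, rfl⟩).meas := by
  let p : RTypeSpace T PEmpty.{u + 1} := ⟨N.tp PEmpty.elim, N, hN, PEmpty.elim, rfl⟩
  have hp : (rCompletionEquiv T).symm ⟨N.theory, N, hN, rfl⟩ = p :=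
    (Equiv.symm_apply_eq _).mpr rfl
  have h : completionMeasure T ⟨N.theory, N, hN, rfl⟩
      = (typeMeasure p).map (completionHomeo T).continuous := by
    rw [← hp]
    rfl
  rw [h, RegProb.meas_map, (completionHomeo T).measurableEmbedding.integral_map,
    ← BFormula.value_expectation hN.1]
  refine (apply_expectation p φ).trans (integral_congr_ae (Eventually.of_forall fun q => ?_))
  exact (sval_completionEquiv q φ).symm

theorem E_br_eq_of_complete (hT : IsCompleteTheory T) {M : Str L} (hM : M.Models T) {N : RStr L}
    (hN : N.ModelsR T) (φ : Sentence L) : N.E (N.br PEmpty.elim φ) = M.sval φ := by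
  obtain ⟨R⟩ := hN.1.nonempty_rep
  -- All fibres are models of the complete theory `T`, so the random variable `⟦φ⟧` is constant.
  have : ∀ ω, R.r (N.br PEmpty.elim φ) ω = M.sval φ := by
    intro ω
    rw [R.r_br hN.1, ← hT.2 _ _ (R.fib_models hN.1 hN.2 ω) hM φ, Str.sval]
    congr 1
    exact Subsingleton.elim _ _
  simp [R.E_eq, this]

theorem isCompleteTheoryR (hT : IsCompleteTheory T) : IsCompleteTheoryR T := by
  obtain ⟨M, hM⟩ := hT.1
  constructor
  · obtain ⟨m₀, -⟩ := exists_mean (Measure.dirac PUnit.unit.{u + 1})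
    obtain ⟨m, -⟩ := m₀.exists_rich
    exact ⟨randomisation m fun _ => M, randomisation.modelsR fun _ => hM⟩
  · intro N N' hN hN' Φ
    refine sub_eq_zero.mp (abs_eq_zero.mp (le_antisymm (le_of_forall_pos_le_add fun ε hε => ?_)
      (abs_nonneg _)))
    obtain ⟨τ, hτ⟩ := RBFormula.exists_term_abs_sub_le Φ (half_pos hε)
    have h1 := hτ N hN.1 PEmpty.elim
    have h2 := hτ N' hN'.1 PEmpty.elim
    simp only [E_br_eq_of_complete hT hM hN] at h1
    simp only [E_br_eq_of_complete hT hM hN'] at h2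
    rw [abs_le] at h1 h2 ⊢
    simp only [RStr.sval]
    constructor <;> linarith

end Completions

end

end ContLogic

theorem mainTheorem4 (L : Signature.{u}) (T : Set (Sentence L)) :
    -- Quantifier elimination in the main sort down to the formulae `E⟦φ⟧`.
    (∀ (I : Type u) (Φ : RFormula L I) (ε : ℝ), 0 < ε → ∃ τ : FreeCPL (Formula L I),
      ∀ N : RStr L, N.ModelsR T → ∀ a : I → N.Main,
        |N.tp a Φ - τ.eval (fun φ => N.E (N.br a φ))| ≤ ε) ∧
    -- The homeomorphism `p ↦ ν_p` and its naturality.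
    (∃ ν : ∀ I : Type u, RTypeSpace T I ≃ₜ RegProb (TypeSpace T I),
      (∀ (I : Type u) (p : RTypeSpace T I) (μ : RegProb (TypeSpace T I)),
        Represents μ p ↔ μ = ν I p) ∧
      (∀ (I J : Type u) (g : I → J) (p : RTypeSpace T J),
        (ν I (RTypeSpace.map T g p)).meas = (ν J p).meas.map (TypeSpace.map T g))) ∧
    -- Completions.
    (∃ β : RCompletion T ≃ RegProb (Completion T),
      ∀ (N : RStr L) (hN : N.ModelsR T) (φ : Sentence L),
        N.E (N.br PEmpty.elim φ) = ∫ C, C.sval φ ∂(β ⟨N.theory, N, hN, rfl⟩).meas) ∧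
    (IsCompleteTheory T → IsCompleteTheoryR T) := by
  refine ⟨fun I Φ ε hε => ?_, ⟨typeMeasureHomeo T, fun I p μ => represents_iff_eq,
    fun I J g p => typeMeasure_map g p⟩,
    ⟨completionMeasure T, fun N hN φ => integral_completionMeasure hN φ⟩, isCompleteTheoryR⟩
  obtain ⟨τ, hτ⟩ := RBFormula.exists_term_abs_sub_le Φ hε
  exact ⟨τ, fun N hN a => hτ N hN.1 a⟩
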